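/- Let $\mathbb K$ be $\mathbb R$ or the torus $\mathbb T=\mathbb R/2\pi\mathbb Z$ (with its geodesic distance), let $\mathcal P(\mathbb K)$ be the set of Borel probability measures on $\mathbb K$, and let $$d_W(\nu_1,\nu_2)=\sup\Big\{\int_{\mathbb K}\psi\,d(\nu_2-\nu_1)\ :\ \psi\in C_b(\mathbb K),\ \|\psi\|_{\mathrm{Lip}}\le 1\Big\}\in[0,\infty]$$ be the 1-Wasserstein distance. Let $V$ assign to each $\nu\in\mathcal P(\mathbb K)$ a function $V[\nu]:\mathbb K\to\mathbb R$ such that for some constants $C_1,C_2,C_3>0$ and all $\nu,\nu_1,\nu_2\in\mathcal P(\mathbb K)$, $x,y\in\mathbb K$, (A1) $|V[\nu](x)|\le C_1$, (A2) $|V[\nu](x)-V[\nu](y)|\le C_2|x-y|$ (on $\mathbb T$, $|x-y|$ is the geodesic distance), (A3) $|V[\nu_1](x)-V[\nu_2](x)|\le C_3\,d_W(\nu_1,\nu_2)$. Let $\mu_0\in\mathcal P(\mathbb K)$ have compact support. A measure-valued solution of $\partial_t\mu+\partial_x(V[\mu]\mu)=0$ with initial datum $\mu_0$ is a map $[0,\infty)\to\mathcal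 P(\mathbb K)$, $t\mapsto\mu_t$, such that $t\mapsto\int f\,d\mu_t$ is continuous for every $f\in C_0(\mathbb K)$ and, for every $\varphi\in C_c^\infty(\mathbb K\times[0,\infty))$, $$\int_0^\infty\int_{\mathbb K}\big(\partial_t\varphi(x,t)+V[\mu_t](x)\,\partial_x\varphi(x,t)\big)\,d\mu_t(x)\,dt+\int_{\mathbb K}\varphi(x,0)\,d\mu_0(x)=0,$$ where the inner integral is required to be an integrable function of $t\in(0,\infty)$. Consider a uniform mesh of $\mathbb K$ with cells of length $\Delta x>0$ and midpoints $x_i=x_0+i\Delta x$, $x_0\in\mathbb R$, where $i\in I:=\mathbb Z$ if $\mathbb K=\mathbb R$; if $\mathbb K=\mathbb T$, then $i\in I:=\{1,\dots,N_x\}$ with $N_x\Delta x=2\pi$, and indices are understood periodically. For a time step $\Delta t>0$ let $t^n=n\Delta t$ and define the unstaggered Lax–Friedrichs scheme by $$\mu_i^0=\int_{\mathbb K}\psi_i\,d\mu_0,\qquad \mu_i^{n+1}=\frac{\mu_{i-1}^n+\mu_{i+1}^n}{2}-\Delta t\,\frac{V[\mu^n](x_{i+1})\mu_{i+1}^n-V[\mu^n](x_{i-1})\mu_{i-1}^n}{2\Delta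 x},\qquad \mu^n=\sum_{i\in I}\mu_i^n\delta_{x_i},$$ where $\psi_i(x)=\max\{0,1-|x-x_i|/\Delta x\}$, and let $$\mu_t^{\Delta x}=\frac{t^{n+1}-t}{\Delta t}\mu^n+\frac{t-t^n}{\Delta t}\mu^{n+1}\qquad\text{for }t\in[t^n,t^{n+1}),\ n=0,1,2,\dots$$ Then there is exactly one measure-valued solution $\mu$ with initial datum $\mu_0$, and for every $\lambda_0>0$ and every $T>0$, $$\sup_{t\in[0,T]}d_W\big(\mu_t^{\Delta x},\mu_t\big)\to 0\qquad\text{as }\Delta x\to0,$$ uniformly over all such meshes of width $\Delta x$ and all time steps $\Delta t$ satisfying the CFL condition $\lambda_0\le\Delta t/\Delta x\le C_1^{-1}$. -/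

import Mathlib

open MeasureTheory Set
open scoped ENNReal ContDiff ZeroAtInfty BoundedContinuousFunction

noncomputable section

namespace LaxFriedrichs

/-- The two possible one-dimensional spatial domains: the real line and the torus. -/
inductive Domain : Type
  | line
  | torus

/-- The underlying space: `ℝ`, respectively `ℝ / 2πℤ` (with its geodesic metric). -/
@[reducible] def Domain.Carrier : Domain → Type
  | .line => ℝ
  | .torus => AddCircle (2 * Real.pi)

instance : CoeSort Domain Type := ⟨Domain.Carrier⟩

instance (K : Domain) : NormedAddCommGroup K :=
  match K with
  | .line => inferInstanceAs (NormedAddCommGroup ℝ)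
  | .torus => inferInstanceAs (NormedAddCommGroup (AddCircle (2 * Real.pi)))

instance (K : Domain) : MeasurableSpace K :=
  match K with
  | .line => inferInstanceAs (MeasurableSpace ℝ)
  | .torus => inferInstanceAs (MeasurableSpace (AddCircle (2 * Real.pi)))

instance (K : Domain) : BorelSpace K :=
  match K with
  | .line => inferInstanceAs (BorelSpace ℝ)
  | .torus => inferInstanceAs (BorelSpace (AddCircle (2 * Real.pi)))

/-- The canonical map `ℝ → K`: the identity for the line, the quotient map for the torus. -/
def Domain.proj (K : Domain) : ℝ → K :=
  match K with
  | .line => fun y => y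
  | .torus => fun y => (y : AddCircle (2 * Real.pi))

/-- The 1-Wasserstein distance in its dual form, with values in `[0, ∞]`: the supremum of
`∫ ψ d(ν₂ - ν₁)` over all bounded continuous `ψ` with Lipschitz constant at most `1`.
(The class of such `ψ` is symmetric, so cutting off negative values changes nothing.) -/
def wassersteinDist {X : Type*} [PseudoMetricSpace X] [MeasurableSpace X]
    (ν₁ ν₂ : Measure X) : ℝ≥0∞ :=
  ⨆ (ψ : X →ᵇ ℝ) (_ : LipschitzWith 1 ψ),
    ENNReal.ofReal ((∫ x, ψ x ∂ν₂) - ∫ x, ψ x ∂ν₁)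

variable {K : Domain}

/-- Spatial derivative `∂ₓ φ(x, t)` of a function on `K × ℝ`. -/
def spaceDeriv (φ : K × ℝ → ℝ) (x : K) (t : ℝ) : ℝ :=
  deriv (fun h : ℝ => φ (x + K.proj h, t)) 0

/-- Time derivative `∂ₜ φ(x, t)` of a function on `K × ℝ`. -/
def timeDeriv (φ : K × ℝ → ℝ) (x : K) (t : ℝ) : ℝ :=
  deriv (fun s : ℝ => φ (x, s)) t

/-- Smooth compactly supported test functions on `K × ℝ`; their restrictions to `t ≥ 0` are the
test functions on `K × [0, ∞)`. Smoothness on the torus is smoothness of the periodic lift. -/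
structure IsTestFunction (φ : K × ℝ → ℝ) : Prop where
  smooth : ContDiff ℝ ∞ (fun y : ℝ × ℝ => φ (K.proj y.1, y.2))
  compactSupport : HasCompactSupport φ

/-- `μ`, regarded as a map `[0, ∞) → 𝒫(K)` (its values at negative times play no role), is a
measure-valued solution of `∂ₜ μ + ∂ₓ (V[μ] μ) = 0` with initial datum `μ₀`: it is weakly
continuous and satisfies the equation in the sense of distributions, the time integral being
an honest (convergent) one. -/
structure IsMeasureValuedSolution (V : Measure K → K → ℝ) (μ₀ : ProbabilityMeasure K)
    (μ : ℝ → ProbabilityMeasure K) : Prop where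
  weaklyContinuous : ∀ f : C₀(K, ℝ), ContinuousOn (fun t => ∫ x, f x ∂(μ t : Measure K)) (Ici 0)
  integrable : ∀ φ : K × ℝ → ℝ, IsTestFunction φ →
    IntegrableOn (fun t : ℝ => ∫ x, (timeDeriv φ x t + V (μ t : Measure K) x * spaceDeriv φ x t)
      ∂(μ t : Measure K)) (Ioi 0)
  equation : ∀ φ : K × ℝ → ℝ, IsTestFunction φ →
    (∫ t in Ioi (0 : ℝ), ∫ x, (timeDeriv φ x t + V (μ t : Measure K) x * spaceDeriv φ x t)
      ∂(μ t : Measure K)) + ∫ x, φ (x, 0) ∂(μ₀ : Measure K) = 0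

/-- The admissible index sets of the cells of a uniform mesh of width `h`: all of `ℤ` for the line,
and `{1, …, N}` with `N h = 2π` for the torus. -/
def Domain.IsIndexSet (K : Domain) (h : ℝ) (I : Set ℤ) : Prop :=
  match K with
  | .line => I = univ
  | .torus => ∃ N : ℕ, I = Icc 1 (N : ℤ) ∧ N * h = 2 * Real.pi

/-- A uniform mesh on `K`, with cells `[xᵢ - Δx/2, xᵢ + Δx/2)`, `i ∈ index`, where
`xᵢ = origin + i Δx` (modulo `2π` on the torus). -/
structure Mesh (K : Domain) where
  origin : ℝ
  dx : ℝ
  dx_pos : 0 < dx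
  index : Set ℤ
  isIndexSet : K.IsIndexSet dx index

namespace Mesh

variable (M : Mesh K)

/-- The cell midpoint `xᵢ`. It is defined for all `i ∈ ℤ`; on the torus it is periodic in `i`. -/
def center (i : ℤ) : K := K.proj (M.origin + i * M.dx)

/-- The hat function `ψᵢ` centred at `xᵢ`, vanishing at distance at least `Δx` from `xᵢ`. -/
def hat (i : ℤ) (x : K) : ℝ := max 0 (1 - dist x (M.center i) / M.dx)

/-- The atomic measure `∑ᵢ aᵢ δ_{xᵢ}` over the cells of the mesh (for weights `aᵢ ≥ 0`, which is
the only case that occurs for the scheme under the CFL condition). -/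
def atomic (a : ℤ → ℝ) : Measure K :=
  Measure.sum fun i : M.index => ENNReal.ofReal (a i) • Measure.dirac (M.center i)

/-- One time step of the unstaggered Lax–Friedrichs scheme, from the weights `a = (μᵢⁿ)ᵢ` to the
weights `(μᵢⁿ⁺¹)ᵢ`; here `μⁿ = M.atomic a`. -/
def step (V : Measure K → K → ℝ) (dt : ℝ) (a : ℤ → ℝ) (i : ℤ) : ℝ :=
  (a (i - 1) + a (i + 1)) / 2
    - dt * ((V (M.atomic a) (M.center (i + 1)) * a (i + 1)
        - V (M.atomic a) (M.center (i - 1)) * a (i - 1)) / (2 * M.dx))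

/-- The weights `μᵢⁿ` of the unstaggered Lax–Friedrichs scheme with time step `dt`. They are indexed
by `i ∈ ℤ`; on the torus they are periodic in `i`. -/
def weight (V : Measure K → K → ℝ) (μ₀ : Measure K) (dt : ℝ) : ℕ → ℤ → ℝ
  | 0 => fun i => ∫ x, M.hat i x ∂μ₀
  | n + 1 => M.step V dt (weight V μ₀ dt n)

/-- The discrete solution `μⁿ = ∑ᵢ μᵢⁿ δ_{xᵢ}` at time `tⁿ = n dt`. -/
def discrete (V : Measure K → K → ℝ) (μ₀ : Measure K) (dt : ℝ) (n : ℕ) : Measure K :=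
  M.atomic (M.weight V μ₀ dt n)

/-- The piecewise linear interpolant in time, for `t ≥ 0`:
`(tⁿ⁺¹ - t)/dt μⁿ + (t - tⁿ)/dt μⁿ⁺¹` for `t ∈ [tⁿ, tⁿ⁺¹)`. -/
def interpolant (V : Measure K → K → ℝ) (μ₀ : Measure K) (dt t : ℝ) : Measure K :=
  let n := ⌊t / dt⌋₊
  ENNReal.ofReal (((n + 1) * dt - t) / dt) • M.discrete V μ₀ dt n
    + ENNReal.ofReal ((t - n * dt) / dt) • M.discrete V μ₀ dt (n + 1)

end Mesh

end LaxFriedrichs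

end

open LaxFriedrichs

/-! Existence. Choose a measure `m` on `ℝ` that projects to `μ₀` and look for the solution as the
law in `K` of `y + Z t y`, with `y` distributed by `m`. The displacement `Z t` determines this law,
so the nonlocal transport equation becomes an autonomous ODE in the Banach space of bounded
continuous functions. Its right-hand side is bounded by `C₁` and Lipschitz with constant `C₂ + C₃`,
so a global solution exists (`IsVelocity.exists_flow`), and differentiating test functions along it
gives the weak form (`flow_isMeasureValuedSolution`). Working with trajectories in `ℝ` treats the
line and the torus together.

Convergence. Under the CFL condition the coefficients `(1 ± λ v) / 2` of the scheme are the
transition probabilities of a nearest-neighbour random walk on the mesh, and the discrete solution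
is the law of that walk (`Mesh.weight_spec`, `Mesh.integral_discrete`). The mean displacement in one
step is `dt * v`, which follows the characteristic; the fluctuation adds only `O(dx²)` to the mean
square distance from it. That distance also bounds the Wasserstein distance, hence the velocity
error, so a discrete Gronwall argument closes (`Mesh.expect_sq_le`). Over `n ≤ T / dt ≤ T / (λ₀ dx)`
steps the mean square error is `O(dx)` (`Mesh.errorBound_le`), which is `O(√dx)` in Wasserstein
distance.

Uniqueness. An arbitrary solution `μ` is compared with the flow solution `ν` by duality. A test
function at time `T` is pulled back by explicit Euler steps for a mollification of `V[ν]`; both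
solutions nearly respect each step (`IsMeasureValuedSolution.euler_step`). Letting the step size and
then the mollification radius tend to zero bounds the distance at time `T` by `exp (C₂ T)` times the
time integral of the velocity difference (`abs_integral_sub_le`). By (A3) this estimate can be
iterated, and the iterates tend to zero (`wassersteinDist_solutions_le`). -/

namespace LaxFriedrichs

/-! ### The line and the torus as quotients of `ℝ`. -/

namespace Domain

variable (K : Domain)

lemma proj_add (a b : ℝ) : K.proj (a + b) = K.proj a + K.proj b := by
  cases K <;> rfl

lemma proj_zero : K.proj 0 = 0 := by
  cases K <;> rfl

lemma proj_sub (a b : ℝ) : K.proj (a - b) = K.proj a - K.proj b := by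
  cases K <;> rfl

lemma isOpenQuotientMap_proj : IsOpenQuotientMap K.proj := by
  cases K
  · exact IsOpenQuotientMap.id
  · exact QuotientAddGroup.isOpenQuotientMap_mk

lemma continuous_proj : Continuous K.proj := K.isOpenQuotientMap_proj.continuous

lemma surjective_proj : Function.Surjective K.proj := K.isOpenQuotientMap_proj.surjective

lemma norm_proj_le (a : ℝ) : ‖K.proj a‖ ≤ |a| := by
  cases K
  · exact le_refl _
  · exact QuotientAddGroup.norm_mk_le_norm

lemma dist_proj_le (a b : ℝ) : dist (K.proj a) (K.proj b) ≤ |a - b| := by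
  rw [dist_eq_norm, ← proj_sub]
  exact K.norm_proj_le _

lemma exists_norm_eq (a : ℝ) : ∃ z, K.proj z = K.proj a ∧ ‖K.proj a‖ = |z| := by
  cases K
  · exact ⟨a, rfl, rfl⟩
  · refine ⟨a - round ((2 * Real.pi)⁻¹ * a) * (2 * Real.pi), ?_, AddCircle.norm_eq _⟩
    change ((a - round ((2 * Real.pi)⁻¹ * a) * (2 * Real.pi) : ℝ) : AddCircle (2 * Real.pi)) = a
    rw [AddCircle.coe_sub, sub_eq_self, AddCircle.coe_eq_zero_iff]
    exact ⟨_, zsmul_eq_mul _ _⟩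

/-- Geodesic distances are attained by a suitable lift, so the hat functions can be evaluated in
`ℝ`. -/
lemma exists_dist_eq (a b : ℝ) :
    ∃ z, K.proj z = K.proj b ∧ dist (K.proj a) (K.proj b) = |a - z| := by
  obtain ⟨z, hz, hz'⟩ := K.exists_norm_eq (a - b)
  refine ⟨a - z, by rw [proj_sub, hz, proj_sub]; abel, ?_⟩
  rw [dist_eq_norm, ← proj_sub, hz', sub_sub_cancel]

lemma exists_measurable_section : ∃ s : K → ℝ, Measurable s ∧ ∀ x, K.proj (s x) = x := by
  cases K
  · exact ⟨id, measurable_id, fun x => rfl⟩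
  · have : Fact (0 < 2 * Real.pi) := ⟨Real.two_pi_pos⟩
    refine ⟨fun x => (AddCircle.measurableEquivIoc (2 * Real.pi) 0 x : ℝ), ?_, ?_⟩
    · exact measurable_subtype_coe.comp
        (AddCircle.measurableEquivIoc (2 * Real.pi) 0).measurable
    · exact fun x => (AddCircle.equivIoc (2 * Real.pi) 0).symm_apply_apply x

instance : SecondCountableTopology K := by
  cases K
  · exact inferInstanceAs (SecondCountableTopology ℝ)
  · exact inferInstanceAs (SecondCountableTopology (ℝ ⧸ AddSubgroup.zmultiples (2 * Real.pi)))

lemma continuous_comp_proj_iff {X : Type*} [TopologicalSpace X] {f : K → X} :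
    Continuous (fun y => f (K.proj y)) ↔ Continuous f :=
  K.isOpenQuotientMap_proj.continuous_comp_iff

/-- A nonzero multiple of the period has absolute value at least `2π > 1`. This keeps adjacent
midpoints distinct on fine meshes. -/
lemma eq_zero_of_proj_eq_zero {a : ℝ} (h : K.proj a = 0) (ha : |a| ≤ 1) : a = 0 := by
  cases K
  · exact h
  · obtain ⟨n, hn⟩ := (AddCircle.coe_eq_zero_iff (2 * Real.pi)).1 h
    by_contra hne
    have hn0 : n ≠ 0 := by rintro rfl; simp at hn; exact hne hn.symm
    have h1 : (1 : ℝ) ≤ |(n : ℝ)| := by exact_mod_cast Int.one_le_abs hn0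
    rw [← hn, zsmul_eq_mul, abs_mul, abs_of_pos Real.two_pi_pos] at ha
    nlinarith [Real.pi_gt_three]

/-- Smooth compactly supported cutoffs with small derivative converging to `1`. -/
lemma exists_cutoff : ∃ χ : ℕ → K → ℝ, (∀ n, ContDiff ℝ ∞ (fun y => χ n (K.proj y))) ∧
    (∀ n, HasCompactSupport (χ n)) ∧ (∀ n x, 0 ≤ χ n x) ∧ (∀ n x, χ n x ≤ 1) ∧
    (∀ n y, |deriv (fun y => χ n (K.proj y)) y| ≤ 1 / ((n : ℝ) + 1)) ∧
    ∀ x, Filter.Tendsto (fun n => χ n x) Filter.atTop (nhds 1) := by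
  cases K
  · let B : ContDiffBump (0 : ℝ) := ⟨1, 2, one_pos, one_lt_two⟩
    obtain ⟨C, hC⟩ : ∃ C, ∀ y, ‖deriv B y‖ ≤ C :=
      (B.contDiff.continuous_deriv (n := 1) le_rfl).bounded_above_of_compact_support
        B.hasCompactSupport.deriv
    have hC0 : 0 ≤ C := (norm_nonneg _).trans (hC 0)
    -- Dilating the bump by `c n` multiplies its slope, at most `C`, by `c n`; the `+ 1` keeps the
    -- denominator positive.
    let c : ℕ → ℝ := fun n => (1 / ((n : ℝ) + 1)) / (C + 1)
    have hc : ∀ n, 0 < c n := fun n => by positivity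
    have hsm : ∀ n, ContDiff ℝ ∞ (fun y : ℝ => B (c n * y)) := fun n =>
      B.contDiff.comp (contDiff_const.mul contDiff_id)
    refine ⟨fun n x => B (c n * x), hsm, ?_, fun n x => B.nonneg, fun n x => B.le_one, ?_, ?_⟩
    · intro n
      exact B.hasCompactSupport.comp_homeomorph (Homeomorph.mulLeft₀ (c n) (hc n).ne')
    · intro n y
      change |deriv (fun y : ℝ => B (c n * y)) y| ≤ _
      rw [deriv_comp_mul_left, smul_eq_mul, abs_mul, abs_of_pos (hc n)]
      have := hC (c n * y)
      rw [Real.norm_eq_abs] at this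
      calc c n * |deriv B (c n * y)| ≤ c n * (C + 1) := by
            gcongr
            linarith
        _ = _ := by simp only [c]; field_simp
    · intro x
      have hx : Filter.Tendsto (fun n => c n * x) Filter.atTop (nhds 0) := by
        have := (tendsto_one_div_add_atTop_nhds_zero_nat (𝕜 := ℝ)).mul_const (x / (C + 1))
        rw [zero_mul] at this
        refine this.congr fun n => ?_
        simp only [c]; ring
      have h1 : B 0 = 1 := B.one_of_mem_closedBall (by simp [B])
      have := (B.contDiff (n := 0)).continuous.continuousAt.tendsto.comp hx
      rw [h1] at this
      exact this
  · refine ⟨fun _ _ => 1, fun _ => contDiff_const, fun n => ?_, fun _ _ => zero_le_one,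
      fun _ _ => le_rfl, fun n y => ?_, fun _ => tendsto_const_nhds⟩
    · have : Fact (0 < 2 * Real.pi) := ⟨Real.two_pi_pos⟩
      have : CompactSpace (Domain.torus : Type) :=
        inferInstanceAs (CompactSpace (AddCircle (2 * Real.pi)))
      exact HasCompactSupport.of_compactSpace _
    · simp; positivity

end Domain

/-! ### Cell midpoints and their lifts to `ℝ`. -/

namespace Mesh

variable {K : Domain} (M : Mesh K)

/-- The position in `ℝ` of the `i`-th cell midpoint. -/
noncomputable def pos (i : ℤ) : ℝ := M.origin + i * M.dx

lemma center_eq (i : ℤ) : M.center i = K.proj (M.pos i) := rfl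

lemma pos_add_one (i : ℤ) : M.pos (i + 1) = M.pos i + M.dx := by
  simp only [pos]; push_cast; ring

lemma pos_sub_one (i : ℤ) : M.pos (i - 1) = M.pos i - M.dx := by
  simp only [pos]; push_cast; ring

lemma center_add_one (i : ℤ) : M.center (i + 1) = M.center i + K.proj M.dx := by
  rw [center_eq, pos_add_one, K.proj_add, ← center_eq]

lemma center_sub_one (i : ℤ) : M.center (i - 1) = M.center i - K.proj M.dx := by
  rw [center_eq, pos_sub_one, K.proj_sub, ← center_eq]

lemma center_ne_center_add_one (h : M.dx ≤ 1) (i : ℤ) : M.center i ≠ M.center (i + 1) := by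
  rw [center_add_one, Ne, left_eq_add]
  intro h0
  have := K.eq_zero_of_proj_eq_zero h0 (by rwa [abs_of_pos M.dx_pos])
  exact M.dx_pos.ne' this

/-- Since `N * dx = 2π`, shifting by a period shifts the index by `N`, so every lift of a midpoint
is again a mesh position. -/
lemma exists_pos_eq {j : ℤ} {z : ℝ} (h : K.proj z = M.center j) :
    ∃ i, M.pos i = z ∧ M.center i = M.center j := by
  cases K
  · exact ⟨j, h.symm, rfl⟩
  · obtain ⟨N, -, hN⟩ := M.isIndexSet
    have h' : ((z - M.pos j : ℝ) : AddCircle (2 * Real.pi)) = 0 := by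
      rw [AddCircle.coe_sub]; exact sub_eq_zero.2 h
    obtain ⟨n, hn⟩ := (AddCircle.coe_eq_zero_iff (2 * Real.pi)).1 h'
    have hz : M.pos (j + n * N) = z := by
      rw [zsmul_eq_mul, ← hN] at hn
      simp only [pos] at hn ⊢
      push_cast
      linarith
    exact ⟨j + n * N, hz, by rw [center_eq, hz, h]⟩

lemma exists_mem_index (k : ℤ) : ∃ i ∈ M.index, M.center i = M.center k := by
  cases K
  · have h : M.index = univ := M.isIndexSet
    exact ⟨k, h ▸ mem_univ k, rfl⟩
  · obtain ⟨N, hI, hN⟩ := M.isIndexSet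
    have hN0 : 0 < N := by
      rcases Nat.eq_zero_or_pos N with h | h
      · rw [h] at hN; simp at hN
      · exact h
    have hN' : (0 : ℤ) < N := by exact_mod_cast hN0
    refine ⟨(k - 1) % N + 1, ?_, ?_⟩
    · rw [hI, mem_Icc]
      have h1 := Int.emod_nonneg (k - 1) hN'.ne'
      have h2 := Int.emod_lt_of_pos (k - 1) hN'
      omega
    · rw [← sub_eq_zero, center_eq, center_eq, ← Domain.proj_sub]
      refine (AddCircle.coe_eq_zero_iff (2 * Real.pi)).2 ⟨-((k - 1) / N), ?_⟩
      have h1 : (((k - 1) % N + 1 : ℤ) : ℝ) = k - N * ((k - 1) / N : ℤ) := by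
        have := Int.emod_add_mul_ediv (k - 1) N
        have h2 : (k - 1) % N + 1 = k - N * ((k - 1) / N) := by linarith
        rw [h2]; push_cast; ring
      simp only [pos]
      rw [h1, zsmul_eq_mul, ← hN]
      push_cast
      ring

lemma index_injOn : InjOn M.center M.index := by
  intro i hi j hj hij
  cases K
  · have h : M.pos i = M.pos j := hij
    simp only [pos, add_right_inj] at h
    exact_mod_cast mul_right_cancel₀ M.dx_pos.ne' h
  · obtain ⟨N, hI, hN⟩ := M.isIndexSet
    rw [hI, mem_Icc] at hi hj
    have h' : ((M.pos i - M.pos j : ℝ) : AddCircle (2 * Real.pi)) = 0 := by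
      rw [AddCircle.coe_sub]; exact sub_eq_zero.2 hij
    obtain ⟨n, hn⟩ := (AddCircle.coe_eq_zero_iff (2 * Real.pi)).1 h'
    have h1 : (n : ℝ) * N = i - j := by
      refine mul_right_cancel₀ M.dx_pos.ne' ?_
      rw [zsmul_eq_mul, ← hN] at hn
      simp only [pos] at hn
      linarith
    have h2 : n * N = i - j := by exact_mod_cast h1
    have h3 : n = 0 := by
      by_contra hne
      rcases lt_or_gt_of_ne hne with h | h
      · nlinarith
      · nlinarith
    rw [h3] at h2
    omega

end Mesh

/-! ### Global solutions of ordinary differential equations. -/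

open Filter Topology in
/-- A bounded globally Lipschitz autonomous vector field on a Banach space has a global integral
curve through every point. -/
lemma exists_global_integralCurve {E : Type*} [NormedAddCommGroup E] [NormedSpace ℝ E]
    [CompleteSpace E] {F : E → E} {k L : NNReal} (hF : LipschitzWith k F) (hL : ∀ x, ‖F x‖ ≤ L)
    (x₀ : E) : ∃ Z : ℝ → E, Z 0 = x₀ ∧ ∀ t, HasDerivAt Z (F (Z t)) t := by
  have key : ∀ n : ℕ, ∃ α : ℝ → E, α 0 = x₀ ∧
      ∀ t ∈ Ioo (-((n : ℝ) + 1)) ((n : ℝ) + 1), HasDerivAt α (F (α t)) t := by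
    intro n
    have h0 : (0 : ℝ) ∈ Icc (-((n : ℝ) + 1)) ((n : ℝ) + 1) :=
      ⟨by linarith [n.cast_nonneg (α := ℝ)], by positivity⟩
    -- The bound `L` is global, so the ball may be given the radius `L * (n + 1)` that a curve of
    -- speed `L` needs; the length of the time interval is unrestricted.
    have hP : IsPicardLindelof (fun _ => F) (⟨0, h0⟩ : Icc (-((n : ℝ) + 1)) ((n : ℝ) + 1)) x₀
        (L * ((n : NNReal) + 1)) 0 L k := by
      refine .of_time_independent (fun x _ => hL x) hF.lipschitzOnWith ?_
      simp
    obtain ⟨α, h1, h2⟩ := hP.exists_eq_forall_mem_Icc_hasDerivWithinAt₀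
    exact ⟨α, h1, fun t ht => (h2 t (Ioo_subset_Icc_self ht)).hasDerivAt (Icc_mem_nhds ht.1 ht.2)⟩
  choose α h0 hα using key
  have huniq : ∀ m n : ℕ, m ≤ n → ∀ t, |t| < (m : ℝ) + 1 → α m t = α n t := by
    intro m n hmn t ht
    have hmn' : (m : ℝ) ≤ n := by exact_mod_cast hmn
    have hm0 : (0 : ℝ) ≤ m := m.cast_nonneg
    refine ODE_solution_unique_of_mem_Ioo (v := fun _ => F) (s := fun _ => univ) (K := k)
      (a := -((m : ℝ) + 1)) (b := (m : ℝ) + 1) (t₀ := 0) (fun _ _ => hF.lipschitzOnWith)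
      ⟨by linarith, by linarith⟩ (fun t ht => ⟨hα m t ht, trivial⟩)
      (fun t ht => ⟨hα n t ⟨by linarith [ht.1], by linarith [ht.2]⟩, trivial⟩)
      ((h0 m).trans (h0 n).symm) (abs_lt.1 ht)
  have hfl : ∀ t : ℝ, |t| < (⌊|t|⌋₊ : ℝ) + 1 := fun t => Nat.lt_floor_add_one _
  have heq : ∀ n : ℕ, ∀ t, |t| < (n : ℝ) + 1 → α ⌊|t|⌋₊ t = α n t := by
    intro n t ht
    rcases le_total ⌊|t|⌋₊ n with h | h
    · exact huniq _ _ h t (hfl t)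
    · exact (huniq _ _ h t ht).symm
  -- By uniqueness the local curves agree wherever two of them are defined, so choosing one by the
  -- size of `|t|` is locally the same as fixing `n`.
  refine ⟨fun t => α ⌊|t|⌋₊ t, by simp [h0], fun t => ?_⟩
  obtain ⟨n, hn⟩ := exists_nat_gt |t|
  have hn' : |t| < (n : ℝ) + 1 := by linarith
  have hev : (fun t => α ⌊|t|⌋₊ t) =ᶠ[𝓝 t] α n := by
    filter_upwards [continuous_abs.continuousAt.eventually (gt_mem_nhds hn')] with s hs
      using heq n s hs
  have := (hα n t (abs_lt.1 hn')).congr_of_eventuallyEq hev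
  rwa [← hev.eq_of_nhds] at this

/-! ### Wasserstein distance, velocity fields and laws of displaced points. -/

lemma wassersteinDist_le {X : Type*} [PseudoMetricSpace X] [MeasurableSpace X]
    {ν₁ ν₂ : Measure X} {A : ℝ}
    (h : ∀ ψ : X →ᵇ ℝ, LipschitzWith 1 ψ → (∫ x, ψ x ∂ν₂) - ∫ x, ψ x ∂ν₁ ≤ A) :
    wassersteinDist ν₁ ν₂ ≤ ENNReal.ofReal A :=
  iSup₂_le fun ψ hψ => ENNReal.ofReal_le_ofReal (h ψ hψ)

lemma integral_sub_le_of_wassersteinDist_le {X : Type*} [PseudoMetricSpace X] [MeasurableSpace X]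
    {ν₁ ν₂ : Measure X} {A : ℝ} (hA : 0 ≤ A) (h : wassersteinDist ν₁ ν₂ ≤ ENNReal.ofReal A)
    (ψ : X →ᵇ ℝ) (hψ : LipschitzWith 1 ψ) : (∫ x, ψ x ∂ν₂) - ∫ x, ψ x ∂ν₁ ≤ A :=
  (ENNReal.ofReal_le_ofReal_iff hA).1 ((le_iSup₂ (f := fun (ψ : X →ᵇ ℝ) (_ : LipschitzWith 1 ψ) =>
    ENNReal.ofReal ((∫ x, ψ x ∂ν₂) - ∫ x, ψ x ∂ν₁)) ψ hψ).trans h)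

variable {K : Domain}

/-- The standing assumptions on the velocity field: boundedness, spatial Lipschitz continuity and
Lipschitz continuity with respect to the measure. -/
structure IsVelocity (V : Measure K → K → ℝ) (C₁ C₂ C₃ : ℝ) : Prop where
  pos₁ : 0 < C₁
  pos₂ : 0 < C₂
  pos₃ : 0 < C₃
  abs_le : ∀ (ν : ProbabilityMeasure K) (x : K), |V ν x| ≤ C₁
  abs_sub_le : ∀ (ν : ProbabilityMeasure K) (x y : K), |V ν x - V ν y| ≤ C₂ * dist x y
  stable : ∀ (ν₁ ν₂ : ProbabilityMeasure K) (x : K),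
    ENNReal.ofReal |V ν₁ x - V ν₂ x| ≤
      ENNReal.ofReal C₃ * wassersteinDist (ν₁ : Measure K) (ν₂ : Measure K)

namespace IsVelocity

variable {V : Measure K → K → ℝ} {C₁ C₂ C₃ : ℝ} (hV : IsVelocity V C₁ C₂ C₃)
include hV

lemma lipschitz (ν : ProbabilityMeasure K) : LipschitzWith C₂.toNNReal (V ν) :=
  LipschitzWith.of_dist_le_mul fun x y => by
    rw [Real.dist_eq, Real.coe_toNNReal _ hV.pos₂.le]
    exact hV.abs_sub_le ν x y

lemma continuous (ν : ProbabilityMeasure K) : Continuous (V ν) := (hV.lipschitz ν).continuous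

lemma abs_sub_le_of_wassersteinDist_le {ν₁ ν₂ : ProbabilityMeasure K} {A : ℝ} (hA : 0 ≤ A)
    (h : wassersteinDist (ν₁ : Measure K) (ν₂ : Measure K) ≤ ENNReal.ofReal A) (x : K) :
    |V ν₁ x - V ν₂ x| ≤ C₃ * A := by
  rw [← ENNReal.ofReal_le_ofReal_iff (mul_nonneg hV.pos₃.le hA),
    ENNReal.ofReal_mul hV.pos₃.le]
  exact (hV.stable ν₁ ν₂ x).trans (by gcongr)

end IsVelocity

variable (K) in
/-- The distribution on `K` of the point `y + Z y`, where `y` is distributed according to `m`. -/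
noncomputable def law (m : ProbabilityMeasure ℝ) (Z : ℝ →ᵇ ℝ) : ProbabilityMeasure K :=
  m.map (f := fun y => K.proj (y + Z y))
    (K.continuous_proj.comp (continuous_id.add Z.continuous)).aemeasurable

lemma continuous_proj_add (Z : ℝ →ᵇ ℝ) : Continuous fun y => K.proj (y + Z y) :=
  K.continuous_proj.comp (continuous_id.add Z.continuous)

lemma integral_law (m : ProbabilityMeasure ℝ) (Z : ℝ →ᵇ ℝ) {f : K → ℝ} (hf : Continuous f) :
    ∫ x, f x ∂(law K m Z : Measure K) = ∫ y, f (K.proj (y + Z y)) ∂(m : Measure ℝ) :=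
  integral_map (continuous_proj_add Z).aemeasurable hf.aestronglyMeasurable

/-- Couple the two laws by using the same starting point `y` for both displacements. -/
lemma wassersteinDist_law_le (m : ProbabilityMeasure ℝ) (Z Z' : ℝ →ᵇ ℝ) :
    wassersteinDist (law K m Z : Measure K) (law K m Z') ≤ ENNReal.ofReal (dist Z Z') := by
  refine wassersteinDist_le fun ψ hψ => ?_
  have hinteg : ∀ W : ℝ →ᵇ ℝ, Integrable (fun y => ψ (K.proj (y + W y))) (m : Measure ℝ) := fun W =>
    Integrable.of_bound (ψ.continuous.comp (continuous_proj_add W)).aestronglyMeasurable ‖ψ‖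
      (ae_of_all _ fun y => ψ.norm_coe_le_norm _)
  rw [integral_law _ _ ψ.continuous, integral_law _ _ ψ.continuous, ← integral_sub (hinteg _) (hinteg _)]
  calc ∫ y, (ψ (K.proj (y + Z' y)) - ψ (K.proj (y + Z y))) ∂(m : Measure ℝ)
      ≤ ∫ y, dist Z Z' ∂(m : Measure ℝ) := by
        refine integral_mono ((hinteg _).sub (hinteg _)) (integrable_const _) fun y => ?_
        have h1 := hψ.dist_le_mul (K.proj (y + Z' y)) (K.proj (y + Z y))
        have h2 := K.dist_proj_le (y + Z' y) (y + Z y)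
        have h3 := BoundedContinuousFunction.dist_coe_le_dist (f := Z) (g := Z') y
        rw [Real.dist_eq, abs_sub_comm] at h3
        rw [Real.dist_eq] at h1
        rw [add_sub_add_left_eq_sub] at h2
        simp only [NNReal.coe_one, one_mul] at h1
        exact (le_abs_self _).trans (h1.trans (h2.trans h3))
    _ = dist Z Z' := by simp

/-! ### The ODE for the displacement of the characteristics. -/

section Flow

variable {V : Measure K → K → ℝ} {C₁ C₂ C₃ : ℝ} (hV : IsVelocity V C₁ C₂ C₃)
  (m : ProbabilityMeasure ℝ)

/-- The velocity of the displacement field `Z`. -/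
noncomputable def IsVelocity.field (Z : ℝ →ᵇ ℝ) : ℝ →ᵇ ℝ :=
  BoundedContinuousFunction.ofNormedAddCommGroup
    (fun y => V (law K m Z : Measure K) (K.proj (y + Z y)))
    ((hV.continuous _).comp (continuous_proj_add Z)) C₁ fun _ => hV.abs_le _ _

lemma IsVelocity.field_apply (Z : ℝ →ᵇ ℝ) (y : ℝ) :
    hV.field m Z y = V (law K m Z : Measure K) (K.proj (y + Z y)) := rfl

lemma IsVelocity.norm_field_le (Z : ℝ →ᵇ ℝ) : ‖hV.field m Z‖ ≤ C₁ :=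
  BoundedContinuousFunction.norm_ofNormedAddCommGroup_le _ hV.pos₁.le _

/-- Changing `Z` moves the point of evaluation, at cost `C₂`, and the measure, at cost `C₃`. -/
lemma IsVelocity.lipschitzWith_field :
    LipschitzWith (C₂ + C₃).toNNReal (hV.field m) := by
  have hp : 0 ≤ C₂ + C₃ := (add_pos hV.pos₂ hV.pos₃).le
  refine LipschitzWith.of_dist_le_mul fun Z Z' => ?_
  rw [Real.coe_toNNReal _ hp, BoundedContinuousFunction.dist_le (mul_nonneg hp dist_nonneg)]
  intro y
  have h1 := hV.abs_sub_le (law K m Z) (K.proj (y + Z y)) (K.proj (y + Z' y))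
  have h2 := hV.abs_sub_le_of_wassersteinDist_le dist_nonneg (wassersteinDist_law_le m Z Z')
    (K.proj (y + Z' y))
  have h3 := K.dist_proj_le (y + Z y) (y + Z' y)
  have h4 := BoundedContinuousFunction.dist_coe_le_dist (f := Z) (g := Z') y
  rw [Real.dist_eq] at h4
  rw [add_sub_add_left_eq_sub] at h3
  have h5 := mul_le_mul_of_nonneg_left (h3.trans h4) hV.pos₂.le
  rw [Real.dist_eq, hV.field_apply, hV.field_apply, add_mul]
  exact (_root_.abs_sub_le _ _ _).trans (add_le_add (h1.trans h5) h2)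

/-- The unknown is the displacement rather than the position because it stays bounded on the line as
well. -/
lemma IsVelocity.exists_flow :
    ∃ Z : ℝ → ℝ →ᵇ ℝ, Z 0 = 0 ∧ ∀ t, HasDerivAt Z (hV.field m (Z t)) t :=
  exists_global_integralCurve (L := C₁.toNNReal) (hV.lipschitzWith_field m)
    (fun Z => by rw [Real.coe_toNNReal _ hV.pos₁.le]; exact hV.norm_field_le m Z) 0

variable {m} {hV} {Z : ℝ → ℝ →ᵇ ℝ} (hZ : ∀ t, HasDerivAt Z (hV.field m (Z t)) t)
include hZ

lemma flow_dist_le (s t : ℝ) : dist (Z s) (Z t) ≤ C₁ * |s - t| := by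
  have := convex_univ.norm_image_sub_le_of_norm_hasDerivWithin_le (f := Z)
    (fun x _ => (hZ x).hasDerivWithinAt) (fun x _ => hV.norm_field_le m (Z x))
    (mem_univ t) (mem_univ s)
  rwa [← dist_eq_norm, Real.norm_eq_abs] at this

lemma flow_continuous : Continuous Z :=
  continuous_iff_continuousAt.2 fun t => (hZ t).continuousAt

lemma flow_hasDerivAt_apply (y t : ℝ) :
    HasDerivAt (fun t => Z t y) (V (law K m (Z t) : Measure K) (K.proj (y + Z t y))) t :=
  (BoundedContinuousFunction.evalCLM (β := ℝ) ℝ y).hasFDerivAt.comp_hasDerivAt t (hZ t)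

lemma wassersteinDist_flow_le (s t : ℝ) :
    wassersteinDist (law K m (Z s) : Measure K) (law K m (Z t))
      ≤ ENNReal.ofReal (C₁ * |s - t|) :=
  (wassersteinDist_law_le m _ _).trans (ENNReal.ofReal_le_ofReal (flow_dist_le hZ s t))

end Flow

/-! ### Regularity and support of the derivatives of test functions. -/

section TestFunction

variable {φ : K × ℝ → ℝ} (hφ : IsTestFunction φ)
include hφ

lemma IsTestFunction.differentiable :
    Differentiable ℝ (fun y : ℝ × ℝ => φ (K.proj y.1, y.2)) :=
  hφ.smooth.differentiable (by simp)

lemma IsTestFunction.spaceDeriv_proj (y t : ℝ) :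
    spaceDeriv φ (K.proj y) t =
      fderiv ℝ (fun y : ℝ × ℝ => φ (K.proj y.1, y.2)) (y, t) (1, 0) := by
  have h := (hφ.differentiable (y, t)).hasFDerivAt
  have hc : HasDerivAt (fun h : ℝ => (y + h, t)) ((1 : ℝ), (0 : ℝ)) 0 :=
    ((hasDerivAt_id (0 : ℝ)).const_add y).prodMk (hasDerivAt_const _ _)
  have h' : HasFDerivAt (fun y : ℝ × ℝ => φ (K.proj y.1, y.2))
      (fderiv ℝ (fun y : ℝ × ℝ => φ (K.proj y.1, y.2)) (y, t)) (y + 0, t) := by rwa [add_zero]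
  rw [← (h'.comp_hasDerivAt (0 : ℝ) hc).deriv]
  simp only [spaceDeriv, Function.comp_def, K.proj_add]

lemma IsTestFunction.timeDeriv_proj (y t : ℝ) :
    timeDeriv φ (K.proj y) t =
      fderiv ℝ (fun y : ℝ × ℝ => φ (K.proj y.1, y.2)) (y, t) (0, 1) := by
  have h := (hφ.differentiable (y, t)).hasFDerivAt
  have hc : HasDerivAt (fun h : ℝ => (y, h)) ((0 : ℝ), (1 : ℝ)) t :=
    (hasDerivAt_const _ _).prodMk (hasDerivAt_id t)
  rw [← (h.comp_hasDerivAt t hc).deriv]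
  rfl

lemma IsTestFunction.continuous : Continuous φ := by
  have h := K.isOpenQuotientMap_proj.prodMap (IsOpenQuotientMap.id (X := ℝ))
  exact h.continuous_comp_iff.1 hφ.smooth.continuous

lemma IsTestFunction.continuous_spaceDeriv : Continuous fun p : K × ℝ => spaceDeriv φ p.1 p.2 := by
  have h := K.isOpenQuotientMap_proj.prodMap (IsOpenQuotientMap.id (X := ℝ))
  refine h.continuous_comp_iff.1 ?_
  refine ((hφ.smooth.continuous_fderiv (by simp)).clm_apply
    (continuous_const (y := ((1 : ℝ), (0 : ℝ))))).congr fun p => ?_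
  exact (hφ.spaceDeriv_proj p.1 p.2).symm

lemma IsTestFunction.continuous_timeDeriv : Continuous fun p : K × ℝ => timeDeriv φ p.1 p.2 := by
  have h := K.isOpenQuotientMap_proj.prodMap (IsOpenQuotientMap.id (X := ℝ))
  refine h.continuous_comp_iff.1 ?_
  refine ((hφ.smooth.continuous_fderiv (by simp)).clm_apply
    (continuous_const (y := ((0 : ℝ), (1 : ℝ))))).congr fun p => ?_
  exact (hφ.timeDeriv_proj p.1 p.2).symm

omit hφ in
lemma spaceDeriv_eq_zero {x : K} {t : ℝ} (h : (x, t) ∉ tsupport φ) : spaceDeriv φ x t = 0 := by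
  have hc : Continuous fun h : ℝ => (x + K.proj h, t) :=
    (continuous_const.add K.continuous_proj).prodMk continuous_const
  have hev : (fun h : ℝ => φ (x + K.proj h, t)) =ᶠ[nhds 0] fun _ => 0 := by
    have h0 := notMem_tsupport_iff_eventuallyEq.1 h
    have h1 : Filter.Tendsto (fun h : ℝ => (x + K.proj h, t)) (nhds 0) (nhds (x, t)) := by
      have := hc.tendsto 0
      rwa [K.proj_zero, add_zero] at this
    exact h1.eventually h0
  rw [spaceDeriv, hev.deriv_eq, deriv_const]

omit hφ in
lemma timeDeriv_eq_zero {x : K} {t : ℝ} (h : (x, t) ∉ tsupport φ) : timeDeriv φ x t = 0 := by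
  have hc : Continuous fun s : ℝ => (x, s) := continuous_const.prodMk continuous_id
  have hev : (fun s : ℝ => φ (x, s)) =ᶠ[nhds t] fun _ => 0 :=
    (hc.tendsto t).eventually (notMem_tsupport_iff_eventuallyEq.1 h)
  rw [timeDeriv, hev.deriv_eq, deriv_const]

lemma IsTestFunction.exists_bound_spaceDeriv : ∃ C, ∀ x t, |spaceDeriv φ x t| ≤ C := by
  obtain ⟨C, hC⟩ := hφ.continuous_spaceDeriv.bounded_above_of_compact_support
    (HasCompactSupport.intro hφ.compactSupport fun p hp => spaceDeriv_eq_zero hp)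
  exact ⟨C, fun x t => hC (x, t)⟩

lemma IsTestFunction.exists_bound_timeDeriv : ∃ C, ∀ x t, |timeDeriv φ x t| ≤ C := by
  obtain ⟨C, hC⟩ := hφ.continuous_timeDeriv.bounded_above_of_compact_support
    (HasCompactSupport.intro hφ.compactSupport fun p hp => timeDeriv_eq_zero hp)
  exact ⟨C, fun x t => hC (x, t)⟩

lemma IsTestFunction.exists_bound : ∃ C, ∀ p, |φ p| ≤ C :=
  hφ.continuous.bounded_above_of_compact_support hφ.compactSupport

lemma IsTestFunction.exists_time_bound : ∃ R, ∀ x t, R < |t| → (x, t) ∉ tsupport φ := by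
  obtain ⟨R, hR⟩ := (hφ.compactSupport.isCompact.image continuous_snd).isBounded.exists_norm_le
  refine ⟨R, fun x t ht hx => ?_⟩
  exact absurd (hR t ⟨_, hx, rfl⟩) (not_le.2 ht)

end TestFunction

/-! ### The law of the flow is a measure-valued solution. -/

section Existence

variable {V : Measure K → K → ℝ} {C₁ C₂ C₃ : ℝ} {hV : IsVelocity V C₁ C₂ C₃}
  {m : ProbabilityMeasure ℝ} {Z : ℝ → ℝ →ᵇ ℝ} (hZ : ∀ t, HasDerivAt Z (hV.field m (Z t)) t)
include hZ

lemma flow_hasDerivAt_testFunction {φ : K × ℝ → ℝ} (hφ : IsTestFunction φ) (y t : ℝ) :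
    HasDerivAt (fun t => φ (K.proj (y + Z t y), t))
      (timeDeriv φ (K.proj (y + Z t y)) t +
        V (law K m (Z t) : Measure K) (K.proj (y + Z t y)) *
          spaceDeriv φ (K.proj (y + Z t y)) t) t := by
  have hc : HasDerivAt (fun t => (y + Z t y, t))
      (V (law K m (Z t) : Measure K) (K.proj (y + Z t y)), (1 : ℝ)) t :=
    ((flow_hasDerivAt_apply hZ y t).const_add y).prodMk (hasDerivAt_id t)
  have h := (HasFDerivAt.comp_hasDerivAt (f := fun t => (y + Z t y, t)) t
    (hφ.differentiable (y + Z t y, t)).hasFDerivAt hc)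
  refine h.congr_deriv ?_
  rw [hφ.timeDeriv_proj, hφ.spaceDeriv_proj, ← smul_eq_mul, ← map_smul, ← map_add]
  simp

/-- The inner integral of the weak form is the time derivative of `∫ φ(y + Z t y, t) dm`.
Integrating it over `(0, ∞)` leaves minus the value at time `0`, since `φ` vanishes for large times.
-/
lemma flow_isMeasureValuedSolution (hZ0 : Z 0 = 0) {μ₀ : ProbabilityMeasure K}
    (hμ₀ : law K m 0 = μ₀) : IsMeasureValuedSolution V μ₀ (fun t => law K m (Z t)) := by
  have hZc : ∀ y, Continuous fun t => Z t y := fun y =>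
    continuous_iff_continuousAt.2 fun t => (flow_hasDerivAt_apply hZ y t).continuousAt
  have hpc : ∀ y, Continuous fun t => K.proj (y + Z t y) := fun y =>
    K.continuous_proj.comp (continuous_const.add (hZc y))
  -- the integrand, pulled back to the real line
  have key : ∀ φ : K × ℝ → ℝ, IsTestFunction φ →
      ∃ G : ℝ → ℝ, Continuous G ∧ HasCompactSupport G ∧
      (∀ t, G t = ∫ x, (timeDeriv φ x t + V (law K m (Z t) : Measure K) x * spaceDeriv φ x t)
        ∂(law K m (Z t) : Measure K)) ∧
      ∀ t, HasDerivAt (fun t => ∫ y, φ (K.proj (y + Z t y), t) ∂(m : Measure ℝ)) (G t) t := by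
    intro φ hφ
    obtain ⟨A, hA⟩ := hφ.exists_bound_timeDeriv
    obtain ⟨B, hB⟩ := hφ.exists_bound_spaceDeriv
    obtain ⟨C, hC⟩ := hφ.exists_bound
    obtain ⟨R, hR⟩ := hφ.exists_time_bound
    let f : ℝ → K → ℝ := fun t x =>
      timeDeriv φ x t + V (law K m (Z t) : Measure K) x * spaceDeriv φ x t
    have hfc : ∀ t, Continuous (f t) := fun t =>
      (hφ.continuous_timeDeriv.comp (continuous_id.prodMk continuous_const)).add
        ((hV.continuous _).mul
          (hφ.continuous_spaceDeriv.comp (continuous_id.prodMk continuous_const)))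
    have hfb : ∀ t x, ‖f t x‖ ≤ A + C₁ * B := fun t x => by
      refine (norm_add_le _ _).trans (add_le_add (hA x t) ?_)
      rw [norm_mul]
      exact mul_le_mul (hV.abs_le _ x) (hB x t) (norm_nonneg _) hV.pos₁.le
    have hmeas : ∀ t, AEStronglyMeasurable (fun y => f t (K.proj (y + Z t y))) (m : Measure ℝ) :=
      fun t => ((hfc t).comp (continuous_proj_add (Z t))).aestronglyMeasurable
    have hcont : ∀ y, Continuous fun t => f t (K.proj (y + Z t y)) := by
      intro y
      refine (hφ.continuous_timeDeriv.comp ((hpc y).prodMk continuous_id)).add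
        (Continuous.mul ?_ (hφ.continuous_spaceDeriv.comp ((hpc y).prodMk continuous_id)))
      have h1 : Continuous fun t => hV.field m (Z t) :=
        (hV.lipschitzWith_field m).continuous.comp (flow_continuous hZ)
      exact (BoundedContinuousFunction.evalCLM ℝ y).continuous.comp h1
    refine ⟨fun t => ∫ y, f t (K.proj (y + Z t y)) ∂(m : Measure ℝ), ?_, ?_, ?_, ?_⟩
    · exact continuous_of_dominated hmeas (fun t => ae_of_all _ fun y => hfb t _)
        (integrable_const (A + C₁ * B)) (ae_of_all _ hcont)
    · refine HasCompactSupport.intro (isCompact_Icc (a := -R) (b := R)) fun t ht => ?_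
      have ht' : R < |t| := by
        by_contra h
        exact ht (abs_le.1 (not_lt.1 h))
      have : ∀ x, f t x = 0 := fun x => by
        simp only [f]
        rw [timeDeriv_eq_zero (hR x t ht'), spaceDeriv_eq_zero (hR x t ht')]
        simp
      simp [this]
    · exact fun t => (integral_law m (Z t) (hfc t)).symm
    · intro t
      refine (hasDerivAt_integral_of_dominated_loc_of_deriv_le (s := univ)
        (F' := fun t y => f t (K.proj (y + Z t y))) (bound := fun _ => A + C₁ * B)
        Filter.univ_mem (Filter.Eventually.of_forall fun s => ?_) ?_ (hmeas t)
        (ae_of_all _ fun y s _ => hfb s _) (integrable_const _)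
        (ae_of_all _ fun y s _ => flow_hasDerivAt_testFunction hZ hφ y s)).2
      · exact (hφ.continuous.comp
          ((continuous_proj_add (Z s)).prodMk continuous_const)).aestronglyMeasurable
      · exact Integrable.of_bound (hφ.continuous.comp
          ((continuous_proj_add (Z t)).prodMk continuous_const)).aestronglyMeasurable C
          (ae_of_all _ fun y => hC _)
  refine ⟨fun f => ?_, fun φ hφ => ?_, fun φ hφ => ?_⟩
  · obtain ⟨C, hC⟩ := f.toBCF.isBounded_range.exists_norm_le
    refine Continuous.continuousOn ?_
    have hfc : Continuous (f : K → ℝ) := f.continuous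
    rw [funext fun t => integral_law m (Z t) hfc]
    refine continuous_of_dominated (bound := fun _ => C)
      (fun t => (hfc.comp (continuous_proj_add (Z t))).aestronglyMeasurable)
      (fun t => ae_of_all _ fun y => hC _ ⟨_, rfl⟩) (integrable_const _)
      (ae_of_all _ fun y => hfc.comp (hpc y))
  · obtain ⟨G, hGc, hGs, hG, -⟩ := key φ hφ
    simp_rw [← hG]
    exact (hGc.integrable_of_hasCompactSupport hGs).integrableOn
  · obtain ⟨G, hGc, hGs, hG, hd⟩ := key φ hφ
    obtain ⟨R, hR⟩ := hφ.exists_time_bound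
    rw [setIntegral_congr_fun measurableSet_Ioi fun t _ => (hG t).symm,
      integral_Ioi_of_hasDerivAt_of_tendsto' (m := 0) (fun t _ => hd t)
      (hGc.integrable_of_hasCompactSupport hGs).integrableOn]
    · have hc : Continuous fun x => φ (x, (0 : ℝ)) :=
        hφ.continuous.comp (continuous_id.prodMk continuous_const)
      rw [← hμ₀, integral_law m 0 hc, hZ0]
      simp
    · refine tendsto_const_nhds.congr' ?_
      filter_upwards [Filter.eventually_gt_atTop R] with t ht
      have ht' : R < |t| := ht.trans_le (le_abs_self t)
      have : ∀ x, φ (x, t) = 0 := fun x => image_eq_zero_of_notMem_tsupport (hR x t ht')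
      exact (integral_eq_zero_of_ae (ae_of_all _ fun y => this _)).symm

end Existence

/-! ### The adjoint scheme as a random walk on the cell indices. -/

/-- The transpose of one Lax–Friedrichs step with velocities `v` and mesh ratio `lam`, acting on
functions of the cell index. -/
noncomputable def backStep (lam : ℝ) (v u : ℤ → ℝ) (i : ℤ) : ℝ :=
  (1 + lam * v i) / 2 * u (i + 1) + (1 - lam * v i) / 2 * u (i - 1)

/-- The transpose of the first `n` Lax–Friedrichs steps with velocities `v 0, …, v (n - 1)`. -/
noncomputable def backward (lam : ℝ) (v : ℕ → ℤ → ℝ) : ℕ → (ℤ → ℝ) → ℤ → ℝ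
  | 0, u => u
  | n + 1, u => backward lam v n (backStep lam (v n) u)

lemma backward_add (lam : ℝ) (v : ℕ → ℤ → ℝ) (n : ℕ) (u w : ℤ → ℝ) :
    backward lam v n (fun i => u i + w i) =
      fun i => backward lam v n u i + backward lam v n w i := by
  induction n generalizing u w with
  | zero => rfl
  | succ n ih =>
    simp only [backward]
    rw [← ih]
    congr 1
    ext i
    simp only [backStep]
    ring

lemma backward_const_mul (lam : ℝ) (v : ℕ → ℤ → ℝ) (n : ℕ) (c : ℝ) (u : ℤ → ℝ) :
    backward lam v n (fun i => c * u i) = fun i => c * backward lam v n u i := by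
  induction n generalizing u with
  | zero => rfl
  | succ n ih =>
    simp only [backward]
    rw [← ih]
    congr 1
    ext i
    simp only [backStep]
    ring

lemma backward_const (lam : ℝ) (v : ℕ → ℤ → ℝ) (n : ℕ) (c : ℝ) :
    backward lam v n (fun _ => c) = fun _ => c := by
  induction n with
  | zero => rfl
  | succ n ih =>
    simp only [backward]
    have : backStep lam (v n) (fun _ => c) = fun _ => c := by
      ext i
      simp only [backStep]
      ring
    rw [this, ih]

lemma backward_mono {lam : ℝ} {v : ℕ → ℤ → ℝ} {n : ℕ} (hv : ∀ k < n, ∀ i, |lam * v k i| ≤ 1)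
    {u w : ℤ → ℝ} (h : ∀ i, u i ≤ w i) (i : ℤ) : backward lam v n u i ≤ backward lam v n w i := by
  induction n generalizing u w with
  | zero => exact h i
  | succ n ih =>
    refine ih (fun k hk => hv k (hk.trans (Nat.lt_succ_self n))) fun j => ?_
    obtain ⟨h1, h2⟩ := abs_le.1 (hv n (Nat.lt_succ_self n) j)
    exact add_le_add (mul_le_mul_of_nonneg_left (h _) (by linarith))
      (mul_le_mul_of_nonneg_left (h _) (by linarith))

namespace Mesh

variable {K : Domain} (M : Mesh K)

/-- Piecewise linear interpolation of the values `u i` at the points `M.pos i`. -/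
noncomputable def interp (u : ℤ → ℝ) (y : ℝ) : ℝ :=
  (1 - Int.fract ((y - M.origin) / M.dx)) * u ⌊(y - M.origin) / M.dx⌋
    + Int.fract ((y - M.origin) / M.dx) * u (⌊(y - M.origin) / M.dx⌋ + 1)

lemma measurable_interp (u : ℤ → ℝ) : Measurable (M.interp u) := by
  have h1 : Measurable fun y : ℝ => (y - M.origin) / M.dx := by fun_prop
  have h2 : Measurable fun y : ℝ => ⌊(y - M.origin) / M.dx⌋ := Int.measurable_floor.comp h1
  have h3 : Measurable fun y : ℝ => Int.fract ((y - M.origin) / M.dx) := measurable_fract.comp h1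
  have h4 : Measurable fun k : ℤ => u k := measurable_of_countable _
  have h5 : Measurable fun k : ℤ => u (k + 1) := measurable_of_countable _
  exact ((measurable_const.sub h3).mul (h4.comp h2)).add (h3.mul (h5.comp h2))

/-- The expectation of `u` at time step `n` for the random walk started near `y` whose transition
probabilities are the coefficients of the Lax–Friedrichs scheme. -/
noncomputable def expect (lam : ℝ) (v : ℕ → ℤ → ℝ) (n : ℕ) (y : ℝ) (u : ℤ → ℝ) : ℝ :=
  M.interp (backward lam v n u) y

section Expect

variable {lam : ℝ} {v : ℕ → ℤ → ℝ} {n : ℕ}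

lemma expect_succ (y : ℝ) (u : ℤ → ℝ) :
    M.expect lam v (n + 1) y u = M.expect lam v n y (backStep lam (v n) u) := rfl

lemma measurable_expect (u : ℤ → ℝ) : Measurable fun y => M.expect lam v n y u :=
  M.measurable_interp _

lemma expect_add (y : ℝ) (u w : ℤ → ℝ) : M.expect lam v n y (fun i => u i + w i) =
    M.expect lam v n y u + M.expect lam v n y w := by
  simp only [expect, interp, backward_add]
  ring

lemma expect_const_mul (y c : ℝ) (u : ℤ → ℝ) : M.expect lam v n y (fun i => c * u i) =
    c * M.expect lam v n y u := by
  simp only [expect, interp, backward_const_mul]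
  ring

lemma expect_const (y c : ℝ) : M.expect lam v n y (fun _ => c) = c := by
  simp only [expect, interp, backward_const]
  ring

lemma expect_mono (hv : ∀ k < n, ∀ i, |lam * v k i| ≤ 1) (y : ℝ) {u w : ℤ → ℝ}
    (h : ∀ i, u i ≤ w i) : M.expect lam v n y u ≤ M.expect lam v n y w :=
  add_le_add
    (mul_le_mul_of_nonneg_left (backward_mono hv h _) (sub_nonneg.2 (Int.fract_lt_one _).le))
    (mul_le_mul_of_nonneg_left (backward_mono hv h _) (Int.fract_nonneg _))

lemma abs_expect_le (hv : ∀ k < n, ∀ i, |lam * v k i| ≤ 1) (y : ℝ) {u : ℤ → ℝ} {C : ℝ}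
    (h : ∀ i, |u i| ≤ C) : |M.expect lam v n y u| ≤ C := by
  refine abs_le.2 ⟨?_, ?_⟩
  · rw [← M.expect_const (lam := lam) (v := v) (n := n) y (-C)]
    exact M.expect_mono hv y fun i => (abs_le.1 (h i)).1
  · rw [← M.expect_const (lam := lam) (v := v) (n := n) y C]
    exact M.expect_mono hv y fun i => (abs_le.1 (h i)).2

lemma integrable_expect (m : ProbabilityMeasure ℝ) (hv : ∀ k < n, ∀ i, |lam * v k i| ≤ 1)
    {u : ℤ → ℝ} {C : ℝ} (h : ∀ i, |u i| ≤ C) :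
    Integrable (fun y => M.expect lam v n y u) (m : Measure ℝ) :=
  Integrable.of_bound (M.measurable_expect u).aestronglyMeasurable C
    (ae_of_all _ fun y => M.abs_expect_le hv y h)

end Expect

/-! ### Summation over the cells, hat functions and atomic measures. -/

/-- Functions of the cell index that only depend on the cell midpoint. -/
def Compat (u : ℤ → ℝ) : Prop := ∀ i j, M.center i = M.center j → u i = u j

variable {M}

lemma Compat.shift_add {u : ℤ → ℝ} (hu : M.Compat u) : M.Compat fun i => u (i + 1) :=
  fun i j h => hu _ _ (by rw [center_add_one, center_add_one, h])

lemma Compat.shift_sub {u : ℤ → ℝ} (hu : M.Compat u) : M.Compat fun i => u (i - 1) :=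
  fun i j h => hu _ _ (by rw [center_sub_one, center_sub_one, h])

lemma Compat.mul {u w : ℤ → ℝ} (hu : M.Compat u) (hw : M.Compat w) : M.Compat fun i => u i * w i :=
  fun i j h => by simp only [hu i j h, hw i j h]

lemma Compat.comp_center (f : K → ℝ) : M.Compat fun i => f (M.center i) :=
  fun i j h => by simp only [h]

variable (M) in
/-- A permutation of the index set which moves every midpoint by one cell. -/
lemma exists_shift : ∃ σ : M.index ≃ M.index, ∀ i, M.center (σ i) = M.center (i + 1) := by
  choose r hr hrc using M.exists_mem_index
  have hb : Function.Bijective fun i : M.index => (⟨r (i + 1), hr _⟩ : M.index) := by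
    constructor
    · intro i j hij
      have h := congrArg (fun k : M.index => M.center k) hij
      simp only [hrc, center_add_one, add_left_inj] at h
      exact Subtype.ext (M.index_injOn i.2 j.2 h)
    · intro j
      refine ⟨⟨r (j - 1), hr _⟩, Subtype.ext (M.index_injOn (hr _) j.2 ?_)⟩
      rw [hrc, center_add_one, hrc, ← center_add_one, sub_add_cancel]
  exact ⟨Equiv.ofBijective _ hb, fun i => hrc _⟩

lemma Compat.hasSum_shift_add {f : ℤ → ℝ} (hf : M.Compat f) {s : ℝ}
    (h : HasSum (fun i : M.index => f i) s) : HasSum (fun i : M.index => f (i + 1)) s := by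
  obtain ⟨σ, hσ⟩ := M.exists_shift
  rw [← σ.hasSum_iff] at h
  refine h.congr_fun fun i => ?_
  exact (hf _ _ (hσ i)).symm

lemma Compat.hasSum_shift_sub {f : ℤ → ℝ} (hf : M.Compat f) {s : ℝ}
    (h : HasSum (fun i : M.index => f i) s) : HasSum (fun i : M.index => f (i - 1)) s := by
  obtain ⟨σ, hσ⟩ := M.exists_shift
  rw [← σ.hasSum_iff]
  refine h.congr_fun fun i => ?_
  refine hf _ _ ?_
  rw [center_sub_one, hσ, center_add_one, add_sub_cancel_right]

variable (M)

lemma continuous_hat (i : ℤ) : Continuous (M.hat i) :=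
  continuous_const.max (continuous_const.sub
    ((continuous_id.dist continuous_const).div_const _))

lemma hat_nonneg (i : ℤ) (x : K) : 0 ≤ M.hat i x := le_max_left _ _

lemma exists_dist_center_eq (y : ℝ) (j : ℤ) :
    ∃ i, M.center i = M.center j ∧ dist (K.proj y) (M.center j) = |y - M.pos i| := by
  obtain ⟨z, hz, hd⟩ := K.exists_dist_eq y (M.pos j)
  obtain ⟨i, rfl, hi⟩ := M.exists_pos_eq (j := j) hz
  exact ⟨i, hi, hd⟩

lemma dist_center_le (y : ℝ) (j : ℤ) : dist (K.proj y) (M.center j) ≤ |y - M.pos j| :=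
  K.dist_proj_le _ _

/-- Only the two midpoints around `y` carry a nonzero hat, with values `1 - θ` and `θ`, where `θ` is
the relative position of `y` between them. On the torus this needs a check that no other lift of a
midpoint is closer; the distinctness of adjacent midpoints provides it. -/
lemma hasSum_hat (hdx : M.dx ≤ 1) {u : ℤ → ℝ} (hu : M.Compat u) (y : ℝ) :
    HasSum (fun i : M.index => M.hat i (K.proj y) * u i) (M.interp u y) := by
  have hpos := M.dx_pos
  set k := ⌊(y - M.origin) / M.dx⌋ with hk
  set θ := Int.fract ((y - M.origin) / M.dx) with hθ
  have hθ0 : 0 ≤ θ := Int.fract_nonneg _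
  have hθ1 : θ < 1 := Int.fract_lt_one _
  have hy : ∀ i : ℤ, y - M.pos i = ((k - i : ℤ) + θ) * M.dx := by
    intro i
    have h : (k : ℝ) + θ = (y - M.origin) / M.dx := Int.floor_add_fract _
    have h' : y - M.origin = ((k : ℝ) + θ) * M.dx := by rw [h]; field_simp
    simp only [pos]
    push_cast
    linarith
  have habs : ∀ i : ℤ, |y - M.pos i| = |((k - i : ℤ) : ℝ) + θ| * M.dx := fun i => by
    rw [hy, abs_mul, abs_of_pos hpos]
  have hlow : ∀ i : ℤ, i ≤ k → ((k - i : ℤ) : ℝ) + θ ≤ |((k - i : ℤ) : ℝ) + θ| :=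
    fun i _ => le_abs_self _
  have hhat : ∀ (j : ℤ) (c : ℝ), dist (K.proj y) (M.center j) = c * M.dx →
      M.hat j (K.proj y) = max 0 (1 - c) := fun j c h => by
    rw [hat, h, mul_div_cancel_right₀ _ hpos.ne']
  have hat_left : ∀ j, M.center j = M.center k → M.hat j (K.proj y) = 1 - θ := by
    intro j hj
    rw [hhat j θ, max_eq_right (by linarith)]
    refine le_antisymm ?_ ?_
    · rw [hj]
      refine (M.dist_center_le y k).trans ?_
      rw [habs, sub_self, Int.cast_zero, zero_add, abs_of_nonneg hθ0]
    · obtain ⟨i, hi, hd⟩ := M.exists_dist_center_eq y j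
      rw [hd, habs]
      refine mul_le_mul_of_nonneg_right ?_ hpos.le
      -- The lift `i` represents the same midpoint as `k`, which excludes `k + 1`; all remaining
      -- indices are at least `θ` cells away from `y`.
      have hne : i ≠ k + 1 := by
        rintro rfl
        exact M.center_ne_center_add_one hdx k (hj.symm.trans hi.symm)
      rcases le_or_gt i k with h | h
      · have : (0 : ℝ) ≤ ((k - i : ℤ) : ℝ) := by exact_mod_cast sub_nonneg.2 h
        linarith [hlow i h]
      · have : ((k - i : ℤ) : ℝ) ≤ -2 := by
          have : k - i ≤ -2 := by omega
          exact_mod_cast this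
        linarith [neg_abs_le (((k - i : ℤ) : ℝ) + θ)]
  have hat_right : ∀ j, M.center j = M.center (k + 1) → M.hat j (K.proj y) = θ := by
    intro j hj
    rw [hhat j (1 - θ), sub_sub_cancel, max_eq_right hθ0]
    refine le_antisymm ?_ ?_
    · rw [hj]
      refine (M.dist_center_le y (k + 1)).trans ?_
      rw [habs, sub_add_cancel_left, Int.cast_neg, Int.cast_one, abs_of_nonpos (by linarith)]
      exact le_of_eq (by ring)
    · obtain ⟨i, hi, hd⟩ := M.exists_dist_center_eq y j
      rw [hd, habs]
      refine mul_le_mul_of_nonneg_right ?_ hpos.le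
      have hne : i ≠ k := by
        rintro rfl
        exact M.center_ne_center_add_one hdx _ (hi.trans hj)
      rcases le_or_gt i k with h | h
      · have : (1 : ℝ) ≤ ((k - i : ℤ) : ℝ) := by
          have : 1 ≤ k - i := by omega
          exact_mod_cast this
        linarith [hlow i h]
      · have : ((k - i : ℤ) : ℝ) ≤ -1 := by
          have : k - i ≤ -1 := by omega
          exact_mod_cast this
        linarith [neg_abs_le (((k - i : ℤ) : ℝ) + θ)]
  have hat_else : ∀ j, M.center j ≠ M.center k → M.center j ≠ M.center (k + 1) →
      M.hat j (K.proj y) = 0 := by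
    intro j h1 h2
    obtain ⟨i, hi, hd⟩ := M.exists_dist_center_eq y j
    rw [hhat j _ (hd.trans (habs i)), max_eq_left]
    have hne1 : i ≠ k := by rintro rfl; exact h1 hi.symm
    have hne2 : i ≠ k + 1 := by rintro rfl; exact h2 hi.symm
    rcases le_or_gt i k with h | h
    · have : (1 : ℝ) ≤ ((k - i : ℤ) : ℝ) := by
        have : 1 ≤ k - i := by omega
        exact_mod_cast this
      linarith [hlow i h]
    · have : ((k - i : ℤ) : ℝ) ≤ -2 := by
        have : k - i ≤ -2 := by omega
        exact_mod_cast this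
      linarith [neg_abs_le (((k - i : ℤ) : ℝ) + θ)]
  obtain ⟨i₀, hi₀, hc₀⟩ := M.exists_mem_index k
  obtain ⟨i₁, hi₁, hc₁⟩ := M.exists_mem_index (k + 1)
  have hne : (⟨i₀, hi₀⟩ : M.index) ≠ ⟨i₁, hi₁⟩ := by
    intro h
    have h' : i₀ = i₁ := congrArg Subtype.val h
    exact M.center_ne_center_add_one hdx k (by rw [← hc₀, ← hc₁, h'])
  have := hasSum_sum_of_ne_finset_zero (f := fun i : M.index => M.hat i (K.proj y) * u i)
    (s := {⟨i₀, hi₀⟩, ⟨i₁, hi₁⟩}) (L := SummationFilter.unconditional _) (fun i hi => by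
      simp only [Finset.mem_insert, Finset.mem_singleton, not_or] at hi
      have h0 : M.hat i (K.proj y) = 0 := by
        refine hat_else i (fun h => hi.1 ?_) (fun h => hi.2 ?_)
        · exact Subtype.ext (M.index_injOn i.2 hi₀ (h.trans hc₀.symm))
        · exact Subtype.ext (M.index_injOn i.2 hi₁ (h.trans hc₁.symm))
      rw [h0, zero_mul])
  rw [Finset.sum_pair hne] at this
  rwa [hat_left _ hc₀, hat_right _ hc₁, hu _ _ hc₀, hu _ _ hc₁] at this

lemma isProbabilityMeasure_atomic {a : ℤ → ℝ} (ha : ∀ i, 0 ≤ a i)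
    (hs : HasSum (fun i : M.index => a i) 1) : IsProbabilityMeasure (M.atomic a) := by
  constructor
  rw [atomic, Measure.sum_apply _ MeasurableSet.univ]
  simp only [Measure.smul_apply, measure_univ, smul_eq_mul, mul_one]
  rw [← ENNReal.ofReal_tsum_of_nonneg (fun i : M.index => ha i) hs.summable, hs.tsum_eq, ENNReal.ofReal_one]

lemma hasSum_integral_atomic {a : ℤ → ℝ} (ha : ∀ i, 0 ≤ a i)
    (hs : HasSum (fun i : M.index => a i) 1) (ψ : K →ᵇ ℝ) :
    HasSum (fun i : M.index => a i * ψ (M.center i)) (∫ x, ψ x ∂(M.atomic a)) := by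
  have := M.isProbabilityMeasure_atomic ha hs
  have hinteg : Integrable (fun x => ψ x) (M.atomic a) := ψ.integrable _
  have h := hasSum_integral_measure hinteg
  refine h.congr_fun fun i => ?_
  rw [integral_smul_measure, integral_dirac, ENNReal.toReal_ofReal (ha i), smul_eq_mul]

/-! ### The discrete solution as the law of the random walk. -/

section Scheme

variable {V : Measure K → K → ℝ} {C₁ C₂ C₃ : ℝ} (hV : IsVelocity V C₁ C₂ C₃)
  {m : ProbabilityMeasure ℝ} {μ₀ : ProbabilityMeasure K} (hμ₀ : law K m 0 = μ₀)
  {dt : ℝ} (hdt : 0 < dt) (hdx : M.dx ≤ 1) (hcfl : C₁ * dt ≤ M.dx)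

/-- The velocities at the midpoints entering the `n`-th step of the scheme. -/
noncomputable def vel (V : Measure K → K → ℝ) (μ₀ : Measure K) (dt : ℝ) (n : ℕ) (i : ℤ) : ℝ :=
  V (M.discrete V μ₀ dt n) (M.center i)

/-- The mass in a cell is what jumps right from its left neighbour plus what jumps left from its
right neighbour. -/
lemma weight_succ (V : Measure K → K → ℝ) (μ₀ : Measure K) (dt : ℝ) (n : ℕ) (i : ℤ) :
    M.weight V μ₀ dt (n + 1) i =
      M.weight V μ₀ dt n (i - 1) * ((1 + dt / M.dx * M.vel V μ₀ dt n (i - 1)) / 2)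
      + M.weight V μ₀ dt n (i + 1) * ((1 - dt / M.dx * M.vel V μ₀ dt n (i + 1)) / 2) := by
  have := M.dx_pos.ne'
  simp only [weight, step, vel, discrete]
  field_simp
  ring

include hμ₀ hdx in
lemma hasSum_weight_zero {u : ℤ → ℝ} (hu : M.Compat u) {C : ℝ} (hC : ∀ i, |u i| ≤ C) :
    HasSum (fun i : M.index => M.weight V μ₀ dt 0 i * u i)
      (∫ y, M.interp u y ∂(m : Measure ℝ)) := by
  have hw : ∀ i : M.index, M.weight V μ₀ dt 0 i * u i =
      ∫ y, M.hat i (K.proj y) * u i ∂(m : Measure ℝ) := fun i => by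
    rw [integral_mul_const]
    simp only [weight]
    rw [← hμ₀, integral_law _ _ (M.continuous_hat _)]
    simp
  rw [funext hw]
  -- The hats form a partition of unity, so `C` times the hats is a dominating series with constant
  -- sum.
  have hone : ∀ y, HasSum (fun i : M.index => M.hat i (K.proj y) * C) C := fun y => by
    have := M.hasSum_hat hdx (u := fun _ => C) (fun _ _ _ => rfl) y
    simp only [interp] at this
    convert this using 1
    ring
  refine hasSum_integral_of_dominated_convergence
    (fun (i : M.index) y => M.hat i (K.proj y) * C) (fun i => ?_) (fun i => ?_)
    (ae_of_all _ fun y => (hone y).summable) ?_ (ae_of_all _ fun y => M.hasSum_hat hdx hu y)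
  · exact (((M.continuous_hat _).comp K.continuous_proj).mul continuous_const).aestronglyMeasurable
  · refine ae_of_all _ fun y => ?_
    rw [norm_mul, Real.norm_of_nonneg (M.hat_nonneg _ _)]
    exact mul_le_mul_of_nonneg_left (hC i) (M.hat_nonneg _ _)
  · simp only [(hone _).tsum_eq]
    exact integrable_const C

include hV hμ₀ hdt hdx hcfl in
-- The four claims must be proved together. The bound `|V| ≤ C₁` is available only for probability
-- measures, so nonnegativity and total mass one (the last claim with `u = 1`) at step `n` are what
-- make the next transition coefficients probabilities.
lemma weight_spec (n : ℕ) :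
    (∀ k < n, ∀ i, |dt / M.dx * M.vel V μ₀ dt k i| ≤ 1) ∧
    (∀ i, 0 ≤ M.weight V μ₀ dt n i) ∧ M.Compat (M.weight V μ₀ dt n) ∧
    ∀ u : ℤ → ℝ, M.Compat u → ∀ C, (∀ i, |u i| ≤ C) →
      HasSum (fun i : M.index => M.weight V μ₀ dt n i * u i)
        (∫ y, M.expect (dt / M.dx) (M.vel V μ₀ dt) n y u ∂(m : Measure ℝ)) := by
  induction n with
  | zero =>
    refine ⟨fun k hk => absurd hk (Nat.not_lt_zero k), fun i => ?_, fun i j h => ?_,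
      fun u hu C hC => M.hasSum_weight_zero hμ₀ hdx hu hC⟩
    · exact integral_nonneg fun x => M.hat_nonneg i x
    · simp only [weight, hat, h]
  | succ n ih =>
    obtain ⟨hv, hpos, hcomp, hsum⟩ := ih
    have hsum1 : HasSum (fun i : M.index => M.weight V μ₀ dt n i) 1 := by
      have := hsum (fun _ => 1) (fun _ _ _ => rfl) 1 (fun _ => by simp)
      simpa [expect_const] using this
    have hprob : IsProbabilityMeasure (M.discrete V μ₀ dt n) :=
      M.isProbabilityMeasure_atomic hpos hsum1
    have hvn : ∀ i, |dt / M.dx * M.vel V μ₀ dt n i| ≤ 1 := fun i => by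
      have h1 : |M.vel V μ₀ dt n i| ≤ C₁ := hV.abs_le ⟨_, hprob⟩ _
      rw [abs_mul, abs_of_pos (div_pos hdt M.dx_pos), div_mul_eq_mul_div, div_le_one M.dx_pos]
      nlinarith
    have hvc : M.Compat (M.vel V μ₀ dt n) := Compat.comp_center _
    refine ⟨fun k hk => ?_, fun i => ?_, fun i j h => ?_, fun u hu C hC => ?_⟩
    · rcases Nat.lt_succ_iff_lt_or_eq.1 hk with h | rfl
      · exact hv k h
      · exact hvn
    · rw [weight_succ]
      have h1 := (abs_le.1 (hvn (i - 1))).1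
      have h2 := (abs_le.1 (hvn (i + 1))).2
      exact add_nonneg (mul_nonneg (hpos _) (by linarith)) (mul_nonneg (hpos _) (by linarith))
    · have e1 := hcomp.shift_sub i j h
      have e2 := hcomp.shift_add i j h
      have e3 := hvc.shift_sub i j h
      have e4 := hvc.shift_add i j h
      simp only at e1 e2 e3 e4
      rw [weight_succ, weight_succ, e1, e2, e3, e4]
    · have hC0 : 0 ≤ C := (abs_nonneg _).trans (hC 0)
      let r : ℤ → ℝ := fun i => (1 + dt / M.dx * M.vel V μ₀ dt n i) / 2
      let l : ℤ → ℝ := fun i => (1 - dt / M.dx * M.vel V μ₀ dt n i) / 2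
      have hrc : M.Compat r := fun i j h => by simp only [r, hvc i j h]
      have hlc : M.Compat l := fun i j h => by simp only [l, hvc i j h]
      have hrb : ∀ i, |r i * u (i + 1)| ≤ C := fun i => by
        rw [abs_mul]
        have : |r i| ≤ 1 := by
          have := abs_le.1 (hvn i)
          exact abs_le.2 ⟨by simp only [r]; linarith, by simp only [r]; linarith⟩
        exact (mul_le_mul this (hC _) (abs_nonneg _) zero_le_one).trans (one_mul C).le
      have hlb : ∀ i, |l i * u (i - 1)| ≤ C := fun i => by
        rw [abs_mul]
        have : |l i| ≤ 1 := by
          have := abs_le.1 (hvn i)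
          exact abs_le.2 ⟨by simp only [l]; linarith, by simp only [l]; linarith⟩
        exact (mul_le_mul this (hC _) (abs_nonneg _) zero_le_one).trans (one_mul C).le
      have h1 := hsum _ (hrc.mul hu.shift_add) C hrb
      have h2 := hsum _ (hlc.mul hu.shift_sub) C hlb
      -- Summation by parts: shifting the index by one cell moves the step from the test function to
      -- the weights. `Compat` makes the shift legitimate on the torus.
      have h1' := (hcomp.mul (hrc.mul hu.shift_add)).hasSum_shift_sub h1
      have h2' := (hcomp.mul (hlc.mul hu.shift_sub)).hasSum_shift_add h2
      have h := h1'.add h2'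
      rw [← integral_add (M.integrable_expect m hv hrb) (M.integrable_expect m hv hlb)] at h
      simp only [← expect_add] at h
      refine h.congr_fun fun i => ?_
      rw [weight_succ, sub_add_cancel, add_sub_cancel_right]
      simp only [r, l]
      ring

include hV hμ₀ hdt hdx hcfl

lemma isProbabilityMeasure_discrete (n : ℕ) :
    IsProbabilityMeasure (M.discrete V μ₀ dt n) := by
  obtain ⟨-, hpos, -, hsum⟩ := M.weight_spec hV hμ₀ hdt hdx hcfl n
  refine M.isProbabilityMeasure_atomic hpos ?_
  have := hsum (fun _ => 1) (fun _ _ _ => rfl) 1 (fun _ => by simp)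
  simpa [expect_const] using this

lemma integral_discrete (n : ℕ) (ψ : K →ᵇ ℝ) :
    ∫ x, ψ x ∂(M.discrete V μ₀ dt n) =
      ∫ y, M.expect (dt / M.dx) (M.vel V μ₀ dt) n y (fun i => ψ (M.center i)) ∂(m : Measure ℝ) := by
  obtain ⟨-, hpos, -, hsum⟩ := M.weight_spec hV hμ₀ hdt hdx hcfl n
  have h1 : HasSum (fun i : M.index => M.weight V μ₀ dt n i) 1 := by
    have := hsum (fun _ => 1) (fun _ _ _ => rfl) 1 (fun _ => by simp)
    simpa [expect_const] using this
  exact (M.hasSum_integral_atomic hpos h1 ψ).unique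
    (hsum _ (Compat.comp_center _) ‖ψ‖ fun i => ψ.norm_coe_le_norm _)

/-- If the random walk at step `n` stays within mean square distance `s ^ 2` of `y + Z y`, uniformly
in `y`, then the discrete solution is `s`-close to the law of `y + Z y`. -/
lemma wassersteinDist_discrete_le (n : ℕ) {Z : ℝ →ᵇ ℝ} {s : ℝ} (hs : 0 < s)
    (h : ∀ y, M.expect (dt / M.dx) (M.vel V μ₀ dt) n y (fun i => (M.pos i - (y + Z y)) ^ 2)
      ≤ s ^ 2) :
    wassersteinDist (M.discrete V μ₀ dt n) (law K m Z) ≤ ENNReal.ofReal s := by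
  obtain ⟨hv, -⟩ := M.weight_spec hV hμ₀ hdt hdx hcfl n
  refine wassersteinDist_le fun ψ hψ => ?_
  have hi1 : Integrable (fun y => ψ (K.proj (y + Z y))) (m : Measure ℝ) :=
    Integrable.of_bound (ψ.continuous.comp (continuous_proj_add Z)).aestronglyMeasurable ‖ψ‖
      (ae_of_all _ fun y => ψ.norm_coe_le_norm _)
  have hi2 := M.integrable_expect m hv (u := fun i => ψ (M.center i)) fun i =>
    ψ.norm_coe_le_norm (M.center i)
  rw [integral_law m Z ψ.continuous, M.integral_discrete hV hμ₀ hdt hdx hcfl, ← integral_sub hi1 hi2]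
  refine (integral_mono (hi1.sub hi2) (integrable_const s) fun y => ?_).trans (by simp)
  simp only [Pi.sub_apply]
  have h1 : ψ (K.proj (y + Z y)) ≤ M.expect (dt / M.dx) (M.vel V μ₀ dt) n y
      (fun i => ψ (M.center i) + (s / 2 + 1 / (2 * s) * (M.pos i - (y + Z y)) ^ 2)) := by
    rw [← M.expect_const (lam := dt / M.dx) (v := M.vel V μ₀ dt) (n := n) y
      (ψ (K.proj (y + Z y)))]
    refine M.expect_mono hv y fun i => ?_
    have h2 := hψ.dist_le_mul (K.proj (y + Z y)) (M.center i)
    have h3 := M.dist_center_le (y + Z y) i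
    rw [Real.dist_eq] at h2
    simp only [NNReal.coe_one, one_mul] at h2
    have h4 := (le_abs_self _).trans (h2.trans h3)
    rw [abs_sub_comm] at h4
    -- Young's inequality replaces Cauchy–Schwarz, so only linearity and monotonicity of `expect`
    -- are needed; a second moment of at most `s ^ 2` then gives exactly `s`.
    have h5 : |M.pos i - (y + Z y)| ≤ s / 2 + 1 / (2 * s) * (M.pos i - (y + Z y)) ^ 2 := by
      rw [← sq_abs (M.pos i - (y + Z y))]
      have : s / 2 + 1 / (2 * s) * |M.pos i - (y + Z y)| ^ 2 - |M.pos i - (y + Z y)| =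
          (|M.pos i - (y + Z y)| - s) ^ 2 / (2 * s) := by
        field_simp
        ring
      have h6 : 0 ≤ (|M.pos i - (y + Z y)| - s) ^ 2 / (2 * s) := by positivity
      linarith
    linarith
  rw [expect_add, expect_add, expect_const, expect_const_mul] at h1
  have h7 : 1 / (2 * s) * M.expect (dt / M.dx) (M.vel V μ₀ dt) n y
      (fun i => (M.pos i - (y + Z y)) ^ 2) ≤ 1 / (2 * s) * s ^ 2 :=
    mul_le_mul_of_nonneg_left (h y) (by positivity)
  have h8 : 1 / (2 * s) * s ^ 2 = s / 2 := by field_simp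
  linarith

end Scheme

end Mesh

/-! ### Mean square error of the random walk and convergence of the scheme. -/

namespace Mesh

variable {K : Domain} (M : Mesh K) {V : Measure K → K → ℝ} {C₁ C₂ C₃ : ℝ}
  {hV : IsVelocity V C₁ C₂ C₃} {m : ProbabilityMeasure ℝ} {μ₀ : ProbabilityMeasure K}
  (hμ₀ : law K m 0 = μ₀) {dt : ℝ} (hdt : 0 < dt) (hdx : M.dx ≤ 1) (hcfl : C₁ * dt ≤ M.dx)
  {Z : ℝ → ℝ →ᵇ ℝ} (hZ : ∀ t, HasDerivAt Z (hV.field m (Z t)) t)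

include hZ in
/-- Comparison of the displacement of a characteristic over one time step with the displacement
given by a nearby probability measure at a nearby point. -/
lemma flow_increment_le (hdt : 0 ≤ dt) {ν : ProbabilityMeasure K} {t s : ℝ} (hs : 0 ≤ s)
    (hν : wassersteinDist (ν : Measure K) (law K m (Z t)) ≤ ENNReal.ofReal s) (y p : ℝ) :
    |Z (t + dt) y - Z t y - dt * V ν (K.proj p)|
      ≤ dt * (C₃ * s + C₂ * |p - (y + Z t y)| + (C₂ + C₃) * (C₁ * dt)) := by
  -- Subtracting the motion with constant velocity `V ν p` leaves a function whose derivative is the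
  -- velocity error, to which the mean value inequality applies.
  have hder : ∀ r ∈ Icc t (t + dt), HasDerivWithinAt (fun r => Z r y - r * V ν (K.proj p))
      (V (law K m (Z r)) (K.proj (y + Z r y)) - 1 * V ν (K.proj p)) (Icc t (t + dt)) r :=
    fun r _ => ((flow_hasDerivAt_apply hZ y r).sub
      ((hasDerivAt_id r).mul_const (V ν (K.proj p)))).hasDerivWithinAt
  have hbd : ∀ r ∈ Icc t (t + dt),
      ‖V (law K m (Z r)) (K.proj (y + Z r y)) - 1 * V ν (K.proj p)‖
        ≤ C₃ * s + C₂ * |p - (y + Z t y)| + (C₂ + C₃) * (C₁ * dt) := by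
    intro r hr
    have hrt : |t - r| ≤ dt := abs_le.2 ⟨by linarith [hr.2], by linarith [hr.1]⟩
    have hrt' := mul_le_mul_of_nonneg_left hrt hV.pos₁.le
    -- The error is split by changing, in turn, the law from time `r` to `t`, the point from time
    -- `r` to `t`, the point to `p`, and the law to `ν`.
    have h1 := hV.abs_sub_le_of_wassersteinDist_le (mul_nonneg hV.pos₁.le (abs_nonneg (t - r)))
      (wassersteinDist_flow_le hZ t r) (K.proj (y + Z r y))
    have h2 := hV.abs_sub_le (law K m (Z t)) (K.proj (y + Z t y)) (K.proj (y + Z r y))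
    have h3 := hV.abs_sub_le (law K m (Z t)) (K.proj p) (K.proj (y + Z t y))
    have h4 := hV.abs_sub_le_of_wassersteinDist_le hs hν (K.proj p)
    have h5 := K.dist_proj_le (y + Z t y) (y + Z r y)
    have h6 := BoundedContinuousFunction.dist_coe_le_dist (f := Z t) (g := Z r) y
    rw [Real.dist_eq] at h6
    rw [add_sub_add_left_eq_sub] at h5
    have h7 := mul_le_mul_of_nonneg_left ((h5.trans h6).trans (flow_dist_le hZ t r)) hV.pos₂.le
    have h8 := mul_le_mul_of_nonneg_left (K.dist_proj_le p (y + Z t y)) hV.pos₂.le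
    have h9 := mul_le_mul_of_nonneg_left hrt' hV.pos₂.le
    have h10 := mul_le_mul_of_nonneg_left hrt' hV.pos₃.le
    rw [Real.norm_eq_abs, one_mul, abs_le]
    have a1 := abs_le.1 h1
    have a2 := abs_le.1 h2
    have a3 := abs_le.1 h3
    have a4 := abs_le.1 h4
    constructor <;> linarith [a1.1, a1.2, a2.1, a2.2, a3.1, a3.2, a4.1, a4.2]
  have h := (convex_Icc t (t + dt)).norm_image_sub_le_of_norm_hasDerivWithin_le hder hbd
    (left_mem_Icc.2 (by linarith)) (right_mem_Icc.2 (by linarith))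
  rw [add_sub_cancel_left, Real.norm_eq_abs, Real.norm_of_nonneg hdt] at h
  calc |Z (t + dt) y - Z t y - dt * V ν (K.proj p)|
      = |Z (t + dt) y - (t + dt) * V ν (K.proj p) - (Z t y - t * V ν (K.proj p))| := by
        congr 1; ring
    _ ≤ _ := h
    _ = _ := mul_comm _ _

/-- The bound for the mean square distance between the random walk and the characteristics. -/
noncomputable def errorBound (C₂ C₃ dt dx : ℝ) (n : ℕ) : ℝ :=
  (1 + 3 * (C₂ + C₃) * dt) ^ n * (dx ^ 2 + n * (((C₂ + C₃) * dt + 4) * dx ^ 2))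

lemma errorBound_pos {C₂ C₃ dt dx : ℝ} (h₂ : 0 < C₂) (h₃ : 0 < C₃) (hdt : 0 < dt) (hdx : 0 < dx)
    (n : ℕ) : 0 < errorBound C₂ C₃ dt dx n := by
  have : 0 < C₂ + C₃ := add_pos h₂ h₃
  unfold errorBound
  positivity

lemma errorBound_succ_le {C₂ C₃ dt dx : ℝ} (h₂ : 0 < C₂) (h₃ : 0 < C₃) (hdt : 0 < dt)
    (hdx : 0 < dx) (n : ℕ) :
    (1 + 3 * (C₂ + C₃) * dt) * errorBound C₂ C₃ dt dx n + ((C₂ + C₃) * dt + 4) * dx ^ 2 ≤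
      errorBound C₂ C₃ dt dx (n + 1) := by
  have h0 : 0 < C₂ + C₃ := add_pos h₂ h₃
  have hL : 0 ≤ 3 * (C₂ + C₃) * dt := by positivity
  have h1 : 1 ≤ (1 + 3 * (C₂ + C₃) * dt) ^ (n + 1) := one_le_pow₀ (by linarith)
  have h2 : 0 ≤ ((C₂ + C₃) * dt + 4) * dx ^ 2 := by positivity
  have h3 := mul_le_mul_of_nonneg_right h1 h2
  have h4 : errorBound C₂ C₃ dt dx (n + 1) =
      (1 + 3 * (C₂ + C₃) * dt) * errorBound C₂ C₃ dt dx n +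
        (1 + 3 * (C₂ + C₃) * dt) ^ (n + 1) * (((C₂ + C₃) * dt + 4) * dx ^ 2) := by
    simp only [errorBound]
    push_cast
    ring
  linarith

include hμ₀ hdt hdx hcfl hZ

lemma expect_sq_le (hZ0 : Z 0 = 0) (n : ℕ) (y : ℝ) :
    M.expect (dt / M.dx) (M.vel V μ₀ dt) n y
      (fun i => (M.pos i - (y + Z (n * dt) y)) ^ 2) ≤ errorBound C₂ C₃ dt M.dx n := by
  induction n generalizing y with
  | zero =>
    have hpos := M.dx_pos
    simp only [expect, backward, interp, errorBound, Nat.cast_zero, zero_mul, hZ0, pow_zero,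
      one_mul, add_zero, BoundedContinuousFunction.coe_zero, Pi.zero_apply, pos]
    set k := ⌊(y - M.origin) / M.dx⌋
    set θ := Int.fract ((y - M.origin) / M.dx)
    have hθ0 : 0 ≤ θ := Int.fract_nonneg _
    have hθ1 : θ < 1 := Int.fract_lt_one _
    have hy : y = M.origin + ((k : ℝ) + θ) * M.dx := by
      have h : (k : ℝ) + θ = (y - M.origin) / M.dx := Int.floor_add_fract _
      rw [h]; field_simp; ring
    push_cast
    rw [hy]
    have : (1 - θ) * (M.origin + ↑k * M.dx - (M.origin + (↑k + θ) * M.dx)) ^ 2 +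
        θ * (M.origin + (↑k + 1) * M.dx - (M.origin + (↑k + θ) * M.dx)) ^ 2 =
        (θ * (1 - θ)) * M.dx ^ 2 := by ring
    rw [this]
    have h1 : θ * (1 - θ) ≤ 1 := by nlinarith
    nlinarith [mul_le_mul_of_nonneg_right h1 (sq_nonneg M.dx)]
  | succ n ih =>
    have hpos := M.dx_pos
    obtain ⟨hv, -⟩ := M.weight_spec hV hμ₀ hdt hdx hcfl n
    have hprob := M.isProbabilityMeasure_discrete hV hμ₀ hdt hdx hcfl n
    have hB := errorBound_pos hV.pos₂ hV.pos₃ hdt hpos n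
    set B := errorBound C₂ C₃ dt M.dx n with hBdef
    have hs : 0 < √B := Real.sqrt_pos.2 hB
    have hs2 : √B ^ 2 = B := Real.sq_sqrt hB.le
    -- The induction hypothesis for all starting points controls the whole measure, hence the error
    -- in the velocity; this closes the nonlinear estimate.
    have hW : wassersteinDist (M.discrete V μ₀ dt n) (law K m (Z (n * dt)))
        ≤ ENNReal.ofReal √B :=
      M.wassersteinDist_discrete_le hV hμ₀ hdt hdx hcfl n hs fun y => by rw [hs2]; exact ih y
    have hstep : ∀ i, backStep (dt / M.dx) (M.vel V μ₀ dt n)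
        (fun i => (M.pos i - (y + Z ((n + 1 : ℕ) * dt) y)) ^ 2) i ≤
        (dt * (C₃ * B) + ((C₂ + C₃) * dt + 4) * M.dx ^ 2) +
          (1 + dt * (3 * C₂ + 2 * C₃)) * (M.pos i - (y + Z (n * dt) y)) ^ 2 := by
      intro i
      have hinc := flow_increment_le hZ hdt.le (ν := ⟨_, hprob⟩) hs.le hW y (M.pos i)
      have htime : ((n + 1 : ℕ) : ℝ) * dt = n * dt + dt := by push_cast; ring
      rw [htime]
      have hvi : |M.vel V μ₀ dt n i| ≤ C₁ := hV.abs_le ⟨_, hprob⟩ _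
      have hvdt : |dt * M.vel V μ₀ dt n i| ≤ M.dx := by
        rw [abs_mul, abs_of_pos hdt]; nlinarith
      have hDdt : |Z (n * dt + dt) y - Z (n * dt) y| ≤ M.dx := by
        have h1 := BoundedContinuousFunction.dist_coe_le_dist (f := Z (n * dt + dt))
          (g := Z (n * dt)) y
        have h2 := flow_dist_le hZ (n * dt + dt) (n * dt)
        rw [Real.dist_eq] at h1
        rw [add_sub_cancel_left, abs_of_pos hdt] at h2
        exact (h1.trans h2).trans hcfl
      -- The walk always moves by exactly one cell, so its squared increment is `dx ^ 2`, and its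
      -- mean increment is `dt * v`.
      have hbs : backStep (dt / M.dx) (M.vel V μ₀ dt n)
          (fun i => (M.pos i - (y + Z (n * dt + dt) y)) ^ 2) i =
          (M.pos i - (y + Z (n * dt + dt) y)) ^ 2 +
            2 * (dt * M.vel V μ₀ dt n i) * (M.pos i - (y + Z (n * dt + dt) y)) + M.dx ^ 2 := by
        simp only [backStep, pos_add_one, pos_sub_one]
        have := hpos.ne'
        field_simp
        ring
      rw [hbs]
      change |Z (n * dt + dt) y - Z (n * dt) y - dt * M.vel V μ₀ dt n i| ≤ _ at hinc
      set D := Z (n * dt + dt) y - Z (n * dt) y with hD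
      set w := dt * M.vel V μ₀ dt n i with hw
      set d := M.pos i - (y + Z (n * dt) y) with hd
      have he : M.pos i - (y + Z (n * dt + dt) y) = d - D := by rw [hd, hD]; ring
      rw [he]
      -- The drift error is multiplied by `2 * |d|` and split by Young's inequality. The term in `B`
      -- contributes another `dt * C₃` after taking expectations, which makes the total growth rate
      -- `3 * (C₂ + C₃)`.
      have hcross : 2 * d * (w - D) ≤
          dt * (C₃ * B) + dt * (3 * C₂ + 2 * C₃) * d ^ 2 + dt * ((C₂ + C₃) * M.dx ^ 2) := by
        have h1 : d * (w - D) ≤ |d| * |D - w| := by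
          rw [abs_sub_comm D w, ← abs_mul]
          exact le_abs_self _
        have h2 := mul_le_mul_of_nonneg_left hinc (abs_nonneg d)
        have h3 : 2 * |d| * √B ≤ d ^ 2 + B := by
          nlinarith [sq_nonneg (|d| - √B), sq_abs d]
        have h4 : 2 * |d| * (C₁ * dt) ≤ d ^ 2 + M.dx ^ 2 := by
          have : 2 * |d| * (C₁ * dt) ≤ 2 * |d| * M.dx :=
            mul_le_mul_of_nonneg_left hcfl (by positivity)
          nlinarith [sq_nonneg (|d| - M.dx), sq_abs d]
        have h5 := mul_le_mul_of_nonneg_left h3 (mul_nonneg hdt.le hV.pos₃.le)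
        have h6 := mul_le_mul_of_nonneg_left h4
          (mul_nonneg hdt.le (add_pos hV.pos₂ hV.pos₃).le)
        have h7 : |d| * |d| = d ^ 2 := by rw [← sq, sq_abs]
        have h8 : 2 * (|d| * (dt * (C₃ * √B + C₂ * |d| + (C₂ + C₃) * (C₁ * dt)))) =
            dt * C₃ * (2 * |d| * √B) + 2 * dt * C₂ * (|d| * |d|) +
              dt * (C₂ + C₃) * (2 * |d| * (C₁ * dt)) := by ring
        rw [h7] at h8
        linarith
      -- By the CFL condition both the drift `w` and the true increment `D` are at most one cell.
      have hquad : D ^ 2 - 2 * w * D + M.dx ^ 2 ≤ 4 * M.dx ^ 2 := by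
        have h1 := abs_le.1 hvdt
        have h2 := abs_le.1 hDdt
        have h3 : D ^ 2 ≤ M.dx ^ 2 := sq_le_sq' h2.1 h2.2
        have h4 : |w * D| ≤ M.dx * M.dx := by
          rw [abs_mul]; exact mul_le_mul hvdt hDdt (abs_nonneg _) hpos.le
        have h5 := (abs_le.1 h4).1
        linarith
      have hexp : (d - D) ^ 2 + 2 * w * (d - D) + M.dx ^ 2 =
          d ^ 2 + 2 * d * (w - D) + (D ^ 2 - 2 * w * D + M.dx ^ 2) := by ring
      rw [hexp]
      linarith
    rw [expect_succ]
    refine (M.expect_mono hv y hstep).trans ?_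
    rw [expect_add, expect_const, expect_const_mul]
    refine le_trans ?_ (errorBound_succ_le hV.pos₂ hV.pos₃ hdt hpos n)
    rw [← hBdef]
    have hc : 0 ≤ 1 + dt * (3 * C₂ + 2 * C₃) := by
      have := hV.pos₂; have := hV.pos₃; positivity
    have := mul_le_mul_of_nonneg_left (ih y) hc
    linarith

lemma wassersteinDist_discrete_flow_le (hZ0 : Z 0 = 0) (n : ℕ) :
    wassersteinDist (M.discrete V μ₀ dt n) (law K m (Z (n * dt)))
      ≤ ENNReal.ofReal √(errorBound C₂ C₃ dt M.dx n) := by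
  have hB := errorBound_pos hV.pos₂ hV.pos₃ hdt M.dx_pos n
  refine M.wassersteinDist_discrete_le hV hμ₀ hdt hdx hcfl n (Real.sqrt_pos.2 hB) fun y => ?_
  rw [Real.sq_sqrt hB.le]
  exact M.expect_sq_le hμ₀ hdt hdx hcfl hZ hZ0 n y

/-- The two grid times used are within `dt` of `t`, and the flow moves by at most `C₁ * dt ≤ dx` in
that time. The later one may exceed `t`, hence the range up to `t + dt` in `h`. -/
lemma wassersteinDist_interpolant_flow_le (hZ0 : Z 0 = 0) {t : ℝ} (ht : 0 ≤ t) {s : ℝ}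
    (h : ∀ n : ℕ, n * dt ≤ t + dt → errorBound C₂ C₃ dt M.dx n ≤ s ^ 2) (hs : 0 ≤ s) :
    wassersteinDist (M.interpolant V μ₀ dt t) (law K m (Z t)) ≤ ENNReal.ofReal (s + M.dx) := by
  refine wassersteinDist_le fun ψ hψ => ?_
  set n := ⌊t / dt⌋₊ with hn
  have h1 : n * dt ≤ t := (le_div_iff₀ hdt).1 (Nat.floor_le (div_nonneg ht hdt.le))
  have h2 : t < (n + 1) * dt := (div_lt_iff₀ hdt).1 (Nat.lt_floor_add_one _)
  have hp0 := M.isProbabilityMeasure_discrete hV hμ₀ hdt hdx hcfl n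
  have hp1 := M.isProbabilityMeasure_discrete hV hμ₀ hdt hdx hcfl (n + 1)
  have key : ∀ k : ℕ, k * dt ≤ t + dt → |k * dt - t| ≤ dt →
      (∫ x, ψ x ∂(law K m (Z t) : Measure K)) - ∫ x, ψ x ∂(M.discrete V μ₀ dt k) ≤ s + M.dx := by
    intro k hk hkt
    have e1 := integral_sub_le_of_wassersteinDist_le (Real.sqrt_nonneg _)
      (M.wassersteinDist_discrete_flow_le hμ₀ hdt hdx hcfl hZ hZ0 k) ψ hψ
    have e2 := integral_sub_le_of_wassersteinDist_le (mul_nonneg hV.pos₁.le (abs_nonneg _))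
      (wassersteinDist_flow_le hZ (k * dt) t) ψ hψ
    have e3 : √(errorBound C₂ C₃ dt M.dx k) ≤ s := Real.sqrt_le_iff.2 ⟨hs, h k hk⟩
    have e4 := mul_le_mul_of_nonneg_left hkt hV.pos₁.le
    linarith
  have k0 := key n (by linarith) (abs_le.2 ⟨by linarith, by linarith⟩)
  have k1 := key (n + 1) (by push_cast; linarith)
    (abs_le.2 ⟨by push_cast; linarith, by push_cast; linarith⟩)
  have ha : 0 ≤ ((n + 1) * dt - t) / dt := div_nonneg (by linarith) hdt.le
  have hb : 0 ≤ (t - n * dt) / dt := div_nonneg (by linarith) hdt.le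
  have hab : ((n + 1) * dt - t) / dt + (t - n * dt) / dt = 1 := by field_simp; ring
  have hinteg : ∫ x, ψ x ∂(M.interpolant V μ₀ dt t) =
      ((n + 1) * dt - t) / dt * ∫ x, ψ x ∂(M.discrete V μ₀ dt n) +
        (t - n * dt) / dt * ∫ x, ψ x ∂(M.discrete V μ₀ dt (n + 1)) := by
    have i0 : Integrable (fun x => ψ x) (M.discrete V μ₀ dt n) := ψ.integrable _
    have i1 : Integrable (fun x => ψ x) (M.discrete V μ₀ dt (n + 1)) := ψ.integrable _
    simp only [interpolant, ← hn]
    rw [integral_add_measure (i0.smul_measure ENNReal.ofReal_ne_top)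
      (i1.smul_measure ENNReal.ofReal_ne_top), integral_smul_measure, integral_smul_measure,
      ENNReal.toReal_ofReal ha, ENNReal.toReal_ofReal hb, smul_eq_mul, smul_eq_mul]
  rw [hinteg]
  set a := ((n + 1) * dt - t) / dt
  set b := (t - n * dt) / dt
  have ha' : a = 1 - b := by linarith
  have e0 := mul_le_mul_of_nonneg_left k0 ha
  have e1 := mul_le_mul_of_nonneg_left k1 hb
  rw [ha'] at e0 ⊢
  linarith

end Mesh

/-- The lower bound on `dt / dx` gives `n * dx ≤ S / lam₀`, so `n` contributions of size `dx ^ 2`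
add up to `O(dx)`. Without it the accumulated diffusion need not vanish. -/
lemma Mesh.errorBound_le {C₂ C₃ dt dx lam₀ S : ℝ} (h₂ : 0 < C₂) (h₃ : 0 < C₃) (hlam₀ : 0 < lam₀)
    (hdt : 0 < dt) (hdt1 : dt ≤ 1) (hdx : 0 < dx) (hdx1 : dx ≤ 1) (hlam : lam₀ * dx ≤ dt) {n : ℕ}
    (hn : n * dt ≤ S) :
    errorBound C₂ C₃ dt dx n ≤
      Real.exp (3 * (C₂ + C₃) * S) * (1 + S / lam₀ * (C₂ + C₃ + 4)) * dx := by
  have hL : 0 < C₂ + C₃ := add_pos h₂ h₃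
  have h1 : (1 + 3 * (C₂ + C₃) * dt) ^ n ≤ Real.exp (3 * (C₂ + C₃) * S) := by
    calc (1 + 3 * (C₂ + C₃) * dt) ^ n ≤ Real.exp (3 * (C₂ + C₃) * dt) ^ n := by
          refine pow_le_pow_left₀ (by positivity) ?_ n
          rw [add_comm]
          exact Real.add_one_le_exp _
      _ = Real.exp (n * (3 * (C₂ + C₃) * dt)) := (Real.exp_nat_mul _ _).symm
      _ ≤ _ := by
          refine Real.exp_le_exp.2 ?_
          have := mul_le_mul_of_nonneg_left hn (by positivity : 0 ≤ 3 * (C₂ + C₃))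
          linarith
  have h2 : n * dx ≤ S / lam₀ := by
    rw [le_div_iff₀ hlam₀]
    have := mul_le_mul_of_nonneg_left hlam (n.cast_nonneg (α := ℝ))
    linarith
  have h3 : dx ^ 2 + n * (((C₂ + C₃) * dt + 4) * dx ^ 2) ≤
      (1 + S / lam₀ * (C₂ + C₃ + 4)) * dx := by
    have e1 : dx ^ 2 ≤ dx := by nlinarith
    have e2 : (C₂ + C₃) * dt + 4 ≤ C₂ + C₃ + 4 := by nlinarith
    have e3 : n * dx * ((C₂ + C₃) * dt + 4) ≤ S / lam₀ * (C₂ + C₃ + 4) :=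
      mul_le_mul h2 e2 (by positivity) ((by positivity : (0 : ℝ) ≤ n * dx).trans h2)
    have e4 := mul_le_mul_of_nonneg_right e3 hdx.le
    nlinarith
  calc errorBound C₂ C₃ dt dx n
      ≤ Real.exp (3 * (C₂ + C₃) * S) * ((1 + S / lam₀ * (C₂ + C₃ + 4)) * dx) :=
        mul_le_mul h1 h3 (by positivity) (Real.exp_pos _).le
    _ = _ := by ring

theorem interpolant_tendsto_flow {K : Domain} {V : Measure K → K → ℝ} {C₁ C₂ C₃ : ℝ}
    {hV : IsVelocity V C₁ C₂ C₃} {m : ProbabilityMeasure ℝ} {μ₀ : ProbabilityMeasure K}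
    (hμ₀ : law K m 0 = μ₀) {Z : ℝ → ℝ →ᵇ ℝ} (hZ : ∀ t, HasDerivAt Z (hV.field m (Z t)) t)
    (hZ0 : Z 0 = 0) {lam₀ : ℝ} (hlam₀ : 0 < lam₀) {T : ℝ} (hT : 0 < T) {ε : ℝ} (hε : 0 < ε) :
    ∃ δ : ℝ, 0 < δ ∧ ∀ (M : Mesh K) (dt : ℝ), M.dx < δ → lam₀ ≤ dt / M.dx → dt / M.dx ≤ C₁⁻¹ →
      (⨆ t ∈ Icc (0 : ℝ) T, wassersteinDist (M.interpolant V μ₀ dt t)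
        (law K m (Z t) : Measure K)) ≤ ENNReal.ofReal ε := by
  have hL : 0 < C₂ + C₃ := add_pos hV.pos₂ hV.pos₃
  set Q := Real.exp (3 * (C₂ + C₃) * (T + 1)) * (1 + (T + 1) / lam₀ * (C₂ + C₃ + 4)) with hQdef
  have hQ : 0 < Q := by positivity
  -- `dx < C₁` and the CFL condition give `dt ≤ 1`, so times up to `T + 1` suffice; the last two
  -- entries give `ε / 2` each to the time interpolation and to the scheme.
  refine ⟨min (min 1 C₁) (min (ε / 2) ((ε / 2) ^ 2 / Q)),
    lt_min (lt_min one_pos hV.pos₁) (lt_min (by positivity) (by positivity)), ?_⟩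
  intro M dt hδ hlam hcfl
  obtain ⟨⟨hdx1, hdxC⟩, hdxε, hdxQ⟩ := by simpa only [lt_min_iff] using hδ
  have hpos := M.dx_pos
  have hlam' : lam₀ * M.dx ≤ dt := (le_div_iff₀ hpos).1 hlam
  have hdt : 0 < dt := (mul_pos hlam₀ hpos).trans_le hlam'
  have hcfl' : C₁ * dt ≤ M.dx := by
    have h1 := (div_le_iff₀ hpos).1 hcfl
    have h2 := mul_le_mul_of_nonneg_left h1 hV.pos₁.le
    rwa [mul_inv_cancel_left₀ hV.pos₁.ne'] at h2
  have hdt1 : dt ≤ 1 := by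
    by_contra h
    have := mul_lt_mul_of_pos_left (not_le.1 h) hV.pos₁
    linarith
  refine iSup₂_le fun t ht => ?_
  refine (M.wassersteinDist_interpolant_flow_le hμ₀ hdt hdx1.le hcfl' hZ hZ0 ht.1
    (s := ε / 2) (fun n hn => ?_) (by positivity)).trans
    (ENNReal.ofReal_le_ofReal (by linarith))
  refine (Mesh.errorBound_le hV.pos₂ hV.pos₃ hlam₀ hdt hdt1 hpos hdx1.le hlam' (S := T + 1)
    (by linarith [ht.2])).trans ?_
  rw [lt_div_iff₀ hQ] at hdxQ
  linarith

/-! ### Test functions in space and cutoffs in time. -/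

lemma Domain.properSpace (K : Domain) : ProperSpace K := by
  cases K
  · exact inferInstanceAs (ProperSpace ℝ)
  · have : Fact (0 < 2 * Real.pi) := ⟨Real.two_pi_pos⟩
    exact inferInstanceAs (ProperSpace (AddCircle (2 * Real.pi)))

variable {K : Domain}

/-- Smooth compactly supported functions on `K`. -/
structure IsSpaceTest (ψ : K → ℝ) : Prop where
  smooth : ContDiff ℝ ∞ fun y => ψ (K.proj y)
  compactSupport : HasCompactSupport ψ

/-- The derivative of a function on `K`. -/
noncomputable def sderiv (ψ : K → ℝ) (x : K) : ℝ := deriv (fun h : ℝ => ψ (x + K.proj h)) 0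

lemma sderiv_proj (ψ : K → ℝ) (y : ℝ) :
    sderiv ψ (K.proj y) = deriv (fun y => ψ (K.proj y)) y := by
  have h := deriv_comp_const_add (fun y => ψ (K.proj y)) y 0
  rw [add_zero] at h
  rw [← h]
  simp only [sderiv, K.proj_add]

namespace IsSpaceTest

variable {ψ : K → ℝ} (hψ : IsSpaceTest ψ)
include hψ

lemma continuous : Continuous ψ := K.continuous_comp_proj_iff.1 hψ.smooth.continuous

lemma exists_bound : ∃ C, ∀ x, |ψ x| ≤ C :=
  hψ.continuous.bounded_above_of_compact_support hψ.compactSupport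

lemma sderiv : IsSpaceTest (sderiv ψ) := by
  refine ⟨?_, ?_⟩
  · simp_rw [sderiv_proj]
    have h := hψ.smooth
    rw [contDiff_infty_iff_deriv] at h
    exact h.2
  · refine HasCompactSupport.intro hψ.compactSupport fun x hx => ?_
    have hev : (fun h : ℝ => ψ (x + K.proj h)) =ᶠ[nhds 0] fun _ => 0 := by
      have h0 := notMem_tsupport_iff_eventuallyEq.1 hx
      have h1 : Filter.Tendsto (fun h : ℝ => x + K.proj h) (nhds 0) (nhds x) := by
        have h2 : Continuous fun h => x + K.proj h := continuous_const.add K.continuous_proj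
        have := h2.tendsto 0
        rwa [K.proj_zero, add_zero] at this
      exact h1.eventually h0
    rw [LaxFriedrichs.sderiv, hev.deriv_eq, deriv_const]

lemma integrable (ν : ProbabilityMeasure K) : Integrable ψ (ν : Measure K) := by
  obtain ⟨C, hC⟩ := hψ.exists_bound
  exact Integrable.of_bound hψ.continuous.aestronglyMeasurable C (ae_of_all _ hC)

lemma mul {χ : K → ℝ} (hχ : ContDiff ℝ ∞ fun y => χ (K.proj y)) :
    IsSpaceTest fun x => χ x * ψ x :=
  ⟨hχ.mul hψ.smooth, hψ.compactSupport.mul_left⟩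

lemma prod {χ : ℝ → ℝ} (hχ : ContDiff ℝ ∞ χ) (hc : HasCompactSupport χ) :
    IsTestFunction fun p : K × ℝ => ψ p.1 * χ p.2 := by
  refine ⟨(hψ.smooth.comp contDiff_fst).mul (hχ.comp contDiff_snd), ?_⟩
  refine HasCompactSupport.intro (hψ.compactSupport.isCompact.prod hc.isCompact) fun p hp => ?_
  rw [mem_prod, not_and_or] at hp
  rcases hp with h | h
  · rw [image_eq_zero_of_notMem_tsupport h, zero_mul]
  · rw [image_eq_zero_of_notMem_tsupport h, mul_zero]

end IsSpaceTest

lemma spaceDeriv_prod (ψ : K → ℝ) (χ : ℝ → ℝ) (x : K) (t : ℝ) :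
    spaceDeriv (fun p : K × ℝ => ψ p.1 * χ p.2) x t = sderiv ψ x * χ t := by
  simp only [spaceDeriv, sderiv, deriv_mul_const_field]

lemma timeDeriv_prod (ψ : K → ℝ) (χ : ℝ → ℝ) (x : K) (t : ℝ) :
    timeDeriv (fun p : K × ℝ => ψ p.1 * χ p.2) x t = ψ x * deriv χ t := by
  simp only [timeDeriv, deriv_const_mul_field]

/-- Smooth compactly supported cutoffs equal to `1` on `[0, t]` and to `0` after `t + δ`. -/
lemma exists_time_cutoff : ∃ C : ℝ, 0 ≤ C ∧ ∀ t δ : ℝ, 0 ≤ t → 0 < δ → ∃ χ : ℝ → ℝ,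
    ContDiff ℝ ∞ χ ∧ HasCompactSupport χ ∧ (∀ s, 0 ≤ s → s ≤ t → χ s = 1) ∧
    (∀ s, t + δ ≤ s → χ s = 0) ∧ (∀ s, |χ s| ≤ 1) ∧ (∀ s, 0 < s → s < t → deriv χ s = 0) ∧
    (∀ s, t + δ < s → deriv χ s = 0) ∧ ∀ s, 0 < s → |deriv χ s| ≤ C / δ := by
  let σ := Real.smoothTransition
  have hσ : ContDiff ℝ ∞ σ := Real.smoothTransition.contDiff
  have hσ' : Continuous (deriv σ) := hσ.continuous_deriv (by simp)
  obtain ⟨C, hC⟩ : ∃ C, ∀ x, |deriv σ x| ≤ C := by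
    obtain ⟨C, hC⟩ := isCompact_Icc.exists_bound_of_continuousOn (s := Icc (0 : ℝ) 1)
      hσ'.continuousOn
    refine ⟨C, fun x => ?_⟩
    have hC0 : 0 ≤ C := (norm_nonneg _).trans (hC 0 (by simp))
    rcases lt_or_ge x 0 with h | h
    · have : σ =ᶠ[nhds x] fun _ => 0 := by
        filter_upwards [Iio_mem_nhds h] with y hy
        exact Real.smoothTransition.zero_of_nonpos (le_of_lt hy)
      rw [this.deriv_eq, deriv_const, abs_zero]; exact hC0
    · rcases lt_or_ge 1 x with h' | h'
      · have : σ =ᶠ[nhds x] fun _ => 1 := by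
          filter_upwards [Ioi_mem_nhds h'] with y hy
          exact Real.smoothTransition.one_of_one_le (le_of_lt hy)
        rw [this.deriv_eq, deriv_const, abs_zero]; exact hC0
      · exact hC x ⟨h, h'⟩
  have hC0 : 0 ≤ C := (abs_nonneg _).trans (hC 0)
  refine ⟨C, hC0, fun t δ ht hδ => ?_⟩
  -- The first factor only provides compact support at negative times and is `1` for `s ≥ -1`. The
  -- second descends from `1` to `0` on `[t, t + δ]`.
  let χ : ℝ → ℝ := fun s => σ (s + 2) * σ ((t + δ - s) / δ)
  have hχ0 : ∀ s, t + δ ≤ s → χ s = 0 := fun s hs => by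
    have : σ ((t + δ - s) / δ) = 0 :=
      Real.smoothTransition.zero_of_nonpos (div_nonpos_of_nonpos_of_nonneg (by linarith) hδ.le)
    simp only [χ, this, mul_zero]
  have hχp : ∀ s, -1 ≤ s → χ s = σ ((t + δ - s) / δ) := fun s hs => by
    have : σ (s + 2) = 1 := Real.smoothTransition.one_of_one_le (by linarith)
    simp only [χ, this, one_mul]
  have hχ1 : ∀ s, 0 ≤ s → s ≤ t → χ s = 1 := fun s hs hst => by
    rw [hχp s (by linarith)]
    exact Real.smoothTransition.one_of_one_le (by rw [le_div_iff₀ hδ]; linarith)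
  refine ⟨χ, ?_, ?_, hχ1, hχ0, ?_, ?_, ?_, ?_⟩
  · exact (hσ.comp (contDiff_id.add contDiff_const)).mul
      (hσ.comp ((contDiff_const.sub contDiff_id).div_const _))
  · refine HasCompactSupport.intro (isCompact_Icc (a := -2) (b := t + δ)) fun s hs => ?_
    rw [mem_Icc, not_and_or, not_le, not_le] at hs
    rcases hs with h | h
    · have : σ (s + 2) = 0 := Real.smoothTransition.zero_of_nonpos (by linarith)
      simp only [χ, this, zero_mul]
    · exact hχ0 s h.le
  · intro s
    rw [abs_of_nonneg (mul_nonneg (Real.smoothTransition.nonneg _)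
      (Real.smoothTransition.nonneg _))]
    exact mul_le_one₀ (Real.smoothTransition.le_one _) (Real.smoothTransition.nonneg _)
      (Real.smoothTransition.le_one _)
  · intro s hs hst
    have : χ =ᶠ[nhds s] fun _ => 1 := by
      filter_upwards [Ioo_mem_nhds hs hst] with r hr using hχ1 r hr.1.le hr.2.le
    rw [this.deriv_eq, deriv_const]
  · intro s hs
    have : χ =ᶠ[nhds s] fun _ => 0 := by
      filter_upwards [Ioi_mem_nhds hs] with r hr using hχ0 r (le_of_lt hr)
    rw [this.deriv_eq, deriv_const]
  · intro s hs
    have hev : χ =ᶠ[nhds s] fun s => σ ((t + δ - s) / δ) := by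
      filter_upwards [Ioi_mem_nhds (by linarith : -1 < s)] with r hr using hχp r (le_of_lt hr)
    have h1 : HasDerivAt (fun s => (t + δ - s) / δ) (-1 / δ) s :=
      ((hasDerivAt_id s).const_sub (t + δ)).div_const δ
    have h2 := ((hσ.differentiable (by simp) ((t + δ - s) / δ)).hasDerivAt).comp s h1
    have h3 : deriv (fun s => σ ((t + δ - s) / δ)) s = deriv σ ((t + δ - s) / δ) * (-1 / δ) :=
      h2.deriv
    rw [hev.deriv_eq, h3, abs_mul, abs_div, abs_neg, abs_one, abs_of_pos hδ, mul_one_div]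
    exact div_le_div_of_nonneg_right (hC _) hδ.le

/-! ### The weak formulation integrated in time. -/

section WeakForm

variable {V : Measure K → K → ℝ} {C₁ C₂ C₃ : ℝ} (hV : IsVelocity V C₁ C₂ C₃)
  {μ₀ : ProbabilityMeasure K} {μ : ℝ → ProbabilityMeasure K}

/-- The rate of change of `∫ ψ dμ_t` along a solution. -/
noncomputable def flux (V : Measure K → K → ℝ) (μ : ℝ → ProbabilityMeasure K) (ψ : K → ℝ)
    (t : ℝ) : ℝ :=
  ∫ x, V (μ t : Measure K) x * sderiv ψ x ∂(μ t : Measure K)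

include hV in
lemma abs_flux_le (μ : ℝ → ProbabilityMeasure K) {ψ : K → ℝ} {L : ℝ}
    (hL : ∀ x, |sderiv ψ x| ≤ L) (t : ℝ) : |flux V μ ψ t| ≤ C₁ * L := by
  have := norm_integral_le_of_norm_le_const (μ := (μ t : Measure K))
    (f := fun x => V (μ t : Measure K) x * sderiv ψ x) (C := C₁ * L) (ae_of_all _ fun x => by
      rw [norm_mul]
      exact mul_le_mul (hV.abs_le _ x) (hL x) (norm_nonneg _) hV.pos₁.le)
  simpa [flux] using this

variable (hμ : IsMeasureValuedSolution V μ₀ μ)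
include hμ

lemma IsMeasureValuedSolution.continuousOn_integral {ψ : K → ℝ} (hψ : IsSpaceTest ψ) :
    ContinuousOn (fun t => ∫ x, ψ x ∂(μ t : Measure K)) (Ici 0) :=
  hμ.weaklyContinuous ⟨⟨ψ, hψ.continuous⟩, hψ.compactSupport.is_zero_at_infty⟩

include hV

lemma IsMeasureValuedSolution.cutoff_identity {ψ : K → ℝ} (hψ : IsSpaceTest ψ) {χ : ℝ → ℝ}
    (hχ : ContDiff ℝ ∞ χ) (hc : HasCompactSupport χ) :
    IntegrableOn (fun t => deriv χ t * ∫ x, ψ x ∂(μ t : Measure K)) (Ioi 0) ∧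
    IntegrableOn (fun t => χ t * flux V μ ψ t) (Ioi 0) ∧
    (∫ t in Ioi 0, deriv χ t * ∫ x, ψ x ∂(μ t : Measure K)) +
      (∫ t in Ioi 0, χ t * flux V μ ψ t) + χ 0 * ∫ x, ψ x ∂(μ₀ : Measure K) = 0 := by
  have hφ := hψ.prod hχ hc
  obtain ⟨C, hC⟩ := hψ.exists_bound
  obtain ⟨L, hL⟩ := hψ.sderiv.exists_bound
  have hsplit : ∀ t, ∫ x, (timeDeriv (fun p : K × ℝ => ψ p.1 * χ p.2) x t +
      V (μ t : Measure K) x * spaceDeriv (fun p : K × ℝ => ψ p.1 * χ p.2) x t)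
        ∂(μ t : Measure K) =
      deriv χ t * (∫ x, ψ x ∂(μ t : Measure K)) + χ t * flux V μ ψ t := by
    intro t
    have i2 : Integrable (fun x => V (μ t : Measure K) x * sderiv ψ x) (μ t : Measure K) :=
      Integrable.of_bound ((hV.continuous _).mul hψ.sderiv.continuous).aestronglyMeasurable
        (C₁ * L) (ae_of_all _ fun x => by
          rw [norm_mul]
          exact mul_le_mul (hV.abs_le _ x) (hL x) (norm_nonneg _) hV.pos₁.le)
    simp only [timeDeriv_prod, spaceDeriv_prod, flux]
    rw [← integral_const_mul, ← integral_const_mul, ← integral_add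
      ((hψ.integrable _).const_mul _) (i2.const_mul _)]
    refine integral_congr_ae (ae_of_all _ fun x => ?_)
    simp only
    ring
  have hI := hμ.integrable _ hφ
  have hE := hμ.equation _ hφ
  simp_rw [hsplit] at hI hE
  have hi1 : IntegrableOn (fun t => deriv χ t * ∫ x, ψ x ∂(μ t : Measure K)) (Ioi 0) := by
    have hd : Integrable (deriv χ) :=
      (hχ.continuous_deriv (by simp)).integrable_of_hasCompactSupport hc.deriv
    refine Integrable.mul_bdd (c := C) hd.integrableOn ?_ (ae_of_all _ fun t => ?_)
    · exact ((hμ.continuousOn_integral hψ).mono Ioi_subset_Ici_self).aestronglyMeasurable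
        measurableSet_Ioi
    · have := norm_integral_le_of_norm_le_const (μ := (μ t : Measure K)) (f := ψ) (ae_of_all _ hC)
      simpa using this
  -- Measurability of the flux in time comes from the integrability clause in the definition of a
  -- solution: subtract the part with `deriv χ`.
  have hi2 : IntegrableOn (fun t => χ t * flux V μ ψ t) (Ioi 0) := by
    refine (hI.sub hi1).congr (ae_of_all _ fun t => ?_)
    simp
  refine ⟨hi1, hi2, ?_⟩
  rw [← integral_add hi1 hi2, ← integral_const_mul]
  simp_rw [mul_comm (χ 0)]
  exact hE

lemma IsMeasureValuedSolution.intervalIntegrable_flux {ψ : K → ℝ} (hψ : IsSpaceTest ψ) {s t : ℝ}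
    (hs : 0 ≤ s) (ht : 0 ≤ t) : IntervalIntegrable (flux V μ ψ) volume s t := by
  have key : ∀ t, 0 ≤ t → IntervalIntegrable (flux V μ ψ) volume 0 t := by
    intro t ht
    obtain ⟨C, -, hC⟩ := exists_time_cutoff
    obtain ⟨χ, hχ, hc, h1, -⟩ := hC t 1 ht one_pos
    have h := (hμ.cutoff_identity hV hψ hχ hc).2.1
    rw [intervalIntegrable_iff_integrableOn_Ioc_of_le ht]
    refine (h.mono_set Ioc_subset_Ioi_self).congr_fun (fun r hr => ?_) measurableSet_Ioc
    simp only [h1 r hr.1.le hr.2, one_mul]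
  exact (key s hs).symm.trans (key t ht)

/-- Test with `ψ` times a time cutoff whose derivative approximates minus a Dirac mass at `t`. For
`t = 0` this says that the initial datum is attained. -/
lemma IsMeasureValuedSolution.integral_eq {ψ : K → ℝ} (hψ : IsSpaceTest ψ) {t : ℝ} (ht : 0 ≤ t) :
    ∫ x, ψ x ∂(μ t : Measure K) = (∫ x, ψ x ∂(μ₀ : Measure K)) + ∫ r in 0..t, flux V μ ψ r := by
  obtain ⟨L, hL⟩ := hψ.sderiv.exists_bound
  have hL0 : 0 ≤ L := (abs_nonneg _).trans (hL 0)
  obtain ⟨C, hC0, hC⟩ := exists_time_cutoff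
  set f : ℝ → ℝ := fun t => ∫ x, ψ x ∂(μ t : Measure K) with hf
  have hfc := hμ.continuousOn_integral hψ
  suffices h : ∀ ε > 0, |(f t - ((∫ x, ψ x ∂(μ₀ : Measure K)) + ∫ r in 0..t, flux V μ ψ r))| ≤
      ε * (C + C₁ * L) by
    have h0 : f t - ((∫ x, ψ x ∂(μ₀ : Measure K)) + ∫ r in 0..t, flux V μ ψ r) = 0 := by
      by_contra hne
      have hp := abs_pos.2 hne
      have hB : 0 ≤ C + C₁ * L := add_nonneg hC0 (mul_nonneg hV.pos₁.le hL0)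
      have := h _ (div_pos hp (by linarith : 0 < 2 * (C + C₁ * L + 1)))
      rw [div_mul_eq_mul_div, le_div_iff₀ (by linarith)] at this
      nlinarith
    linarith
  intro ε hε
  obtain ⟨δ₀, hδ₀, hδ⟩ := Metric.continuousOn_iff.1 hfc t ht ε hε
  set δ := min ε (δ₀ / 2) with hδdef
  have hδp : 0 < δ := lt_min hε (by linarith)
  have hδε : δ ≤ ε := min_le_left _ _
  have hδδ : δ < δ₀ := (min_le_right _ _).trans_lt (by linarith)
  obtain ⟨χ, hχ, hcs, h1, h0, hb, hd0, hd1, hdb⟩ := hC t δ ht hδp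
  obtain ⟨i1, i2, hE⟩ := hμ.cutoff_identity hV hψ hχ hcs
  have hχ0 : χ 0 = 1 := h1 0 le_rfl ht
  rw [hχ0, one_mul] at hE
  -- `deriv χ` has total integral `-1` on `(0, ∞)`, lives on `[t, t + δ]` and is at most `C / δ`,
  -- while `f` varies by at most `ε` there.
  have hA : |(∫ r in Ioi 0, deriv χ r * f r) + f t| ≤ ε * C := by
    have hd : Integrable (deriv χ) :=
      (hχ.continuous_deriv (by simp)).integrable_of_hasCompactSupport hcs.deriv
    have e1 : ∫ r in Ioi 0, deriv χ r * f t = - f t := by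
      rw [integral_mul_const, hcs.integral_Ioi_deriv_eq (hχ.of_le (by simp)), hχ0]
      ring
    have e2 : (∫ r in Ioi 0, deriv χ r * f r) + f t =
        ∫ r in Ioi 0, deriv χ r * (f r - f t) := by
      simp_rw [mul_sub]
      rw [integral_sub i1 (hd.integrableOn.mul_const _), e1]
      ring
    have e3 : ∫ r in Ioi 0, deriv χ r * (f r - f t) =
        ∫ r in Icc t (t + δ) ∩ Ioi 0, deriv χ r * (f r - f t) := by
      refine setIntegral_eq_of_subset_of_forall_sdiff_eq_zero measurableSet_Ioi
        inter_subset_right fun r hr => ?_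
      have hr0 : 0 < r := hr.1
      have hr' : r ∉ Icc t (t + δ) := fun h => hr.2 ⟨h, hr0⟩
      rw [mem_Icc, not_and_or, not_le, not_le] at hr'
      rcases hr' with h | h
      · rw [hd0 r hr0 h, zero_mul]
      · rw [hd1 r h, zero_mul]
    rw [e2, e3]
    have hvol : volume (Icc t (t + δ) ∩ Ioi 0) ≤ ENNReal.ofReal δ := by
      refine (measure_mono inter_subset_left).trans ?_
      rw [Real.volume_Icc, add_sub_cancel_left]
    have hle := norm_setIntegral_le_of_norm_le_const (μ := volume) (C := C / δ * ε)
      (f := fun r => deriv χ r * (f r - f t)) (hvol.trans_lt ENNReal.ofReal_lt_top)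
      (fun r hr => by
        rw [norm_mul]
        refine mul_le_mul (hdb r hr.2) ?_ (norm_nonneg _) (div_nonneg hC0 hδp.le)
        refine (hδ r (mem_Ici.2 (le_of_lt hr.2)) ?_).le
        rw [Real.dist_eq, abs_of_nonneg (by linarith [hr.1.1])]
        linarith [hr.1.2])
    refine hle.trans ?_
    have hreal : volume.real (Icc t (t + δ) ∩ Ioi 0) ≤ δ :=
      ENNReal.toReal_le_of_le_ofReal hδp.le hvol
    calc C / δ * ε * volume.real (Icc t (t + δ) ∩ Ioi 0) ≤ C / δ * ε * δ :=
          mul_le_mul_of_nonneg_left hreal (by positivity)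
      _ = ε * C := by field_simp
  have hB : |(∫ r in Ioi 0, χ r * flux V μ ψ r) - ∫ r in 0..t, flux V μ ψ r| ≤ ε * (C₁ * L) := by
    have ht' : t ≤ t + δ := by linarith
    have e1 : ∫ r in Ioi 0, χ r * flux V μ ψ r = ∫ r in 0..(t + δ), χ r * flux V μ ψ r := by
      rw [intervalIntegral.integral_of_le (ht.trans ht')]
      refine setIntegral_eq_of_subset_of_forall_sdiff_eq_zero measurableSet_Ioi
        Ioc_subset_Ioi_self fun r hr => ?_
      have : t + δ < r := by
        by_contra h
        exact hr.2 ⟨hr.1, not_lt.1 h⟩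
      rw [h0 r this.le, zero_mul]
    have hinteg : ∀ a b, 0 ≤ a → a ≤ b →
        IntervalIntegrable (fun r => χ r * flux V μ ψ r) volume a b := fun a b ha hab => by
      rw [intervalIntegrable_iff_integrableOn_Ioc_of_le hab]
      exact i2.mono_set fun r hr => ha.trans_lt hr.1
    have e2 : ∫ r in 0..t, χ r * flux V μ ψ r = ∫ r in 0..t, flux V μ ψ r := by
      refine intervalIntegral.integral_congr fun r hr => ?_
      rw [uIcc_of_le ht] at hr
      simp only [h1 r hr.1 hr.2, one_mul]
    rw [e1, ← intervalIntegral.integral_add_adjacent_intervals (hinteg 0 t le_rfl ht)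
      (hinteg t (t + δ) ht ht'), e2, add_sub_cancel_left]
    have := intervalIntegral.norm_integral_le_of_norm_le_const (a := t) (b := t + δ)
      (f := fun r => χ r * flux V μ ψ r) (C := C₁ * L) fun r _ => by
        rw [norm_mul]
        calc ‖χ r‖ * ‖flux V μ ψ r‖ ≤ 1 * (C₁ * L) :=
              mul_le_mul (hb r) (abs_flux_le hV μ hL r) (norm_nonneg _) zero_le_one
          _ = _ := one_mul _
    rw [add_sub_cancel_left, abs_of_pos hδp] at this
    refine this.trans ?_
    rw [mul_comm]
    exact mul_le_mul_of_nonneg_right hδε (mul_nonneg hV.pos₁.le hL0)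
  have : f t - ((∫ x, ψ x ∂(μ₀ : Measure K)) + ∫ r in 0..t, flux V μ ψ r) =
      ((∫ r in Ioi 0, deriv χ r * f r) + f t) +
        ((∫ r in Ioi 0, χ r * flux V μ ψ r) - ∫ r in 0..t, flux V μ ψ r) := by
    linarith
  rw [this, mul_add]
  exact (abs_add_le _ _).trans (add_le_add hA hB)

lemma IsMeasureValuedSolution.integral_sub_eq {ψ : K → ℝ} (hψ : IsSpaceTest ψ) {s t : ℝ}
    (hs : 0 ≤ s) (ht : 0 ≤ t) :
    (∫ x, ψ x ∂(μ t : Measure K)) - ∫ x, ψ x ∂(μ s : Measure K) =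
      ∫ r in s..t, flux V μ ψ r := by
  rw [hμ.integral_eq hV hψ hs, hμ.integral_eq hV hψ ht, add_sub_add_left_eq_sub,
    intervalIntegral.integral_interval_sub_left (hμ.intervalIntegrable_flux hV hψ le_rfl ht)
      (hμ.intervalIntegrable_flux hV hψ le_rfl hs)]

end WeakForm

/-! ### Mollification on `K`. -/

lemma abs_deriv_le_of_abs_sub_le {g : ℝ → ℝ} {C : ℝ} (h : ∀ x y, |g x - g y| ≤ C * |x - y|)
    (y : ℝ) : |deriv g y| ≤ C := by
  have hC : 0 ≤ C := by
    have := (abs_nonneg _).trans (h 1 0)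
    simpa using this
  have hl : LipschitzWith C.toNNReal g := LipschitzWith.of_dist_le_mul fun x y => by
    rw [Real.dist_eq, Real.dist_eq, Real.coe_toNNReal _ hC]
    exact h x y
  have := norm_deriv_le_of_lipschitz (x₀ := y) hl
  rwa [Real.coe_toNNReal _ hC] at this

open scoped Convolution in
lemma abs_convolution_sub_le {k g : ℝ → ℝ} (hk : Continuous k) (hkc : HasCompactSupport k)
    (hg : Continuous g) {L : ℝ} (hL : ∀ x y, |g x - g y| ≤ L * |x - y|) (x y : ℝ) :
    |(k ⋆[ContinuousLinearMap.lsmul ℝ ℝ, volume] g) x -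
      (k ⋆[ContinuousLinearMap.lsmul ℝ ℝ, volume] g) y| ≤ (∫ t, |k t|) * L * |x - y| := by
  have hinteg : ∀ x, Integrable fun t => k t * g (x - t) := fun x =>
    (hk.mul (hg.comp (continuous_const.sub continuous_id))).integrable_of_hasCompactSupport
      hkc.mul_right
  have hki : Integrable k := hk.integrable_of_hasCompactSupport hkc
  simp only [convolution_def, ContinuousLinearMap.lsmul_apply, smul_eq_mul]
  rw [← integral_sub (hinteg x) (hinteg y), ← Real.norm_eq_abs]
  refine (norm_integral_le_of_norm_le (g := fun t => |k t| * (L * |x - y|))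
    (hki.abs.mul_const _) (ae_of_all _ fun t => ?_)).trans ?_
  · rw [← mul_sub, norm_mul]
    refine mul_le_mul_of_nonneg_left ?_ (norm_nonneg _)
    have := hL (x - t) (y - t)
    rwa [sub_sub_sub_cancel_right] at this
  · rw [integral_mul_const, mul_assoc]

variable {K : Domain}

lemma hasDerivAt_lift {f : K → ℝ} (hf : ContDiff ℝ ∞ fun y => f (K.proj y)) (y : ℝ) :
    HasDerivAt (fun y => f (K.proj y)) (sderiv f (K.proj y)) y := by
  rw [sderiv_proj]
  exact (hf.differentiable (by simp) y).hasDerivAt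

lemma contDiff_sderiv {f : K → ℝ} (hf : ContDiff ℝ ∞ fun y => f (K.proj y)) :
    ContDiff ℝ ∞ fun y => sderiv f (K.proj y) := by
  simp_rw [sderiv_proj]
  rw [contDiff_infty_iff_deriv] at hf
  exact hf.2

lemma sderiv_eq_of_hasDerivAt {f : K → ℝ} {y c : ℝ} (h : HasDerivAt (fun y => f (K.proj y)) c y) :
    sderiv f (K.proj y) = c := by
  rw [sderiv_proj, h.deriv]

lemma abs_sub_le_of_abs_sderiv_le {f : K → ℝ} (hf : ContDiff ℝ ∞ fun y => f (K.proj y)) {L : ℝ}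
    (hL : ∀ x, |sderiv f x| ≤ L) (y z : ℝ) : |f (K.proj y) - f (K.proj z)| ≤ L * |y - z| :=
  convex_univ.norm_image_sub_le_of_norm_hasDerivWithin_le (f := fun y => f (K.proj y))
    (fun x _ => (hasDerivAt_lift hf x).hasDerivWithinAt) (fun _ _ => hL _)
    (mem_univ z) (mem_univ y)

/-- Convolution with a bump function. -/
noncomputable def mollify (ρ : ContDiffBump (0 : ℝ)) (f : K → ℝ) (x : K) : ℝ :=
  ∫ z, ρ.normed volume z * f (x - K.proj z)

section Mollify

variable (ρ : ContDiffBump (0 : ℝ)) {f : K → ℝ} (hf : Continuous f)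

open scoped Convolution in
lemma mollify_proj (f : K → ℝ) (y : ℝ) : mollify ρ f (K.proj y) =
    (ρ.normed volume ⋆[ContinuousLinearMap.lsmul ℝ ℝ, volume] fun y => f (K.proj y)) y := by
  simp only [convolution_def, ContinuousLinearMap.lsmul_apply, smul_eq_mul, mollify, K.proj_sub]

include hf

lemma contDiff_mollify : ContDiff ℝ ∞ fun y => mollify ρ f (K.proj y) := by
  simp_rw [mollify_proj]
  exact ρ.hasCompactSupport_normed.contDiff_convolution_left _ ρ.contDiff_normed
    (hf.comp K.continuous_proj).locallyIntegrable

lemma abs_mollify_sub_le (x : K) {a C : ℝ}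
    (h : ∀ z, |z| ≤ ρ.rOut → |f (x - K.proj z) - a| ≤ C) : |mollify ρ f x - a| ≤ C := by
  have hi1 : Integrable fun z => ρ.normed volume z * f (x - K.proj z) :=
    (ρ.continuous_normed.mul (hf.comp (continuous_const.sub
      K.continuous_proj))).integrable_of_hasCompactSupport ρ.hasCompactSupport_normed.mul_right
  have hi2 : Integrable (ρ.normed volume) :=
    ρ.continuous_normed.integrable_of_hasCompactSupport ρ.hasCompactSupport_normed
  have e : mollify ρ f x - a = ∫ z, ρ.normed volume z * (f (x - K.proj z) - a) := by
    simp_rw [mul_sub]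
    rw [integral_sub hi1 (hi2.mul_const a), integral_mul_const, ρ.integral_normed, one_mul, mollify]
  rw [e, ← Real.norm_eq_abs]
  refine (norm_integral_le_of_norm_le (g := fun z => ρ.normed volume z * C)
    (hi2.mul_const _) (ae_of_all _ fun z => ?_)).trans ?_
  · rw [norm_mul, Real.norm_of_nonneg (ρ.nonneg_normed z)]
    by_cases hz : |z| ≤ ρ.rOut
    · exact mul_le_mul_of_nonneg_left (h z hz) (ρ.nonneg_normed z)
    · have : ρ.normed volume z = 0 := by
        have hz' : z ∉ Function.support (ρ.normed volume) := by
          rw [ρ.support_normed_eq, Metric.mem_ball, dist_zero_right]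
          exact fun h => hz h.le
        simpa using hz'
      simp [this]
  · rw [integral_mul_const, ρ.integral_normed, one_mul]

lemma abs_mollify_le {C : ℝ} (h : ∀ x, |f x| ≤ C) (x : K) : |mollify ρ f x| ≤ C := by
  have := abs_mollify_sub_le ρ hf x (a := 0) (C := C) fun z _ => by
    rw [sub_zero]; exact h _
  rwa [sub_zero] at this

variable {L : ℝ} (hL : ∀ x y, |f x - f y| ≤ L * dist x y) (hL0 : 0 ≤ L)
include hL hL0

lemma abs_mollify_sub_self_le (x : K) : |mollify ρ f x - f x| ≤ L * ρ.rOut := by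
  refine abs_mollify_sub_le ρ hf x fun z hz => (hL _ _).trans ?_
  refine mul_le_mul_of_nonneg_left ?_ hL0
  rw [dist_eq_norm, sub_sub_cancel_left, norm_neg]
  exact (K.norm_proj_le z).trans hz

omit hf in
lemma abs_lift_sub_le (y z : ℝ) : |f (K.proj y) - f (K.proj z)| ≤ L * |y - z| :=
  (hL _ _).trans (mul_le_mul_of_nonneg_left (K.dist_proj_le y z) hL0)

lemma abs_sderiv_mollify_le (x : K) : |sderiv (mollify ρ f) x| ≤ L := by
  obtain ⟨y, rfl⟩ := K.surjective_proj x
  rw [sderiv_proj]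
  refine abs_deriv_le_of_abs_sub_le (fun y z => ?_) y
  rw [mollify_proj, mollify_proj]
  refine (abs_convolution_sub_le ρ.continuous_normed ρ.hasCompactSupport_normed
    (hf.comp K.continuous_proj) (abs_lift_sub_le hL hL0) y z).trans ?_
  simp_rw [abs_of_nonneg (ρ.nonneg_normed _)]
  rw [ρ.integral_normed, one_mul]

open scoped Convolution in
-- One derivative falls on the kernel, the other is paid by the Lipschitz constant of `f`. The bound
-- depends on `ρ`, which is harmless because the step size tends to zero before the radius does.
lemma abs_sderiv_sderiv_mollify_le (x : K) :
    |sderiv (sderiv (mollify ρ f)) x| ≤ (∫ z, |deriv (ρ.normed volume) z|) * L := by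
  obtain ⟨y, rfl⟩ := K.surjective_proj x
  rw [sderiv_proj]
  have hρ : ContDiff ℝ 1 (ρ.normed volume) := ρ.contDiff_normed
  refine abs_deriv_le_of_abs_sub_le (fun y z => ?_) y
  have h : ∀ y, sderiv (mollify ρ f) (K.proj y) = (deriv (ρ.normed volume) ⋆[
      ContinuousLinearMap.lsmul ℝ ℝ, volume] fun y => f (K.proj y)) y := fun y => by
    rw [sderiv_proj]
    simp_rw [mollify_proj]
    exact (ρ.hasCompactSupport_normed.hasDerivAt_convolution_left
      (ContinuousLinearMap.lsmul ℝ ℝ) hρ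
      (hf.comp K.continuous_proj).locallyIntegrable y).deriv
  rw [h, h]
  exact abs_convolution_sub_le (hρ.continuous_deriv le_rfl)
    ρ.hasCompactSupport_normed.deriv (hf.comp K.continuous_proj) (abs_lift_sub_le hL hL0) y z

end Mollify

/-- In the definition of the Wasserstein distance of probability measures, it suffices to consider
smooth compactly supported functions. -/
lemma wassersteinDist_le_of_isSpaceTest {ν₁ ν₂ : ProbabilityMeasure K} {A : ℝ}
    (h : ∀ ψ : K → ℝ, IsSpaceTest ψ → (∀ x, |sderiv ψ x| ≤ 1) →
      (∫ x, ψ x ∂(ν₂ : Measure K)) - ∫ x, ψ x ∂(ν₁ : Measure K) ≤ A) :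
    wassersteinDist (ν₁ : Measure K) (ν₂ : Measure K) ≤ ENNReal.ofReal A := by
  refine wassersteinDist_le fun ψ hψ => ?_
  obtain ⟨χ, hχs, hχc, hχ0, hχ1, hχd, hχt⟩ := K.exists_cutoff
  have hψL : ∀ x y, |ψ x - ψ y| ≤ 1 * dist x y := fun x y => by
    have := hψ.dist_le_mul x y
    rwa [Real.dist_eq, NNReal.coe_one] at this
  have hψb : ∀ x, |ψ x| ≤ ‖ψ‖ := ψ.norm_coe_le_norm
  have hmoll : ∀ ρ : ContDiffBump (0 : ℝ),
      (∫ x, mollify ρ ψ x ∂(ν₂ : Measure K)) - ∫ x, mollify ρ ψ x ∂(ν₁ : Measure K) ≤ A := by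
    intro ρ
    have hsm := contDiff_mollify ρ ψ.continuous
    have hb := abs_mollify_le ρ ψ.continuous hψb
    have hmc : Continuous (mollify ρ ψ) := K.continuous_comp_proj_iff.1 hsm.continuous
    have hχsp : ∀ n, IsSpaceTest (χ n) := fun n => ⟨hχs n, hχc n⟩
    have hlim : ∀ ν : ProbabilityMeasure K, Filter.Tendsto
        (fun n => ∫ x, mollify ρ ψ x * χ n x ∂(ν : Measure K)) Filter.atTop
        (nhds (∫ x, mollify ρ ψ x ∂(ν : Measure K))) := by
      intro ν
      refine tendsto_integral_of_dominated_convergence (fun _ => ‖ψ‖)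
        (fun n => (hmc.mul (hχsp n).continuous).aestronglyMeasurable) (integrable_const _)
        (fun n => ae_of_all _ fun x => ?_) (ae_of_all _ fun x => ?_)
      · rw [norm_mul, Real.norm_of_nonneg (hχ0 n x)]
        calc ‖mollify ρ ψ x‖ * χ n x ≤ ‖ψ‖ * 1 :=
              mul_le_mul (hb x) (hχ1 n x) (hχ0 n x) (norm_nonneg _)
          _ = _ := mul_one _
      · simpa using (hχt x).const_mul (mollify ρ ψ x)
    have hc : Filter.Tendsto (fun n : ℕ => (1 + ‖ψ‖ * (1 / ((n : ℝ) + 1))) * A) Filter.atTop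
        (nhds A) := by
      have := ((tendsto_one_div_add_atTop_nhds_zero_nat (𝕜 := ℝ)).const_mul ‖ψ‖).const_add 1
      simpa using this.mul_const A
    refine le_of_tendsto_of_tendsto' ((hlim ν₂).sub (hlim ν₁)) hc fun n => ?_
    -- The product rule bounds the slope of the truncated function by `c`; dividing by `c` makes it
    -- admissible, and `c` tends to `1`.
    set c := 1 + ‖ψ‖ * (1 / ((n : ℝ) + 1)) with hcdef
    have hc0 : 0 < c := by positivity
    have ht : IsSpaceTest fun x => c⁻¹ * (mollify ρ ψ x * χ n x) :=
      ((hχsp n).mul hsm).mul contDiff_const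
    have := h _ ht fun x => by
      obtain ⟨y, rfl⟩ := K.surjective_proj x
      rw [sderiv_eq_of_hasDerivAt
        (((hasDerivAt_lift hsm y).mul (hasDerivAt_lift (hχs n) y)).const_mul c⁻¹), abs_mul,
        abs_of_pos (inv_pos.2 hc0), inv_mul_le_iff₀ hc0, mul_one]
      refine (abs_add_le _ _).trans ?_
      rw [abs_mul, abs_mul, hcdef]
      refine add_le_add ?_ ?_
      · rw [abs_of_nonneg (hχ0 n _)]
        calc _ ≤ (1 : ℝ) * 1 := mul_le_mul
              (abs_sderiv_mollify_le ρ ψ.continuous hψL zero_le_one _) (hχ1 n _) (hχ0 n _)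
              zero_le_one
          _ = 1 := one_mul 1
      · refine mul_le_mul (hb _) ?_ (abs_nonneg _) (norm_nonneg _)
        rw [sderiv_proj]
        exact hχd n y
    rw [integral_const_mul, integral_const_mul, ← mul_sub, inv_mul_le_iff₀ hc0] at this
    exact this
  refine le_of_forall_pos_le_add fun ε hε => ?_
  let ρ : ContDiffBump (0 : ℝ) := ⟨ε / 4, ε / 2, by linarith, by linarith⟩
  have hmc : Continuous (mollify ρ ψ) :=
    K.continuous_comp_proj_iff.1 (contDiff_mollify ρ ψ.continuous).continuous
  have hclose : ∀ ν : ProbabilityMeasure K,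
      |(∫ x, mollify ρ ψ x ∂(ν : Measure K)) - ∫ x, ψ x ∂(ν : Measure K)| ≤ ε / 2 := by
    intro ν
    rw [← integral_sub (Integrable.of_bound hmc.aestronglyMeasurable ‖ψ‖
      (ae_of_all _ (abs_mollify_le ρ ψ.continuous hψb))) (ψ.integrable _)]
    have := norm_integral_le_of_norm_le_const (μ := (ν : Measure K))
      (f := fun x => mollify ρ ψ x - ψ x) (ae_of_all _
        (abs_mollify_sub_self_le ρ ψ.continuous hψL zero_le_one))
    simpa [ρ] using this
  have h1 := abs_le.1 (hclose ν₁)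
  have h2 := abs_le.1 (hclose ν₂)
  have h3 := hmoll ρ
  linarith [h1.1, h1.2, h2.1, h2.2]

/-! ### Pulling test functions back through explicit Euler steps. -/

variable {K : Domain}

/-- Smooth compactly supported functions with bounds on the first two derivatives. -/
structure IsSpaceTestWith (L M : ℝ) (ψ : K → ℝ) : Prop extends IsSpaceTest ψ where
  abs_sderiv_le : ∀ x, |sderiv ψ x| ≤ L
  abs_sderiv_sderiv_le : ∀ x, |sderiv (sderiv ψ) x| ≤ M

lemma IsSpaceTestWith.mono {L M L' M' : ℝ} {ψ : K → ℝ} (h : IsSpaceTestWith L M ψ) (hL : L ≤ L')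
    (hM : M ≤ M') : IsSpaceTestWith L' M' ψ :=
  ⟨h.toIsSpaceTest, fun x => (h.abs_sderiv_le x).trans hL,
    fun x => (h.abs_sderiv_sderiv_le x).trans hM⟩

/-- Smooth velocity fields with bounds on the derivatives up to order two. -/
structure IsSmoothField (C₁ C₂ B : ℝ) (β : K → ℝ) : Prop where
  smooth : ContDiff ℝ ∞ fun y => β (K.proj y)
  abs_le : ∀ x, |β x| ≤ C₁
  abs_sderiv_le : ∀ x, |sderiv β x| ≤ C₂
  abs_sderiv_sderiv_le : ∀ x, |sderiv (sderiv β) x| ≤ B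

/-- The composition of `ψ` with one explicit Euler step of size `h` for the velocity field `β`. -/
noncomputable def eulerComp (h : ℝ) (β ψ : K → ℝ) (x : K) : ℝ := ψ (x + K.proj (h * β x))

lemma eulerComp_proj (h : ℝ) (β ψ : K → ℝ) (y : ℝ) :
    eulerComp h β ψ (K.proj y) = ψ (K.proj (y + h * β (K.proj y))) := by
  rw [eulerComp, K.proj_add]

lemma hasDerivAt_eulerComp {h : ℝ} {β ψ : K → ℝ} (hβ : ContDiff ℝ ∞ fun y => β (K.proj y))
    (hψ : ContDiff ℝ ∞ fun y => ψ (K.proj y)) (y : ℝ) :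
    HasDerivAt (fun y => eulerComp h β ψ (K.proj y))
      (eulerComp h β (sderiv ψ) (K.proj y) * (1 + h * sderiv β (K.proj y))) y := by
  simp_rw [eulerComp_proj]
  exact (hasDerivAt_lift hψ _).comp y ((hasDerivAt_id y).add ((hasDerivAt_lift hβ y).const_mul h))

lemma sderiv_eulerComp {h : ℝ} {β ψ : K → ℝ} (hβ : ContDiff ℝ ∞ fun y => β (K.proj y))
    (hψ : ContDiff ℝ ∞ fun y => ψ (K.proj y)) :
    sderiv (eulerComp h β ψ) = fun x => eulerComp h β (sderiv ψ) x * (1 + h * sderiv β x) := by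
  ext x
  obtain ⟨y, rfl⟩ := K.surjective_proj x
  exact sderiv_eq_of_hasDerivAt (hasDerivAt_eulerComp hβ hψ y)

/-- Chain rule for `x ↦ x + h β(x)`. The first-derivative bound does not involve `B`, so it survives
the removal of the mollification. -/
lemma IsSpaceTestWith.eulerComp {L M C₁ C₂ B h : ℝ} {β ψ : K → ℝ} (hψ : IsSpaceTestWith L M ψ)
    (hβ : IsSmoothField C₁ C₂ B β) (hh : 0 ≤ h) :
    IsSpaceTestWith (L * (1 + h * C₂)) (M * (1 + h * C₂) ^ 2 + L * (h * B)) (eulerComp h β ψ) := by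
  have hL0 : 0 ≤ L := (abs_nonneg _).trans (hψ.abs_sderiv_le 0)
  have hM0 : 0 ≤ M := (abs_nonneg _).trans (hψ.abs_sderiv_sderiv_le 0)
  have hC0 : 0 ≤ C₂ := (abs_nonneg _).trans (hβ.abs_sderiv_le 0)
  have hfac : ∀ x, |1 + h * sderiv β x| ≤ 1 + h * C₂ := fun x => by
    refine (abs_add_le _ _).trans ?_
    rw [abs_one, abs_mul, abs_of_nonneg hh]
    have := mul_le_mul_of_nonneg_left (hβ.abs_sderiv_le x) hh
    linarith
  refine ⟨⟨?_, ?_⟩, ?_, ?_⟩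
  · simp_rw [eulerComp_proj]
    exact hψ.smooth.comp (contDiff_id.add (contDiff_const.mul hβ.smooth))
  · have := K.properSpace
    obtain ⟨R, hR⟩ := hψ.compactSupport.isCompact.isBounded.exists_norm_le
    refine HasCompactSupport.intro (isCompact_closedBall 0 (R + h * C₁)) fun x hx => ?_
    change ψ (x + K.proj (h * β x)) = 0
    refine image_eq_zero_of_notMem_tsupport fun hx' => hx ?_
    rw [mem_closedBall_zero_iff]
    have h1 := hR _ hx'
    have h2 : ‖K.proj (h * β x)‖ ≤ h * C₁ := by
      refine (K.norm_proj_le _).trans ?_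
      rw [abs_mul, abs_of_nonneg hh]
      exact mul_le_mul_of_nonneg_left (hβ.abs_le x) hh
    have h3 := norm_sub_le (x + K.proj (h * β x)) (K.proj (h * β x))
    rw [add_sub_cancel_right] at h3
    linarith
  · intro x
    rw [sderiv_eulerComp hβ.smooth hψ.smooth, abs_mul]
    exact mul_le_mul (hψ.abs_sderiv_le _) (hfac x) (abs_nonneg _) hL0
  · intro x
    obtain ⟨y, rfl⟩ := K.surjective_proj x
    rw [sderiv_eulerComp hβ.smooth hψ.smooth, sderiv_eq_of_hasDerivAt
      ((hasDerivAt_eulerComp hβ.smooth (contDiff_sderiv hψ.smooth) y).mul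
        (((hasDerivAt_lift (contDiff_sderiv hβ.smooth) y).const_mul h).const_add 1))]
    refine (abs_add_le _ _).trans (add_le_add ?_ ?_)
    · rw [abs_mul, abs_mul, sq, ← mul_assoc]
      have h1 := hfac (K.proj y)
      refine mul_le_mul (mul_le_mul (hψ.abs_sderiv_sderiv_le _) h1 (abs_nonneg _) hM0) h1
        (abs_nonneg _) (mul_nonneg hM0 ((abs_nonneg _).trans h1))
    · rw [abs_mul, abs_mul, abs_of_nonneg hh]
      exact mul_le_mul (hψ.abs_sderiv_le _) (mul_le_mul_of_nonneg_left
        (hβ.abs_sderiv_sderiv_le _) hh) (mul_nonneg hh (abs_nonneg _)) hL0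

lemma IsSpaceTestWith.abs_taylor_le {L M : ℝ} {ψ : K → ℝ} (hψ : IsSpaceTestWith L M ψ) (x : K)
    (a : ℝ) : |ψ (x + K.proj a) - ψ x - a * sderiv ψ x| ≤ M * a ^ 2 := by
  obtain ⟨y, rfl⟩ := K.surjective_proj x
  have hM0 : 0 ≤ M := (abs_nonneg _).trans (hψ.abs_sderiv_sderiv_le 0)
  have hd : ∀ s ∈ Icc (0 : ℝ) 1, HasDerivWithinAt
      (fun s => ψ (K.proj (y + s * a)) - s * (a * sderiv ψ (K.proj y)))
      (sderiv ψ (K.proj (y + s * a)) * (1 * a) - 1 * (a * sderiv ψ (K.proj y))) (Icc 0 1) s := by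
    intro s _
    refine HasDerivAt.hasDerivWithinAt (HasDerivAt.sub ?_ ((hasDerivAt_id s).mul_const _))
    exact HasDerivAt.comp (h := fun s => y + s * a) s (hasDerivAt_lift hψ.smooth (y + s * a))
      (((hasDerivAt_id s).mul_const a).const_add y)
  have hb : ∀ s ∈ Icc (0 : ℝ) 1,
      ‖sderiv ψ (K.proj (y + s * a)) * (1 * a) - 1 * (a * sderiv ψ (K.proj y))‖ ≤ M * a ^ 2 := by
    intro s hs
    have h1 := abs_sub_le_of_abs_sderiv_le (contDiff_sderiv hψ.smooth) hψ.abs_sderiv_sderiv_le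
      (y + s * a) y
    rw [add_sub_cancel_left, abs_mul, abs_of_nonneg hs.1] at h1
    have e : sderiv ψ (K.proj (y + s * a)) * (1 * a) - 1 * (a * sderiv ψ (K.proj y)) =
        (sderiv ψ (K.proj (y + s * a)) - sderiv ψ (K.proj y)) * a := by ring
    rw [e, Real.norm_eq_abs, abs_mul]
    have h2 : s * |a| ≤ |a| := mul_le_of_le_one_left (abs_nonneg a) hs.2
    calc _ ≤ M * |a| * |a| :=
          mul_le_mul_of_nonneg_right (h1.trans (mul_le_mul_of_nonneg_left h2 hM0)) (abs_nonneg a)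
      _ = M * a ^ 2 := by rw [mul_assoc, ← sq, sq_abs]
  have h := (convex_Icc (0 : ℝ) 1).norm_image_sub_le_of_norm_hasDerivWithin_le hd hb
    (left_mem_Icc.2 zero_le_one) (right_mem_Icc.2 zero_le_one)
  have e : ψ (K.proj y + K.proj a) - ψ (K.proj y) - a * sderiv ψ (K.proj y) =
      ψ (K.proj (y + 1 * a)) - 1 * (a * sderiv ψ (K.proj y)) -
        (ψ (K.proj (y + 0 * a)) - 0 * (a * sderiv ψ (K.proj y))) := by
    rw [one_mul, zero_mul, add_zero, K.proj_add]
    ring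
  rw [e]
  simpa using h

section Stability

variable {V : Measure K → K → ℝ} {C₁ C₂ C₃ : ℝ} (hV : IsVelocity V C₁ C₂ C₃)
  {μ₀ : ProbabilityMeasure K} {μ : ℝ → ProbabilityMeasure K}
  (hμ : IsMeasureValuedSolution V μ₀ μ)
include hV hμ

/-- Consistency of one Euler step: the error made when the solution is replaced by its image under
an Euler step for an approximate velocity field. -/
lemma IsMeasureValuedSolution.euler_step {L M B h t : ℝ} {β ψ : K → ℝ}
    (hψ : IsSpaceTestWith L M ψ) (hβ : IsSmoothField C₁ C₂ B β) (hh : 0 ≤ h) (ht : 0 ≤ t)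
    {e : ℝ → ℝ} (hec : Continuous e)
    (he : ∀ r ∈ Icc t (t + h), ∀ x, |V (μ r : Measure K) x - β x| ≤ e r) :
    |(∫ x, ψ x ∂(μ (t + h) : Measure K)) - ∫ x, eulerComp h β ψ x ∂(μ t : Measure K)| ≤
      L * (∫ r in t..(t + h), e r) + h ^ 2 * (C₁ * (C₂ * L + C₁ * M) + C₁ ^ 2 * M) := by
  have hL0 : 0 ≤ L := (abs_nonneg _).trans (hψ.abs_sderiv_le 0)
  have hM0 : 0 ≤ M := (abs_nonneg _).trans (hψ.abs_sderiv_sderiv_le 0)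
  have htt : t ≤ t + h := by linarith
  -- Smoothness of `β` makes `q` a test function, so the weak form also controls the variation of `∫
  -- q dμ_r` over the step and the flux may be frozen at time `t`.
  let q : K → ℝ := fun x => β x * sderiv ψ x
  have hq : IsSpaceTest q := hψ.toIsSpaceTest.sderiv.mul hβ.smooth
  have hqd : ∀ x, |sderiv q x| ≤ C₂ * L + C₁ * M := by
    intro x
    obtain ⟨y, rfl⟩ := K.surjective_proj x
    rw [sderiv_eq_of_hasDerivAt ((hasDerivAt_lift hβ.smooth y).mul
      (hasDerivAt_lift (contDiff_sderiv hψ.smooth) y))]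
    refine (abs_add_le _ _).trans (add_le_add ?_ ?_)
    · rw [abs_mul]
      exact mul_le_mul (hβ.abs_sderiv_le _) (hψ.abs_sderiv_le _) (abs_nonneg _) hV.pos₂.le
    · rw [abs_mul]
      exact mul_le_mul (hβ.abs_le _) (hψ.abs_sderiv_sderiv_le _) (abs_nonneg _) hV.pos₁.le
  set P := C₂ * L + C₁ * M with hP
  have hP0 : 0 ≤ P := (abs_nonneg _).trans (hqd 0)
  have hflux : ∀ r ∈ Icc t (t + h),
      |flux V μ ψ r - ∫ x, q x ∂(μ t : Measure K)| ≤ L * e r + C₁ * P * h := by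
    intro r hr
    have hr0 : 0 ≤ r := ht.trans hr.1
    have h1 : |flux V μ ψ r - ∫ x, q x ∂(μ r : Measure K)| ≤ L * e r := by
      have i1 : Integrable (fun x => V (μ r : Measure K) x * sderiv ψ x) (μ r : Measure K) :=
        Integrable.of_bound ((hV.continuous _).mul hψ.sderiv.continuous).aestronglyMeasurable
          (C₁ * L) (ae_of_all _ fun x => by
            rw [norm_mul]
            exact mul_le_mul (hV.abs_le _ x) (hψ.abs_sderiv_le x) (norm_nonneg _) hV.pos₁.le)
      rw [flux, ← integral_sub i1 (hq.integrable _)]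
      have := norm_integral_le_of_norm_le_const (μ := (μ r : Measure K)) (C := L * e r)
        (f := fun x => V (μ r : Measure K) x * sderiv ψ x - q x) (ae_of_all _ fun x => by
          simp only [q]
          rw [← sub_mul, norm_mul, mul_comm L]
          exact mul_le_mul (he r hr x) (hψ.abs_sderiv_le x) (norm_nonneg _)
            ((abs_nonneg _).trans (he r hr x)))
      simpa using this
    have h2 : |(∫ x, q x ∂(μ r : Measure K)) - ∫ x, q x ∂(μ t : Measure K)| ≤ C₁ * P * h := by
      rw [hμ.integral_sub_eq hV hq ht hr0]
      have := intervalIntegral.norm_integral_le_of_norm_le_const (a := t) (b := r)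
        (f := flux V μ q) (C := C₁ * P) fun s _ => abs_flux_le hV μ hqd s
      refine this.trans (mul_le_mul_of_nonneg_left ?_ (mul_nonneg hV.pos₁.le hP0))
      rw [abs_of_nonneg (by linarith [hr.1])]
      linarith [hr.2]
    exact (abs_sub_le _ _ _).trans (add_le_add h1 h2)
  have hA : |(∫ r in t..(t + h), flux V μ ψ r) - h * ∫ x, q x ∂(μ t : Measure K)| ≤
      L * (∫ r in t..(t + h), e r) + C₁ * P * h * h := by
    have e1 : (∫ r in t..(t + h), flux V μ ψ r) - h * ∫ x, q x ∂(μ t : Measure K) =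
        ∫ r in t..(t + h), (flux V μ ψ r - ∫ x, q x ∂(μ t : Measure K)) := by
      rw [intervalIntegral.integral_sub (hμ.intervalIntegrable_flux hV hψ.toIsSpaceTest ht
        (ht.trans htt)) intervalIntegrable_const, intervalIntegral.integral_const]
      simp
    have e2 : L * (∫ r in t..(t + h), e r) + C₁ * P * h * h =
        ∫ r in t..(t + h), (L * e r + C₁ * P * h) := by
      rw [intervalIntegral.integral_add ((hec.const_mul L).intervalIntegrable _ _)
        intervalIntegrable_const, intervalIntegral.integral_const_mul,
        intervalIntegral.integral_const]
      simp [mul_comm]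
    rw [e1, e2]
    have hg : Continuous fun r => L * e r + C₁ * P * h := (hec.const_mul L).add continuous_const
    rw [← Real.norm_eq_abs]
    refine intervalIntegral.norm_integral_le_of_norm_le htt (ae_of_all _ fun r hr => ?_)
      (hg.intervalIntegrable _ _)
    exact hflux r ⟨hr.1.le, hr.2⟩
  have hB : |(∫ x, eulerComp h β ψ x ∂(μ t : Measure K)) - (∫ x, ψ x ∂(μ t : Measure K)) -
      h * ∫ x, q x ∂(μ t : Measure K)| ≤ M * (h * C₁) ^ 2 := by
    have hs := (hψ.eulerComp hβ hh).toIsSpaceTest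
    have i1 : Integrable (fun x => eulerComp h β ψ x - ψ x) (μ t : Measure K) :=
      (hs.integrable _).sub (hψ.integrable _)
    rw [← integral_const_mul, ← integral_sub (hs.integrable _) (hψ.integrable _),
      ← integral_sub i1 ((hq.integrable _).const_mul _)]
    have := norm_integral_le_of_norm_le_const (μ := (μ t : Measure K)) (C := M * (h * C₁) ^ 2)
      (f := fun x => eulerComp h β ψ x - ψ x - h * q x) (ae_of_all _ fun x => by
        have h1 := hψ.abs_taylor_le x (h * β x)
        have h2 : (h * β x) ^ 2 ≤ (h * C₁) ^ 2 := by
          rw [mul_pow, mul_pow, ← sq_abs (β x)]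
          exact mul_le_mul_of_nonneg_left
            (pow_le_pow_left₀ (abs_nonneg _) (hβ.abs_le x) 2) (sq_nonneg h)
        have h3 := h1.trans (mul_le_mul_of_nonneg_left h2 hM0)
        rwa [mul_assoc] at h3)
    simpa using this
  have hE := hμ.integral_sub_eq hV hψ.toIsSpaceTest ht (ht.trans htt)
  have hsplit : (∫ x, ψ x ∂(μ (t + h) : Measure K)) - ∫ x, eulerComp h β ψ x ∂(μ t : Measure K) =
      ((∫ r in t..(t + h), flux V μ ψ r) - h * ∫ x, q x ∂(μ t : Measure K)) -
      ((∫ x, eulerComp h β ψ x ∂(μ t : Measure K)) - (∫ x, ψ x ∂(μ t : Measure K)) -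
        h * ∫ x, q x ∂(μ t : Measure K)) := by
    rw [← hE]; ring
  rw [hsplit]
  refine (abs_sub _ _).trans ((add_le_add hA hB).trans (le_of_eq ?_))
  ring

end Stability

variable {K : Domain}

lemma IsVelocity.isSmoothField_mollify {V : Measure K → K → ℝ} {C₁ C₂ C₃ : ℝ}
    (hV : IsVelocity V C₁ C₂ C₃) (ρ : ContDiffBump (0 : ℝ)) (ν : ProbabilityMeasure K) :
    IsSmoothField C₁ C₂ ((∫ z, |deriv (ρ.normed volume) z|) * C₂) (mollify ρ (V ν)) :=
  ⟨contDiff_mollify ρ (hV.continuous ν), abs_mollify_le ρ (hV.continuous ν) (hV.abs_le ν),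
    abs_sderiv_mollify_le ρ (hV.continuous ν) (hV.abs_sub_le ν) hV.pos₂.le,
    abs_sderiv_sderiv_mollify_le ρ (hV.continuous ν) (hV.abs_sub_le ν) hV.pos₂.le⟩

/-- Backward Euler steps preserve the scale of test functions with derivative bounds that grow
exponentially with the remaining time `τ`. -/
lemma IsSpaceTestWith.eulerComp_exp {C₁ C₂ B M₀ h τ : ℝ} {β ψ : K → ℝ}
    (hψ : IsSpaceTestWith (Real.exp (C₂ * τ)) (Real.exp (C₂ * τ) ^ 2 * (M₀ + B * τ)) ψ)
    (hβ : IsSmoothField C₁ C₂ B β) (hh : 0 ≤ h) (hC₂ : 0 ≤ C₂) (hB : 0 ≤ B) (hM₀ : 0 ≤ M₀)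
    (hτ : 0 ≤ τ) :
    IsSpaceTestWith (Real.exp (C₂ * (τ + h)))
      (Real.exp (C₂ * (τ + h)) ^ 2 * (M₀ + B * (τ + h))) (LaxFriedrichs.eulerComp h β ψ) := by
  have hF : 1 + h * C₂ ≤ Real.exp (C₂ * h) := by
    have := Real.add_one_le_exp (C₂ * h)
    linarith
  have hF0 : 0 ≤ 1 + h * C₂ := by positivity
  have hE : 1 ≤ Real.exp (C₂ * τ) := Real.one_le_exp (by positivity)
  have hG : 1 ≤ Real.exp (C₂ * h) := Real.one_le_exp (by positivity)
  refine (hψ.eulerComp hβ hh).mono ?_ ?_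
  · rw [mul_add C₂, Real.exp_add]
    exact mul_le_mul_of_nonneg_left hF (Real.exp_pos _).le
  · rw [mul_add C₂, Real.exp_add]
    set E := Real.exp (C₂ * τ)
    set G := Real.exp (C₂ * h)
    have h1 : (1 + h * C₂) ^ 2 ≤ G ^ 2 := pow_le_pow_left₀ hF0 hF 2
    have h2 := mul_le_mul_of_nonneg_left h1 (by positivity : 0 ≤ E ^ 2 * (M₀ + B * τ))
    -- A wasteful bound, chosen so that the recursion for the second derivative has a closed form.
    have h3 : E ≤ (E * G) ^ 2 := by
      have : 1 ≤ E * G := one_le_mul_of_one_le_of_one_le hE hG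
      nlinarith
    have h4 := mul_le_mul_of_nonneg_right h3 (mul_nonneg hh hB)
    calc _ ≤ E ^ 2 * (M₀ + B * τ) * G ^ 2 + (E * G) ^ 2 * (h * B) := add_le_add h2 h4
      _ = _ := by ring

/-! ### Stability of an arbitrary solution relative to a time-Lipschitz one. -/

section Stability

variable {V : Measure K → K → ℝ} {C₁ C₂ C₃ : ℝ} (hV : IsVelocity V C₁ C₂ C₃)
  {μ₀ : ProbabilityMeasure K} {μ ν : ℝ → ProbabilityMeasure K}
  (hμ : IsMeasureValuedSolution V μ₀ μ) (hν : IsMeasureValuedSolution V μ₀ ν)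
  (hνL : ∀ s t, wassersteinDist (ν s : Measure K) (ν t) ≤ ENNReal.ofReal (C₁ * |s - t|))
  {T : ℝ} {g : ℝ → ℝ} (hgc : Continuous g)
  (hg : ∀ r ∈ Icc 0 T, ∀ x, |V (μ r : Measure K) x - V (ν r : Measure K) x| ≤ g r)
include hV hμ hν hνL hgc hg

/-- Induction on the number of steps: the difference tested with `ψ` at time `(n + 1) h` is, up to
consistency errors, the difference at time `n h` tested with the pulled-back `ψ`. The derivative
bounds are indexed by the remaining time `T - n h`, so they fit together. -/
lemma abs_integral_sub_le_of_steps (ρ : ContDiffBump (0 : ℝ)) {M₀ B h S P : ℝ} (hh : 0 ≤ h)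
    (hM₀ : 0 ≤ M₀) (hB : B = (∫ z, |deriv (ρ.normed volume) z|) * C₂)
    (hS : S = Real.exp (C₂ * T))
    (hP : P = C₁ * (C₂ * S + C₁ * (S ^ 2 * (M₀ + B * T))) + C₁ ^ 2 * (S ^ 2 * (M₀ + B * T)))
    (n : ℕ) (hn : n * h ≤ T) {ψ : K → ℝ}
    (hψ : IsSpaceTestWith (Real.exp (C₂ * (T - n * h)))
      (Real.exp (C₂ * (T - n * h)) ^ 2 * (M₀ + B * (T - n * h))) ψ) :
    |(∫ x, ψ x ∂(μ (n * h) : Measure K)) - ∫ x, ψ x ∂(ν (n * h) : Measure K)| ≤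
      S * (∫ r in 0..(n * h), g r) +
        n * h * (2 * S * (C₃ * (C₁ * h) + C₂ * ρ.rOut) + 2 * (h * P)) := by
  have hB0 : 0 ≤ B := by
    rw [hB]
    exact mul_nonneg (integral_nonneg fun _ => abs_nonneg _) hV.pos₂.le
  induction n generalizing ψ with
  | zero =>
    simp only [Nat.cast_zero, zero_mul, intervalIntegral.integral_same, mul_zero, add_zero]
    rw [hμ.integral_eq hV hψ.toIsSpaceTest le_rfl, hν.integral_eq hV hψ.toIsSpaceTest le_rfl]
    simp
  | succ n ih =>
    set t := n * h with ht
    have ht0 : 0 ≤ t := by positivity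
    have hsucc : ((n + 1 : ℕ) : ℝ) * h = t + h := by rw [ht]; push_cast; ring
    rw [hsucc] at hψ hn
    have htT : t ≤ T := by linarith
    rw [hsucc]
    set τ := T - (t + h) with hτ
    have hτ0 : 0 ≤ τ := by linarith
    have hτT : τ ≤ T := by linarith
    -- The field is frozen at the start of the step; `hνL` bounds the cost of freezing by `C₃ * (C₁
    -- * h)`.
    set β := mollify ρ (V (ν t : Measure K)) with hβdef
    have hβ : IsSmoothField C₁ C₂ B β := hB ▸ hV.isSmoothField_mollify ρ (ν t)
    have hcomp := hψ.eulerComp_exp hβ hh hV.pos₂.le hB0 hM₀ hτ0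
    have hτh : τ + h = T - t := by rw [hτ]; ring
    rw [hτh] at hcomp
    have hI := ih htT hcomp
    set κ := C₃ * (C₁ * h) + C₂ * ρ.rOut with hκ
    have hκ0 : 0 ≤ κ := add_nonneg
      (mul_nonneg hV.pos₃.le (mul_nonneg hV.pos₁.le hh)) (mul_nonneg hV.pos₂.le ρ.rOut_pos.le)
    have heν : ∀ r ∈ Icc t (t + h), ∀ x, |V (ν r : Measure K) x - β x| ≤ κ := by
      intro r hr x
      have hrt : |r - t| ≤ h := abs_le.2 ⟨by linarith [hr.1], by linarith [hr.2]⟩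
      have h1 := hV.abs_sub_le_of_wassersteinDist_le (mul_nonneg hV.pos₁.le (abs_nonneg (r - t)))
        (hνL r t) x
      have h2 := abs_mollify_sub_self_le ρ (hV.continuous (ν t)) (hV.abs_sub_le (ν t)) hV.pos₂.le x
      rw [abs_sub_comm] at h2
      have h3 := mul_le_mul_of_nonneg_left (mul_le_mul_of_nonneg_left hrt hV.pos₁.le) hV.pos₃.le
      exact (abs_sub_le _ _ _).trans (add_le_add (h1.trans h3) h2)
    have heμ : ∀ r ∈ Icc t (t + h), ∀ x, |V (μ r : Measure K) x - β x| ≤ g r + κ := fun r hr x =>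
      (abs_sub_le _ _ _).trans (add_le_add (hg r ⟨ht0.trans hr.1, hr.2.trans hn⟩ x) (heν r hr x))
    have hgκ : Continuous fun r => g r + κ := hgc.add continuous_const
    have hsμ := hμ.euler_step hV hψ hβ hh ht0 hgκ heμ
    have hsν := hν.euler_step hV hψ hβ hh ht0 (continuous_const (y := κ)) heν
    have hExp : Real.exp (C₂ * τ) ≤ S := by
      rw [hS]; exact Real.exp_le_exp.2 (mul_le_mul_of_nonneg_left hτT hV.pos₂.le)
    have hExp0 := (Real.exp_pos (C₂ * τ)).le
    have hS0 : 0 ≤ S := hExp0.trans hExp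
    have hMle : Real.exp (C₂ * τ) ^ 2 * (M₀ + B * τ) ≤ S ^ 2 * (M₀ + B * T) := by
      have : M₀ + B * τ ≤ M₀ + B * T := by
        have := mul_le_mul_of_nonneg_left hτT hB0
        linarith
      exact mul_le_mul (pow_le_pow_left₀ hExp0 hExp 2) this (by positivity) (by positivity)
    have hPle : h ^ 2 * (C₁ * (C₂ * Real.exp (C₂ * τ) +
        C₁ * (Real.exp (C₂ * τ) ^ 2 * (M₀ + B * τ))) +
        C₁ ^ 2 * (Real.exp (C₂ * τ) ^ 2 * (M₀ + B * τ))) ≤ h ^ 2 * P := by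
      have p1 := hV.pos₁.le
      have p2 := hV.pos₂.le
      rw [hP]
      gcongr
    have hg0 : 0 ≤ ∫ r in t..(t + h), g r :=
      intervalIntegral.integral_nonneg (by linarith) fun r hr =>
        (abs_nonneg _).trans (hg r ⟨ht0.trans hr.1, hr.2.trans hn⟩ 0)
    have hgi : ∀ a b, IntervalIntegrable g volume a b := fun a b => hgc.intervalIntegrable a b
    have hint1 : ∫ r in t..(t + h), (g r + κ) = (∫ r in t..(t + h), g r) + h * κ := by
      rw [intervalIntegral.integral_add (hgi _ _) intervalIntegrable_const,
        intervalIntegral.integral_const]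
      simp
    have hint2 : ∫ _ in t..(t + h), κ = h * κ := by
      rw [intervalIntegral.integral_const]; simp
    have hint3 : ∫ r in 0..(t + h), g r = (∫ r in 0..t, g r) + ∫ r in t..(t + h), g r :=
      (intervalIntegral.integral_add_adjacent_intervals (hgi _ _) (hgi _ _)).symm
    rw [hint1] at hsμ
    rw [hint2] at hsν
    have a1 := mul_le_mul_of_nonneg_right hExp (add_nonneg hg0 (mul_nonneg hh hκ0))
    have a2 := mul_le_mul_of_nonneg_right hExp (mul_nonneg hh hκ0)
    rw [hint3]
    have b1 := abs_le.1 hsμ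
    have b2 := abs_le.1 hsν
    have b3 := abs_le.1 hI
    have hth : (t + h) * (2 * S * κ + 2 * (h * P)) =
        t * (2 * S * κ + 2 * (h * P)) + 2 * (S * (h * κ)) + 2 * (h ^ 2 * P) := by
      ring
    rw [hth, abs_le]
    constructor <;> linarith [b1.1, b1.2, b2.1, b2.2, b3.1, b3.2]

/-- Order of limits: for a fixed kernel the step size `T / (N + 1)` tends to zero, which removes the
terms with second derivatives; afterwards the radius tends to zero. -/
lemma abs_integral_sub_le (hT : 0 ≤ T) {ψ : K → ℝ} (hψ : IsSpaceTest ψ)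
    (hψ1 : ∀ x, |sderiv ψ x| ≤ 1) :
    |(∫ x, ψ x ∂(μ T : Measure K)) - ∫ x, ψ x ∂(ν T : Measure K)| ≤
      Real.exp (C₂ * T) * ∫ r in 0..T, g r := by
  obtain ⟨M₀, hM₀⟩ := hψ.sderiv.sderiv.exists_bound
  have hM₀0 : 0 ≤ M₀ := (abs_nonneg _).trans (hM₀ 0)
  set S := Real.exp (C₂ * T) with hS
  have key : ∀ ρ : ContDiffBump (0 : ℝ),
      |(∫ x, ψ x ∂(μ T : Measure K)) - ∫ x, ψ x ∂(ν T : Measure K)| ≤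
        S * (∫ r in 0..T, g r) + T * (2 * S * (C₂ * ρ.rOut)) := by
    intro ρ
    set B := (∫ z, |deriv (ρ.normed volume) z|) * C₂ with hB
    set P := C₁ * (C₂ * S + C₁ * (S ^ 2 * (M₀ + B * T))) + C₁ ^ 2 * (S ^ 2 * (M₀ + B * T)) with hP
    have hlim : Filter.Tendsto (fun N : ℕ => S * (∫ r in 0..T, g r) +
        T * (2 * S * (C₃ * (C₁ * (T * (1 / ((N : ℝ) + 1)))) + C₂ * ρ.rOut) +
          2 * (T * (1 / ((N : ℝ) + 1)) * P))) Filter.atTop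
        (nhds (S * (∫ r in 0..T, g r) + T * (2 * S * (C₂ * ρ.rOut)))) := by
      have h0 := (tendsto_one_div_add_atTop_nhds_zero_nat (𝕜 := ℝ)).const_mul T
      have h1 := (((((h0.const_mul C₁).const_mul C₃).add_const (C₂ * ρ.rOut)).const_mul
        (2 * S)).add ((h0.mul_const P).const_mul 2)).const_mul T
      simpa using h1.const_add (S * (∫ r in 0..T, g r))
    refine ge_of_tendsto' hlim fun N => ?_
    have hN : ((N + 1 : ℕ) : ℝ) * (T * (1 / ((N : ℝ) + 1))) = T := by
      push_cast; field_simp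
    have h := abs_integral_sub_le_of_steps hV hμ hν hνL hgc hg ρ (h := T * (1 / ((N : ℝ) + 1)))
      (by positivity) hM₀0 hB hS hP (N + 1) hN.le (ψ := ψ) (by
        rw [hN]
        exact ⟨hψ, by simpa using hψ1, by simpa using hM₀⟩)
    rwa [hN] at h
  refine le_of_forall_pos_le_add fun ε hε => ?_
  have hS0 : 0 < S := Real.exp_pos _
  have hp := hV.pos₂
  -- This radius makes the remaining mollification error at most `ε`; the `+ 1` avoids division by
  -- zero when `T = 0`.
  have hc : 0 < ε / (T * (2 * S * C₂) + 1) := by positivity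
  have := key ⟨_ / 2, ε / (T * (2 * S * C₂) + 1), half_pos hc, half_lt_self hc⟩
  refine this.trans (add_le_add_right ?_ _)
  have e : T * (2 * S * (C₂ * (ε / (T * (2 * S * C₂) + 1)))) =
      ε * ((T * (2 * S * C₂)) / (T * (2 * S * C₂) + 1)) := by ring
  change T * (2 * S * (C₂ * (ε / (T * (2 * S * C₂) + 1)))) ≤ ε
  rw [e]
  exact mul_le_of_le_one_right hε.le ((div_le_one (by positivity)).2 (by linarith))

end Stability

/-! ### Uniqueness by iterating the stability estimate. -/

section Uniqueness

variable {V : Measure K → K → ℝ} {C₁ C₂ C₃ : ℝ} (hV : IsVelocity V C₁ C₂ C₃)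
  {μ₀ : ProbabilityMeasure K} {μ ν : ℝ → ProbabilityMeasure K}
  (hμ : IsMeasureValuedSolution V μ₀ μ) (hν : IsMeasureValuedSolution V μ₀ ν)
  (hνL : ∀ s t, wassersteinDist (ν s : Measure K) (ν t) ≤ ENNReal.ofReal (C₁ * |s - t|))
include hV hμ hν hνL

lemma wassersteinDist_le_of_abs_velocity_sub_le {T : ℝ} (hT : 0 ≤ T) {g : ℝ → ℝ}
    (hgc : Continuous g)
    (hg : ∀ r ∈ Icc 0 T, ∀ x, |V (μ r : Measure K) x - V (ν r : Measure K) x| ≤ g r) :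
    wassersteinDist (μ T : Measure K) (ν T) ≤
      ENNReal.ofReal (Real.exp (C₂ * T) * ∫ r in 0..T, g r) := by
  refine wassersteinDist_le_of_isSpaceTest fun ψ hψ hψ1 => ?_
  have h := abs_integral_sub_le hV hμ hν hνL hgc hg hT hψ hψ1
  rw [abs_sub_comm] at h
  exact (le_abs_self _).trans h

/-- Start from the trivial velocity bound `2 * C₁` and feed each distance bound back through (A3).
With the weight `exp (κ t)` and this `κ`, every round gains a factor `1 / 2`. Compared with
Gronwall's lemma, this requires neither finiteness nor measurability in time of the unknown distance
beforehand, since the bounds used are explicit continuous functions. -/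
lemma wassersteinDist_solutions_le {T : ℝ} (hT : 0 ≤ T) {κ : ℝ}
    (hκ : κ = 2 * (Real.exp (C₂ * T) * C₃)) (k : ℕ) :
    ∀ t ∈ Icc 0 T, wassersteinDist (μ t : Measure K) (ν t) ≤
      ENNReal.ofReal (Real.exp (C₂ * T) * (2 * C₁ * T) * (1 / 2) ^ k * Real.exp (κ * t)) := by
  have hS : ∀ t ∈ Icc 0 T, Real.exp (C₂ * t) ≤ Real.exp (C₂ * T) := fun t ht =>
    Real.exp_le_exp.2 (mul_le_mul_of_nonneg_left ht.2 hV.pos₂.le)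
  have hS0 : 0 < Real.exp (C₂ * T) := Real.exp_pos _
  set S := Real.exp (C₂ * T)
  have p1 := hV.pos₁
  have p3 := hV.pos₃
  have hκ0 : 0 < κ := by rw [hκ]; positivity
  induction k with
  | zero =>
    intro t ht
    have h := wassersteinDist_le_of_abs_velocity_sub_le hV hμ hν hνL ht.1
      (continuous_const (y := 2 * C₁)) fun r _ x => by
        refine (abs_sub _ _).trans ?_
        have h1 := hV.abs_le (μ r) x
        have h2 := hV.abs_le (ν r) x
        linarith
    refine h.trans (ENNReal.ofReal_le_ofReal ?_)
    rw [intervalIntegral.integral_const, sub_zero, smul_eq_mul, pow_zero, mul_one]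
    have h1 : 1 ≤ Real.exp (κ * t) := Real.one_le_exp (mul_nonneg hκ0.le ht.1)
    have h2 : t * (2 * C₁) ≤ 2 * C₁ * T := by nlinarith [ht.2]
    calc Real.exp (C₂ * t) * (t * (2 * C₁)) ≤ S * (2 * C₁ * T) :=
          mul_le_mul (hS t ht) h2 (mul_nonneg ht.1 (by positivity)) hS0.le
      _ ≤ S * (2 * C₁ * T) * Real.exp (κ * t) := le_mul_of_one_le_right (by positivity) h1
  | succ k ih =>
    intro t ht
    set A := S * (2 * C₁ * T) * (1 / 2) ^ k with hA
    have hA0 : 0 ≤ A := by positivity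
    have hgc : Continuous fun r => C₃ * (A * Real.exp (κ * r)) := by fun_prop
    have h := wassersteinDist_le_of_abs_velocity_sub_le hV hμ hν hνL ht.1 hgc fun r hr x =>
      hV.abs_sub_le_of_wassersteinDist_le (by positivity) (ih r ⟨hr.1, hr.2.trans ht.2⟩) x
    refine h.trans (ENNReal.ofReal_le_ofReal ?_)
    have hinteg : ∫ r in 0..t, C₃ * (A * Real.exp (κ * r)) =
        C₃ * A * ((Real.exp (κ * t) - 1) / κ) := by
      simp_rw [← mul_assoc]
      rw [intervalIntegral.integral_const_mul, intervalIntegral.integral_comp_mul_left _ hκ0.ne',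
        integral_exp, mul_zero, Real.exp_zero, smul_eq_mul]
      ring
    rw [hinteg]
    have h1 : 1 ≤ Real.exp (κ * t) := Real.one_le_exp (mul_nonneg hκ0.le ht.1)
    have hnn : 0 ≤ C₃ * A * ((Real.exp (κ * t) - 1) / κ) :=
      mul_nonneg (by positivity) (div_nonneg (by linarith) hκ0.le)
    calc Real.exp (C₂ * t) * (C₃ * A * ((Real.exp (κ * t) - 1) / κ))
        ≤ S * (C₃ * A * ((Real.exp (κ * t) - 1) / κ)) :=
          mul_le_mul_of_nonneg_right (hS t ht) hnn
      _ = A * (1 / 2) * (Real.exp (κ * t) - 1) := by rw [hκ]; field_simp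
      _ ≤ A * (1 / 2) * Real.exp (κ * t) := by
          refine mul_le_mul_of_nonneg_left (by linarith) (by positivity)
      _ = _ := by rw [hA, pow_succ]; ring

omit hV hμ hν hνL in
-- Bounded Lipschitz functions determine weak convergence, so the constant sequence `ν₁` converges
-- to `ν₂`, and weak limits are unique.
lemma eq_of_wassersteinDist_eq_zero {ν₁ ν₂ : ProbabilityMeasure K}
    (h : wassersteinDist (ν₁ : Measure K) (ν₂ : Measure K) = 0) : ν₁ = ν₂ := by
  have key : ∀ ψ : K →ᵇ ℝ, LipschitzWith 1 ψ →
      ∫ x, ψ x ∂(ν₁ : Measure K) = ∫ x, ψ x ∂(ν₂ : Measure K) := by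
    intro ψ hψ
    have h0 : wassersteinDist (ν₁ : Measure K) (ν₂ : Measure K) ≤ ENNReal.ofReal 0 := by simp [h]
    have h1 := integral_sub_le_of_wassersteinDist_le le_rfl h0 ψ hψ
    have h2 := integral_sub_le_of_wassersteinDist_le le_rfl h0 (-ψ) hψ.neg
    simp only [BoundedContinuousFunction.coe_neg, Pi.neg_apply, integral_neg] at h2
    linarith
  have ht : Filter.Tendsto (fun _ : ℕ => ν₁) Filter.atTop (nhds ν₂) := by
    rw [tendsto_iff_forall_lipschitz_integral_tendsto]
    rintro f ⟨C, hC⟩ ⟨L, hL⟩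
    -- Rescaling makes the Lipschitz constant at most `1`; `L + 1` is nonzero even when `L = 0`.
    let c : ℝ := ((L : ℝ) + 1)⁻¹
    have hc : 0 < c := by positivity
    have hlip : LipschitzWith 1 fun x => c * f x := by
      refine LipschitzWith.of_dist_le_mul fun x y => ?_
      have h1 := hL.dist_le_mul x y
      rw [Real.dist_eq] at h1 ⊢
      rw [← mul_sub, abs_mul, abs_of_pos hc, NNReal.coe_one, one_mul, inv_mul_le_iff₀ (by positivity)]
      nlinarith [dist_nonneg (x := x) (y := y)]
    let ψ : K →ᵇ ℝ := BoundedContinuousFunction.mkOfBound ⟨fun x => c * f x, hlip.continuous⟩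
      (c * C) fun x y => by
        change dist (c * f x) (c * f y) ≤ _
        rw [Real.dist_eq, ← mul_sub, abs_mul, abs_of_pos hc]
        exact mul_le_mul_of_nonneg_left (hC x y) hc.le
    have h1 := key ψ hlip
    change ∫ x, c * f x ∂(ν₁ : Measure K) = ∫ x, c * f x ∂(ν₂ : Measure K) at h1
    rw [integral_const_mul, integral_const_mul] at h1
    rw [mul_left_cancel₀ hc.ne' h1]
    exact tendsto_const_nhds
  exact tendsto_nhds_unique tendsto_const_nhds ht

lemma IsMeasureValuedSolution.unique {t : ℝ} (ht : 0 ≤ t) : μ t = ν t := by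
  refine eq_of_wassersteinDist_eq_zero (le_antisymm ?_ zero_le)
  have hlim : Filter.Tendsto (fun k : ℕ => ENNReal.ofReal (Real.exp (C₂ * t) * (2 * C₁ * t) *
      (1 / 2) ^ k * Real.exp (2 * (Real.exp (C₂ * t) * C₃) * t))) Filter.atTop (nhds 0) := by
    rw [← ENNReal.ofReal_zero]
    refine ENNReal.tendsto_ofReal ?_
    have := ((tendsto_pow_atTop_nhds_zero_of_lt_one (r := (1 / 2 : ℝ)) (by norm_num)
      (by norm_num)).const_mul (Real.exp (C₂ * t) * (2 * C₁ * t))).mul_const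
      (Real.exp (2 * (Real.exp (C₂ * t) * C₃) * t))
    simpa using this
  exact ge_of_tendsto' hlim fun k =>
    wassersteinDist_solutions_le hV hμ hν hνL ht rfl k t ⟨ht, le_rfl⟩

end Uniqueness

/-- A probability measure on `K` lifts to a probability measure on the real line. -/
lemma exists_law_zero_eq (μ₀ : ProbabilityMeasure K) :
    ∃ m : ProbabilityMeasure ℝ, law K m 0 = μ₀ := by
  obtain ⟨s, hs, hsp⟩ := K.exists_measurable_section
  refine ⟨μ₀.map hs.aemeasurable, Subtype.ext ?_⟩
  change ((μ₀ : Measure K).map s).map (fun y => K.proj (y + (0 : ℝ →ᵇ ℝ) y)) = μ₀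
  rw [Measure.map_map (continuous_proj_add 0).measurable hs]
  have : (fun y => K.proj (y + (0 : ℝ →ᵇ ℝ) y)) ∘ s = id := by
    ext x
    simp [hsp]
  rw [this, Measure.map_id]

end LaxFriedrichs

theorem theorem2p4 (K : Domain)
    -- the velocity field; only its values on probability measures are constrained
    (V : Measure K → K → ℝ) (C₁ C₂ C₃ : ℝ) (hC₁ : 0 < C₁) (hC₂ : 0 < C₂) (hC₃ : 0 < C₃)
    (hA1 : ∀ (ν : ProbabilityMeasure K) (x : K), |V ν x| ≤ C₁)
    (hA2 : ∀ (ν : ProbabilityMeasure K) (x y : K), |V ν x - V ν y| ≤ C₂ * dist x y)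
    (hA3 : ∀ (ν₁ ν₂ : ProbabilityMeasure K) (x : K),
      ENNReal.ofReal |V ν₁ x - V ν₂ x| ≤
        ENNReal.ofReal C₃ * wassersteinDist (ν₁ : Measure K) (ν₂ : Measure K))
    (μ₀ : ProbabilityMeasure K) (hμ₀ : IsCompact (μ₀ : Measure K).support)
    (lam₀ : ℝ) (hlam₀ : 0 < lam₀) :
    ∃ μ : ℝ → ProbabilityMeasure K,
      IsMeasureValuedSolution V μ₀ μ ∧
      (∀ μ' : ℝ → ProbabilityMeasure K, IsMeasureValuedSolution V μ₀ μ' →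
        ∀ t : ℝ, 0 ≤ t → μ' t = μ t) ∧
      ∀ T : ℝ, 0 < T → ∀ ε : ℝ, 0 < ε → ∃ δ : ℝ, 0 < δ ∧
        ∀ (M : Mesh K) (dt : ℝ), M.dx < δ → lam₀ ≤ dt / M.dx → dt / M.dx ≤ C₁⁻¹ →
          (⨆ t ∈ Icc (0 : ℝ) T,
            wassersteinDist (M.interpolant V μ₀ dt t) (μ t : Measure K)) ≤ ENNReal.ofReal ε := by
  have hV : IsVelocity V C₁ C₂ C₃ := ⟨hC₁, hC₂, hC₃, hA1, hA2, hA3⟩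
  obtain ⟨m, hm⟩ := exists_law_zero_eq μ₀
  obtain ⟨Z, hZ0, hZ⟩ := hV.exists_flow m
  have hsol := flow_isMeasureValuedSolution hZ hZ0 hm
  refine ⟨fun t => law K m (Z t), hsol, fun μ' hμ' t ht => ?_, fun T hT ε hε => ?_⟩
  · exact IsMeasureValuedSolution.unique hV hμ' hsol (fun s t => wassersteinDist_flow_le hZ s t) ht
  · exact interpolant_tendsto_flow hm hZ hZ0 hlam₀ hT hε
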